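/- Consider the three delay-differential equations (with $\bar u(z)=u(z+1)$, $\underline u(z)=u(z-1)$, complex parameters, $b,q,\alpha\neq 0$) $$\text{(1.1)}\ \ u(\bar u-\underline u)=au-bu',\qquad \text{(1.2)}\ \ v^2(\bar v-\underline v)=pv+qv',\qquad \text{(1.3)}\ \ \bar w\,w=\underline w(\lambda z w+\alpha w').$$ **Setting.** Fix a base point $z_0\in\mathbb C$ and put $\zeta=z-z_0$. Let $J^r$ be the space of $r$-jets at $z_0$ of local sections $(x,y)$ of the trivial bundle with fibre $\mathbb P^1\times\mathbb P^1$; it is glued from four charts $\mathbb C^{2r+2}$, whose coordinates are the Taylor coefficients up to order $r$ in the charts $(x,y),(X,y),(x,Y),(X,Y)$ of $\mathbb P^1\times\mathbb P^1$, $X=1/x$, $Y=1/y$. Topological terms refer to the Zariski topology. Each equation induces a map on sections, $(x,y)=(u,\underline u)\mapsto(\bar x,\bar y)=(\bar u,u)$ (defined if $x\not\equiv0$), and the image in $J^r$ of a set of jets in $J^{r+1}$ is the set of $r$-jets of the images of all sections whose $(r+1)$-jet lies in that set. For a subvariety (irreducible locally closed subset) $B\subset J^{r+1}$, let $\operatorname{codim}\varphi(B)$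 be the codimension in $J^r$ of the image of a sufficiently small dense open part of $B$ (the other coefficients being generic), that is, the supremum of the codimensions of the images of the nonempty open subsets of $B$. The set $B$ is a *blow-down type singularity* if $\operatorname{codim}\varphi(B)>\operatorname{codim}B$. It is *accessible* if it contains the jet of a section obtained by iterating the equation some number $k\ge 0$ of times, starting from a section both of whose components are regular and nonzero at the (correspondingly shifted) base point, such that none of the earlier sections already lies on a blow-down type singularity. Define in the $(x,y)$-chart of $J^{r+1}$, for (1.1) and (1.2), $$B_m=\{x_0=\dots=x_{m-1}=0\}\quad (0\le m\le M:=r+2),$$ and for (1.3) $$B_m=\Big\{\tfrac{d^i}{dz^i}\big(\lambda z\,x(z)+\alpha x'(z)\big)\big|_{z=z_0}=0,\ i=0,\dots,m-1\Big\}\quad (0\le m\le M:=r+1).$$ **Statement.** For each of the three equations and every $z_0$, the sets $B_m$ with $m\geq 1$ are the only accessible blow-down type singularities, in the following sense. 1. If $r\ge1$ and $1\le m\le r+1$, then $B_m\subset J^{r+1}$ is an accessible blow-down type singularity of codimension $m$. 2. Let $r\ge0$ and let $S\subset J^{r+1}$ be any accessible blow-down type singularity. Then the largest $m\le M$ with $S\subset\overline{B_m}$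 exists and satisfies $m\ge1$, and for it $$\operatorname{codim}\varphi(S)-\operatorname{codim}S\ \le\ \operatorname{codim}\varphi(B_m)-m .$$ Thus every accessible blow-down type singularity lies in some $B_m$, $m\ge1$, and inside $B_m$, away from $B_{m+1}$, the map causes no increase of codimension beyond that of $B_m$ itself. -/

import Mathlib

noncomputable section

namespace DelayPainleve

/-! ### Sections of the trivial bundle with fibre `ℙ¹ × ℙ¹`, near a fixed point

A section over a neighbourhood of `z₀` is a pair `(x, y)` of germs with values in `ℙ¹`.  It is
recorded by the two Laurent expansions in `ζ = z - z₀` (a pole is the value `∞`).  Only finitely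
many coefficients ever enter a jet, so formal expansions and convergent ones have the same jets;
the germ that is identically `∞` is left out since it has the same `r`-jet as `ζ⁻ⁿ` for `n > r`. -/

/-- Expansions `∑ fₙ ζⁿ` with finitely many polar terms. -/
abbrev Germ : Type := LaurentSeries ℂ

/-- The germ takes a finite value at the base point. -/
def Regular (f : Germ) : Prop := ∃ p : PowerSeries ℂ, f = (p : LaurentSeries ℂ)

/-- The two affine coordinates on `ℙ¹`: `x` (for `false`) and `X = 1 / x` (for `true`). -/
def localCoord (e : Bool) (f : Germ) : Germ := if e then f⁻¹ else f

/-- The germ is visible in the chart `e` of `ℙ¹` near the base point. -/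
def Visible (e : Bool) (f : Germ) : Prop := (e = true → f ≠ 0) ∧ Regular (localCoord e f)

/-- Two germs have the same `r`-jet: in a common chart their expansions agree up to order `r`. -/
def SameJet (r : ℕ) (f g : Germ) : Prop :=
  ∃ e : Bool, Visible e f ∧ Visible e g ∧
    ∀ i : ℕ, i ≤ r → (localCoord e f).coeff i = (localCoord e g).coeff i

theorem exists_visible (f : Germ) : ∃ e, Visible e f := by
  by_cases hf : f = 0
  · exact ⟨false, by simp, 0, by simp [localCoord, hf]⟩
  · rcases le_total 0 f.order with h | h
    · refine ⟨false, by simp, (PowerSeries.X ^ f.order.toNat * f.powerSeriesPart), ?_⟩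
      have := LaurentSeries.ofPowerSeries_powerSeriesPart f
      simp only [localCoord, Bool.false_eq_true, if_false]
      rw [map_mul, this, map_pow, HahnSeries.ofPowerSeries_X, HahnSeries.single_pow, ← mul_assoc,
        HahnSeries.single_mul_single]
      simp [Int.toNat_of_nonneg h]
    · have hf' : f⁻¹ ≠ 0 := inv_ne_zero hf
      have h1 : (f⁻¹).order = - f.order := by
        have := HahnSeries.order_mul hf hf'
        rw [mul_inv_cancel₀ hf, HahnSeries.order_one] at this
        omega
      have h2 : 0 ≤ (f⁻¹).order := by omega
      refine ⟨true, fun _ => hf, (PowerSeries.X ^ (f⁻¹).order.toNat * (f⁻¹).powerSeriesPart), ?_⟩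
      have := LaurentSeries.ofPowerSeries_powerSeriesPart f⁻¹
      simp only [localCoord, if_true]
      rw [map_mul, this, map_pow, HahnSeries.ofPowerSeries_X, HahnSeries.single_pow, ← mul_assoc,
        HahnSeries.single_mul_single]
      simp [Int.toNat_of_nonneg h2]

theorem inv_agree {r : ℕ} {F G : Germ} (hF : Regular F) (hG : Regular G)
    (h : ∀ i : ℕ, i ≤ r → F.coeff i = G.coeff i) (hG0 : G ≠ 0) (hG' : Regular G⁻¹) :
    F ≠ 0 ∧ Regular F⁻¹ ∧ ∀ i : ℕ, i ≤ r → (F⁻¹).coeff i = (G⁻¹).coeff i := by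
  obtain ⟨P, rfl⟩ := hF
  obtain ⟨Q, rfl⟩ := hG
  obtain ⟨Q', hQ'⟩ := hG'
  have hQQ : Q * Q' = 1 := by
    apply HahnSeries.ofPowerSeries_injective (Γ := ℤ)
    rw [map_mul, ← hQ', mul_inv_cancel₀ hG0, map_one]
  have hco : ∀ i : ℕ, i ≤ r → PowerSeries.coeff i P = PowerSeries.coeff i Q := by
    intro i hi
    simpa [HahnSeries.ofPowerSeries_apply_coeff] using h i hi
  have hQ0 : PowerSeries.constantCoeff Q ≠ 0 := by
    intro h0
    have := congrArg PowerSeries.constantCoeff hQQ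
    simp [h0] at this
  have hP0 : PowerSeries.constantCoeff P ≠ 0 := by
    have := hco 0 (Nat.zero_le _)
    rw [PowerSeries.coeff_zero_eq_constantCoeff_apply,
      PowerSeries.coeff_zero_eq_constantCoeff_apply] at this
    rwa [this]
  have hPP : P * P⁻¹ = 1 := PowerSeries.mul_inv_cancel P hP0
  have hPL : (P : LaurentSeries ℂ) * ((P⁻¹ : PowerSeries ℂ) : LaurentSeries ℂ) = 1 := by
    rw [← map_mul, hPP, map_one]
  have hPinv : (P : LaurentSeries ℂ)⁻¹ = ((P⁻¹ : PowerSeries ℂ) : LaurentSeries ℂ) :=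
    inv_eq_of_mul_eq_one_right hPL
  refine ⟨left_ne_zero_of_mul_eq_one hPL, ⟨_, hPinv⟩, ?_⟩
  intro i hi
  rw [hPinv, hQ', HahnSeries.ofPowerSeries_apply_coeff, HahnSeries.ofPowerSeries_apply_coeff]
  have hdvd : (PowerSeries.X : PowerSeries ℂ) ^ (r + 1) ∣ P⁻¹ - Q' := by
    have h1 : (PowerSeries.X : PowerSeries ℂ) ^ (r + 1) ∣ Q - P := by
      rw [PowerSeries.X_pow_dvd_iff]
      intro m hm
      rw [map_sub, hco m (by omega), sub_self]
    have h2 : P⁻¹ - Q' = (Q - P) * (P⁻¹ * Q') := by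
      linear_combination (-P⁻¹) * hQQ + Q' * hPP
    rw [h2]
    exact Dvd.dvd.mul_right h1 _
  have := (PowerSeries.X_pow_dvd_iff.1 hdvd) i (by omega)
  rw [map_sub] at this
  exact sub_eq_zero.1 this

theorem sameJet_change {r : ℕ} {e : Bool} {f g : Germ} (hf : Visible e f) (hg : Visible e g)
    (h : ∀ i : ℕ, i ≤ r → (localCoord e f).coeff i = (localCoord e g).coeff i)
    {e' : Bool} (hg' : Visible e' g) :
    Visible e' f ∧
      ∀ i : ℕ, i ≤ r → (localCoord e' f).coeff i = (localCoord e' g).coeff i := by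
  obtain ⟨hf0, hfr⟩ := hf
  obtain ⟨hg0, hgr⟩ := hg
  obtain ⟨hg0', hgr'⟩ := hg'
  cases e <;> cases e' <;> simp only [localCoord, Visible] at *
  · exact ⟨⟨by simp, hfr⟩, h⟩
  · obtain ⟨a, b, c⟩ := inv_agree (by simpa using hfr) (by simpa using hgr) (by simpa using h)
      (hg0' trivial) (by simpa using hgr')
    exact ⟨⟨fun _ => a, by simpa using b⟩, by simpa using c⟩
  · obtain ⟨a, b, c⟩ := inv_agree (F := f⁻¹) (G := g⁻¹) (by simpa using hfr) (by simpa using hgr)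
      (by simpa using h) (inv_ne_zero (hg0 trivial)) (by simpa using hgr')
    exact ⟨⟨by simp, by simpa using b⟩, by simpa using c⟩
  · exact ⟨⟨hf0, hfr⟩, h⟩

/-- Having the same `r`-jet is an equivalence relation. -/
def jetSetoid (r : ℕ) : Setoid Germ where
  r := SameJet r
  iseqv :=
    { refl := fun f => by
        obtain ⟨e, he⟩ := exists_visible f
        exact ⟨e, he, he, fun _ _ => rfl⟩
      symm := fun ⟨e, hf, hg, h⟩ => ⟨e, hg, hf, fun i hi => (h i hi).symm⟩
      trans := fun ⟨_, hf, hg, h⟩ ⟨e', hg', hk, h'⟩ => by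
        obtain ⟨hf', hh⟩ := sameJet_change hf hg h hg'
        exact ⟨e', hf', hk, fun i hi => (hh i hi).trans (h' i hi)⟩ }

/-! ### Jet spaces -/

/-- The space `J^r` of `r`-jets of sections of the trivial bundle with fibre `ℙ¹ × ℙ¹`. -/
def Jet (r : ℕ) : Type := Quotient (jetSetoid r) × Quotient (jetSetoid r)

/-- The `r`-jet of the section `(x, y)`. -/
def jet (r : ℕ) (x y : Germ) : Jet r :=
  (Quotient.mk (jetSetoid r) x, Quotient.mk (jetSetoid r) y)

/-- The coordinates of a chart of `J^r`: the entries `(0, i)` are the coefficients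
`x₀, …, x_r` (or `X₀, …, X_r`), the entries `(1, i)` are `y₀, …, y_r` (or `Y₀, …, Y_r`). -/
abbrev Coord (r : ℕ) : Type := Fin 2 × Fin (r + 1) → ℂ

/-- The jet component whose coefficients in the chart `e` of `ℙ¹` are `v₀, …, v_r`.  The term
`ζ^(r+1)` is not seen by the `r`-jet; it makes the series nonzero, so that it has an inverse. -/
def germOf (r : ℕ) (e : Bool) (v : Fin (r + 1) → ℂ) : Germ :=
  localCoord e
    ((∑ i : Fin (r + 1), HahnSeries.single ((i : ℕ) : ℤ) (v i)) +
      HahnSeries.single ((r : ℤ) + 1) 1)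

/-- The four charts `ℂ^(2r+2) → J^r`, coming from the charts `(x, y)`, `(X, y)`, `(x, Y)`,
`(X, Y)` of `ℙ¹ × ℙ¹`; here `(x, y)` is `(false, false)`. -/
def chart (r : ℕ) (e : Bool × Bool) (v : Coord r) : Jet r :=
  jet r (germOf r e.1 fun i => v (0, i)) (germOf r e.2 fun i => v (1, i))

/-- The Zariski topology on affine space. -/
@[reducible] def zariskiCoord (r : ℕ) : TopologicalSpace (Coord r) :=
  TopologicalSpace.induced
    (MvPolynomial.pointToPoint : Coord r → PrimeSpectrum (MvPolynomial (Fin 2 × Fin (r + 1)) ℂ))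
    inferInstance

/-- The Zariski topology on `J^r`, glued from the four charts: a set is closed if and only if in
each of the charts it is the vanishing locus of polynomials in the coordinates. -/
instance (r : ℕ) : TopologicalSpace (Jet r) :=
  ⨆ e : Bool × Bool, TopologicalSpace.coinduced (chart r e) (zariskiCoord r)

/-- The codimension in `J^r` (of the Zariski closure) of a set of jets: the smallest height, over
the four charts, of the ideal of all polynomials vanishing on the set.  It is `⊤` for `∅`. -/
def codim {r : ℕ} (S : Set (Jet r)) : ℕ∞ :=
  ⨅ e : Bool × Bool, (MvPolynomial.vanishingIdeal ℂ (chart r e ⁻¹' S)).height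

/-! ### Three-point delay-differential equations as mappings of jets -/

/-- Differentiation with respect to `z`. -/
abbrev der (f : Germ) : Germ := LaurentSeries.derivative ℂ f

/-- The function `z`, expanded at the base point `c`: that is, `c + ζ`. -/
def zAt (c : ℂ) : Germ := HahnSeries.C c + HahnSeries.single 1 1

/-- A three-point equation of first order, as a relation `E c w u v` between the expansions at the
base point `z = c` of `w = u(z - 1)`, `u = u(z)` and `v = u(z + 1)`. -/
abbrev DelayEquation : Type := ℂ → Germ → Germ → Germ → Prop

/-- `u (ū - u̲) = a u - b u'`. -/
def eqOne (a b : ℂ) : DelayEquation := fun _ w u v => u * (v - w) = a • u - b • der u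

/-- `v² (v̄ - v̲) = p v + q v'`. -/
def eqTwo (p q : ℂ) : DelayEquation := fun _ w u v => u ^ 2 * (v - w) = p • u + q • der u

/-- `w̄ w = w̲ (λ z w + α w')`. -/
def eqThree (l α : ℂ) : DelayEquation :=
  fun c w u v => v * u = w * (l • (zAt c * u) + α • der u)

/-- The image in `J^r` of a set of jets in `J^(r+1)` under the map induced by the iteration
`(x, y) = (u, u̲) ↦ (x̄, ȳ) = (ū, u)` on sections: the `r`-jets of the images of all sections
whose `(r+1)`-jet is in the set. -/
def image (E : DelayEquation) (c : ℂ) (r : ℕ) (S : Set (Jet (r + 1))) : Set (Jet r) :=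
  {j | ∃ x y x' : Germ, x ≠ 0 ∧ jet (r + 1) x y ∈ S ∧ E c y x x' ∧ j = jet r x' x}

/-- The codimension of the image of a subvariety, "the other coordinates being generic": the
codimension of the image of a sufficiently small dense open part. -/
def imageCodim (E : DelayEquation) (c : ℂ) (r : ℕ) (B : Set (Jet (r + 1))) : ℕ∞ :=
  ⨆ (U : Set (Jet (r + 1))) (_ : IsOpen U) (_ : (B ∩ U).Nonempty), codim (image E c r (B ∩ U))

/-- Subvarieties: irreducible, locally closed subsets for the Zariski topology. -/
def IsSubvariety {r : ℕ} (B : Set (Jet r)) : Prop := IsIrreducible B ∧ IsLocallyClosed B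

/-- Blow-down type singularities: subvarieties of `J^(r+1)` whose image in `J^r` has greater
codimension. -/
def IsBlowDown (E : DelayEquation) (c : ℂ) (r : ℕ) (B : Set (Jet (r + 1))) : Prop :=
  IsSubvariety B ∧ codim B < imageCodim E c r B

/-- The section lies on some blow-down type singularity (in a jet space of some order). -/
def OnBlowDown (E : DelayEquation) (c : ℂ) (x y : Germ) : Prop :=
  ∃ (r : ℕ) (B : Set (Jet (r + 1))), IsBlowDown E c r B ∧ jet (r + 1) x y ∈ B

/-- Regular with nonzero value at the base point. -/
def RegularNonzero (f : Germ) : Prop := Regular f ∧ f.coeff 0 ≠ 0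

/-- `AccessibleSection E c x y`: the section `(x, y)`, at the base point `c`, arises by iterating
the equation (each step shifts the base point by one) from a regular nonzero initial section
without having met a blow-down type singularity at an earlier step. -/
inductive AccessibleSection (E : DelayEquation) : ℂ → Germ → Germ → Prop
  | init (c : ℂ) (x y : Germ) (hx : RegularNonzero x) (hy : RegularNonzero y) :
      AccessibleSection E c x y
  | step (c : ℂ) (x y x' : Germ) (h : AccessibleSection E c x y) (hB : ¬ OnBlowDown E c x y)
      (hx : x ≠ 0) (hE : E c y x x') : AccessibleSection E (c + 1) x' x

/-- A set of jets is accessible if it contains the jet of an accessible section. -/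
def IsAccessible (E : DelayEquation) (c : ℂ) {r : ℕ} (B : Set (Jet r)) : Prop :=
  ∃ x y : Germ, AccessibleSection E c x y ∧ jet r x y ∈ B

/-! ### The sets `B_m` -/

/-- `{x₀ = … = x_{m-1} = 0}` in the `(x, y)`-chart of `J^(r+1)` (for `m ≤ r + 2`). -/
def zeroSet (r m : ℕ) : Set (Jet (r + 1)) :=
  {j | ∃ x y : Germ, Regular x ∧ Regular y ∧ (∀ i : ℕ, i < m → x.coeff i = 0) ∧
    j = jet (r + 1) x y}

/-- `{dⁱ/dzⁱ (λ z x + α x') = 0 at z = c, for i = 0, …, m - 1}` in the `(x, y)`-chart of `J^(r+1)`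
(for `m ≤ r + 1`). -/
def logDerivSet (l α c : ℂ) (r m : ℕ) : Set (Jet (r + 1)) :=
  {j | ∃ x y : Germ, Regular x ∧ Regular y ∧
    (∀ i : ℕ, i < m → (der^[i] (l • (zAt c * x) + α • der x)).coeff 0 = 0) ∧
    j = jet (r + 1) x y}

/-- The sets `B r m ⊆ J^(r+1)`, `1 ≤ m ≤ M r`, are the only accessible blow-down type singularities
of the equation (at base point `c`):
* each `B r m` with `m ≤ r + 1` (`r ≥ 1`) is an accessible blow-down type singularity, of
  codimension `m`;
* conversely, an accessible blow-down type singularity `S` is contained in (the closure of) some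
  `B r m` with `m ≥ 1`; and for the largest such `m`, passing from `S` to its image
  increases the codimension by no more than passing from `B r m` to its image does, so that there
  is no blow-down inside `B r m` away from `B r (m + 1)`. -/
def OnlyAccessibleBlowDowns (E : DelayEquation) (c : ℂ) (M : ℕ → ℕ)
    (B : (r : ℕ) → ℕ → Set (Jet (r + 1))) : Prop :=
  (∀ r m : ℕ, 1 ≤ r → 1 ≤ m → m ≤ r + 1 →
    IsBlowDown E c r (B r m) ∧ IsAccessible E c (B r m) ∧ codim (B r m) = m) ∧
  ∀ (r : ℕ) (S : Set (Jet (r + 1))), IsBlowDown E c r S → IsAccessible E c S →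
    ∃ m : ℕ, 1 ≤ m ∧ IsGreatest {k : ℕ | k ≤ M r ∧ S ⊆ closure (B r k)} m ∧
      imageCodim E c r S + m ≤ codim S + imageCodim E c r (B r m)

end DelayPainleve

end

noncomputable section
namespace DelayPainleve

/-! ### Heights in polynomial rings and transcendence degrees -/

/-! Everything is a dimension count with rational functions. In a polynomial ring over a field, the
height of a prime plus the transcendence degree of its quotient is the number of variables
(`height_add_tdim`). Two estimates follow. If the points of an irreducible family are rational in
their images and in `s` further functions, passing to the images loses at most `s` dimensions
(`height_relIdeal_add_card_le`); this bounds codimensions of images from above. If `n` coordinates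
are rational in the remaining ones, the codimension is at least `n` (`card_le_height_relIdeal`);
this bounds them from below. Since `J^(r+1)` has two more coordinates than `J^r`, a map whose points
can be recovered with `k + 2` further functions raises the codimension by at most `k`
(`imageCodim_le_codim_add`).

The first two equations read `x̄ = y + R(x)`, where `R(x)` has a pole of order `d` at a zero of `x`
of order `m`: `d = 1` for the first, `d = m + 1` for the second. Where `x ≠ 0` the map is inverted
by `x = ȳ`, `y = x̄ - R(ȳ)`, and nothing is lost. At a zero of order `m ≤ r + 1` one has `1/x̄ = ζ^d
/ (ζ^d y + h)` with `h` invertible and depending only on `x`. Its `r`-jet shows `y` only below index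
`r + 1 - 2d`, so the codimension rises by at most `min (r + 1) (2d)`
(`PoleForm.imageCodim_le_of_zero`). On `B_m` this is attained: `ȳ` has `m` vanishing coefficients,
and the first `2d` coefficients of `1/x̄` are functions of `ȳ` (`PoleForm.le_imageCodim_zeroSet`).
On `B_(r+2)` the jet no longer shows the order of `x`, and each equation needs its own argument.

The third equation reads `x̄ = y L(x) / x` with `L(x) = λ z x + α x'`. Let `E` solve `L(E) = 0` with
value `1`. Then `L(E g) = α E g'`, so `B_m` is the linear condition `x ≡ x₀ E` modulo `ζ^(m+1)`.
There `x̄` starts with `m` zeros and `ȳ = x` is proportional to `E` up to order `m`, an increase of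
`min m r`; outside `B_(m+1)` it cannot be larger.

Accessibility keeps `S` in the right chart: a section that has never met a blow-down type
singularity has regular components, with nonzero values in the case of the third equation. The
largest `m` with `S` in the closure of `B_m` then makes the next defining equation generically
nonzero on `S`, or `m` is maximal. -/

/-- The transcendence degree, as an extended natural number. -/
def tdim (k A : Type*) [CommRing k] [CommRing A] [Algebra k A] : ℕ∞ :=
  Cardinal.toENat (Algebra.trdeg k A)

theorem tdim_le_of_injective {k A B : Type*} [Field k] [CommRing A] [Algebra k A]
    [CommRing B] [Algebra k B] (f : A →ₐ[k] B) (hf : Function.Injective f) :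
    tdim k A ≤ tdim k B := by
  have h := lift_trdeg_le_of_injective f hf
  have h' := OrderHomClass.mono Cardinal.toENat h
  simpa [tdim] using h'

/-- A transcendence basis of `B` lifts to an algebraically independent family `y` in `A`. The
nonzero kernel element `q` is transcendental over `k[y]`: a relation for `q` can be chosen with
nonzero constant term, that term would be killed by `f`, and `f` is injective on `k[y]`. So `q` may
be added to `y`. -/
theorem tdim_add_one_le_of_surjective {k A B : Type*} [Field k] [CommRing A] [IsDomain A]
    [Algebra k A] [CommRing B] [IsDomain B] [Algebra k B] (f : A →ₐ[k] B)
    (hs : Function.Surjective f) {q : A} (hq : f q = 0) (hq0 : q ≠ 0) :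
    tdim k B + 1 ≤ tdim k A := by
  have hfa : FaithfulSMul k B :=
    (faithfulSMul_iff_algebraMap_injective k B).2 (algebraMap k B).injective
  obtain ⟨ι, x, hx⟩ := exists_isTranscendenceBasis' k B
  choose y hy using fun i => hs (x i)
  have hyx : f ∘ y = x := funext hy
  have hyi : AlgebraicIndependent k y := AlgebraicIndependent.of_comp f (by rw [hyx]; exact hx.1)
  have htr : Transcendental (Algebra.adjoin k (Set.range y)) q := by
    intro halg
    obtain ⟨g, hg, hg0⟩ := halg.exists_nonzero_coeff_and_aeval_eq_zero
      (mem_nonZeroDivisors_of_ne_zero hq0)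
    apply hg
    have h1 : f ((g.coeff 0 : Algebra.adjoin k (Set.range y)) : A) = 0 := by
      rw [← Polynomial.divX_mul_X_add g] at hg0
      simp only [map_add, map_mul, Polynomial.aeval_X, Polynomial.aeval_C] at hg0
      have h2 : ((g.coeff 0 : Algebra.adjoin k (Set.range y)) : A)
          = - (Polynomial.aeval q g.divX * q) := eq_neg_of_add_eq_zero_right hg0
      rw [h2, map_neg, map_mul, hq, mul_zero, neg_zero]
    obtain ⟨p, hp⟩ : ∃ p : MvPolynomial ι k, MvPolynomial.aeval y p = (g.coeff 0 : A) := by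
      have : (g.coeff 0 : A) ∈ (MvPolynomial.aeval (R := k) y).range := by
        rw [← Algebra.adjoin_range_eq_range_aeval]
        exact (g.coeff 0).2
      exact this
    rw [← hp] at h1
    have h3 : MvPolynomial.aeval x p = 0 := by
      rw [← hyx, ← h1]
      exact (MvPolynomial.comp_aeval_apply (f := y) f p).symm
    have h4 : p = 0 := hx.1 (by rw [h3, map_zero])
    rw [h4, map_zero] at hp
    exact Subtype.ext hp.symm
  have hopt := (hyi.option_iff_transcendental q).2 htr
  have h := hopt.lift_cardinalMk_le_trdeg
  have h1 := hx.lift_cardinalMk_eq_trdeg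
  have h' := OrderHomClass.mono Cardinal.toENat h
  have h1' := congrArg Cardinal.toENat h1
  simp [Cardinal.mk_option] at h' h1'
  rw [tdim, tdim, ← h1']
  exact h'

/-- Each strict inclusion of primes lowers the transcendence degree of the quotient by at least one,
which bounds the chains below `P`. The induction is on an upper bound `N` for `n - tdim k (A ⧸ P)`.
-/
theorem height_add_tdim_le {k A : Type*} [Field k] [CommRing A] [IsDomain A] [Algebra k A]
    (n : ℕ) (hn : tdim k A ≤ n) (P : Ideal A) [P.IsPrime] :
    P.height + tdim k (A ⧸ P) ≤ n := by
  have step : ∀ q p : Ideal A, q.IsPrime → p.IsPrime → q < p →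
      tdim k (A ⧸ p) + 1 ≤ tdim k (A ⧸ q) := by
    intro q p hq hp hqp
    obtain ⟨x, hxp, hxq⟩ := SetLike.exists_of_lt hqp
    exact tdim_add_one_le_of_surjective (Ideal.Quotient.factorₐ k hqp.le)
      (Ideal.Quotient.factor_surjective hqp.le) (q := Ideal.Quotient.mk q x)
      (by simpa using Ideal.Quotient.eq_zero_iff_mem.2 hxp)
      (fun h => hxq (Ideal.Quotient.eq_zero_iff_mem.1 h))
  have top : ∀ p : Ideal A, p.IsPrime → tdim k (A ⧸ p) ≤ n := by
    intro p hp
    refine le_trans ?_ hn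
    have := OrderHomClass.mono Cardinal.toENat
      (lift_trdeg_le_of_surjective (Ideal.Quotient.mkₐ k p) (Ideal.Quotient.mkₐ_surjective k p))
    simpa [tdim] using this
  have key : ∀ (N : ℕ) (P : Ideal A), P.IsPrime → (n : ℕ∞) ≤ N + tdim k (A ⧸ P) →
      P.height ≤ N := by
    intro N
    induction N with
    | zero =>
      intro P hP h
      rw [Ideal.height_le_iff]
      intro q hq hqP
      exfalso
      have h1 := step q P hq hP hqP
      have h2 := top q hq
      obtain ⟨d, hd⟩ := ENat.ne_top_iff_exists.1 (ne_top_of_le_ne_top (ENat.natCast_ne_top n) (top P hP))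
      obtain ⟨e, he⟩ := ENat.ne_top_iff_exists.1 (ne_top_of_le_ne_top (ENat.natCast_ne_top n) (top q hq))
      rw [← hd, ← he] at h1
      rw [← he] at h2
      rw [← hd] at h
      norm_cast at h1 h2 h
      omega
    | succ N ih =>
      intro P hP h
      rw [Ideal.height_le_iff]
      intro q hq hqP
      have h1 := step q P hq hP hqP
      have h3 : q.height ≤ N := by
        refine ih q hq (h.trans ?_)
        rw [Nat.cast_add, add_assoc, add_comm (((1 : ℕ) : ℕ∞))]
        exact add_le_add_right h1 _
      refine lt_of_le_of_lt h3 ?_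
      norm_cast
      omega
  obtain ⟨d, hd⟩ := ENat.ne_top_iff_exists.1
    (ne_top_of_le_ne_top (ENat.natCast_ne_top n) (top P inferInstance))
  have hdn := top P inferInstance
  rw [← hd] at hdn ⊢
  norm_cast at hdn
  have := key (n - d) P inferInstance (by rw [← hd]; norm_cast; omega)
  calc P.height + d ≤ ((n - d : ℕ) : ℕ∞) + d := by gcongr
    _ = n := by norm_cast; omega

/-- Let `p` be the contraction of `P`. If `P = p[X]`, the quotient is `(A ⧸ p)[X]` and the
transcendence degree gains one, as evaluation at `0` kills `X`. Otherwise the height gains one,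
because by going down the height of `P` is that of `p` plus that of the image of `P` in the quotient
by `p[X]`. -/
theorem le_height_add_tdim_polynomial {k A : Type*} [Field k] [CommRing A] [IsDomain A]
    [IsNoetherianRing A] [Algebra k A] (n : ℕ)
    (h : ∀ P : Ideal A, P.IsPrime → (n : ℕ∞) ≤ P.height + tdim k (A ⧸ P))
    (P : Ideal (Polynomial A)) (hP : P.IsPrime) :
    ((n + 1 : ℕ) : ℕ∞) ≤ P.height + tdim k (Polynomial A ⧸ P) := by
  set p : Ideal A := P.under A with hp
  have hpP : p.IsPrime := inferInstance
  have hover : P.LiesOver p := ⟨hp⟩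
  have hle : p.map (algebraMap A (Polynomial A)) ≤ P := Ideal.map_comap_le
  have hht := Ideal.height_eq_height_add_of_liesOver_of_hasGoingDown p P
  have hprime : (p.map (algebraMap A (Polynomial A))).IsPrime :=
    Ideal.isPrime_map_C_of_isPrime (P := p)
  have hn := h p hpP
  push_cast
  by_cases hc : P = p.map (algebraMap A (Polynomial A))
  · have h1 : tdim k (A ⧸ p) + 1 ≤ tdim k (Polynomial A ⧸ P) := by
      have hker : ∀ f ∈ P, ((Ideal.Quotient.mkₐ k p).comp
          ((Polynomial.aeval (0 : A)).restrictScalars k)) f = 0 := by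
        intro f hf
        rw [hc] at hf
        have : f.coeff 0 ∈ p := Ideal.mem_map_C_iff.1 hf 0
        rw [Polynomial.coeff_zero_eq_eval_zero] at this
        simpa  using
          Ideal.Quotient.eq_zero_iff_mem.2 this
      refine tdim_add_one_le_of_surjective (Ideal.Quotient.liftₐ P _ hker) ?_
        (q := Ideal.Quotient.mk P Polynomial.X) ?_ ?_
      · intro x
        obtain ⟨a, rfl⟩ := Ideal.Quotient.mk_surjective x
        exact ⟨Ideal.Quotient.mk P (Polynomial.C a), (Ideal.Quotient.lift_mk _ _ _).trans (by simp)⟩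
      · exact (Ideal.Quotient.lift_mk _ _ _).trans (by simp)
      · intro h0
        have h0' := Ideal.Quotient.eq_zero_iff_mem.1 h0
        rw [hc] at h0'
        have : (Polynomial.X : Polynomial A).coeff 1 ∈ p := Ideal.mem_map_C_iff.1 h0' 1
        rw [Polynomial.coeff_X_one] at this
        exact hpP.ne_top ((Ideal.eq_top_iff_one p).2 this)
    have h2 : p.height ≤ P.height := by rw [hht]; exact le_self_add
    calc (n : ℕ∞) + 1 ≤ (p.height + tdim k (A ⧸ p)) + 1 := by gcongr
      _ = p.height + (tdim k (A ⧸ p) + 1) := add_assoc _ _ _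
      _ ≤ _ := by gcongr
  · have h1 : tdim k (A ⧸ p) ≤ tdim k (Polynomial A ⧸ P) := by
      refine tdim_le_of_injective
        (Ideal.quotientMapₐ P (IsScalarTower.toAlgHom k A (Polynomial A)) le_rfl) ?_
      exact Ideal.quotientMap_injective
    have h2 : p.height + 1 ≤ P.height := by
      rw [hht]
      gcongr
      rw [Order.one_le_iff_ne_zero]
      intro h0
      rw [Ideal.height_eq_zero_iff_eq_bot] at h0
      apply hc
      refine le_antisymm ?_ hle
      rw [Ideal.map_eq_bot_iff_le_ker, Ideal.mk_ker] at h0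
      exact h0
    calc (n : ℕ∞) + 1 ≤ (p.height + tdim k (A ⧸ p)) + 1 := by gcongr
      _ = (p.height + 1) + tdim k (A ⧸ p) := by ring
      _ ≤ _ := by gcongr

theorem le_height_add_tdim_of_equiv {k A B : Type*} [Field k] [CommRing A] [CommRing B]
    [Algebra k A] [Algebra k B] (e : A ≃ₐ[k] B) (n : ℕ)
    (h : ∀ P : Ideal A, P.IsPrime → (n : ℕ∞) ≤ P.height + tdim k (A ⧸ P))
    (P : Ideal B) (hP : P.IsPrime) : (n : ℕ∞) ≤ P.height + tdim k (B ⧸ P) := by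
  have h1 := h (P.comap (e : A →ₐ[k] B)) (Ideal.comap_isPrime _ _)
  have h2 : (P.comap (e : A →ₐ[k] B)).height = P.height :=
    RingEquiv.height_comap (e : A ≃+* B) P
  rw [h2] at h1
  have h3 : tdim k (A ⧸ P.comap (e : A →ₐ[k] B)) ≤ tdim k (B ⧸ P) :=
    tdim_le_of_injective (Ideal.quotientMapₐ P (e : A →ₐ[k] B) le_rfl)
      Ideal.quotientMap_injective
  exact h1.trans (add_le_add_right h3 _)

theorem tdim_mvPolynomial (k σ : Type*) [Field k] [Fintype σ] :
    tdim k (MvPolynomial σ k) = Fintype.card σ := by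
  simp [tdim, MvPolynomial.trdeg_of_isDomain]

/-- The dimension formula for prime ideals of polynomial rings over a field. -/
theorem height_add_tdim {k σ : Type*} [Field k] [Fintype σ] (P : Ideal (MvPolynomial σ k))
    [P.IsPrime] : P.height + tdim k (MvPolynomial σ k ⧸ P) = Fintype.card σ := by
  refine le_antisymm (height_add_tdim_le _ (tdim_mvPolynomial k σ).le P) ?_
  have key : ∀ (n : ℕ) (P : Ideal (MvPolynomial (Fin n) k)), P.IsPrime →
      (n : ℕ∞) ≤ P.height + tdim k (MvPolynomial (Fin n) k ⧸ P) := by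
    intro n
    induction n with
    | zero => intro P _; simp
    | succ n ih =>
      exact le_height_add_tdim_of_equiv (MvPolynomial.finSuccEquiv k n).symm (n + 1)
        (le_height_add_tdim_polynomial n ih)
  exact le_height_add_tdim_of_equiv
    (MvPolynomial.renameEquiv k (Fintype.equivFin σ).symm) _ (key _) P inferInstance

end DelayPainleve

end

noncomputable section
namespace DelayPainleve
open MvPolynomial

/-! ### Functions that are rational in given functions -/

/-- `f` is a quotient of polynomials in the functions `u`, the denominator vanishing nowhere. -/
def RatGen {A κ : Type*} (u : A → κ → ℂ) (f : A → ℂ) : Prop :=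
  ∃ h q : MvPolynomial κ ℂ, (∀ a, eval (u a) q ≠ 0) ∧ ∀ a, f a * eval (u a) q = eval (u a) h

namespace RatGen
variable {A κ : Type*} {u : A → κ → ℂ} {f g : A → ℂ}

theorem const (c : ℂ) : RatGen u fun _ => c := ⟨C c, 1, by simp, by simp⟩

theorem coord (i : κ) : RatGen u fun a => u a i := ⟨X i, 1, by simp, by simp⟩

theorem add (hf : RatGen u f) (hg : RatGen u g) : RatGen u fun a => f a + g a := by
  obtain ⟨h, q, hq, e⟩ := hf
  obtain ⟨h', q', hq', e'⟩ := hg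
  refine ⟨h * q' + h' * q, q * q', fun a => by simpa using ⟨hq a, hq' a⟩, fun a => ?_⟩
  simp only [map_add, map_mul, ← e, ← e']
  ring

theorem mul (hf : RatGen u f) (hg : RatGen u g) : RatGen u fun a => f a * g a := by
  obtain ⟨h, q, hq, e⟩ := hf
  obtain ⟨h', q', hq', e'⟩ := hg
  refine ⟨h * h', q * q', fun a => by simpa using ⟨hq a, hq' a⟩, fun a => ?_⟩
  simp only [map_mul, ← e, ← e']
  ring

theorem inv (hf : RatGen u f) (h0 : ∀ a, f a ≠ 0) : RatGen u fun a => (f a)⁻¹ := by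
  obtain ⟨h, q, hq, e⟩ := hf
  refine ⟨q, h, fun a => by rw [← e]; exact mul_ne_zero (h0 a) (hq a), fun a => ?_⟩
  rw [← e, inv_mul_cancel_left₀ (h0 a)]

theorem sum {ι : Type*} (s : Finset ι) {F : ι → A → ℂ} (h : ∀ i ∈ s, RatGen u (F i)) :
    RatGen u fun a => ∑ i ∈ s, F i a := by
  classical
  induction s using Finset.induction_on with
  | empty => simpa using const 0
  | insert i s hi ih =>
    simp only [Finset.sum_insert hi]
    exact (h i (Finset.mem_insert_self _ _)).add
      (ih fun j hj => h j (Finset.mem_insert_of_mem hj))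

theorem congr (hf : RatGen u f) (h : ∀ a, g a = f a) : RatGen u g := by
  rwa [show g = f from funext h]

theorem comp {B : Type*} (hf : RatGen u f) (k : B → A) : RatGen (fun b => u (k b)) fun b => f (k b) := by
  obtain ⟨h, q, hq, e⟩ := hf
  exact ⟨h, q, fun a => hq (k a), fun a => e (k a)⟩

theorem eval {ι : Type*} {F : A → ι → ℂ} (hF : ∀ i, RatGen u fun a => F a i)
    (p : MvPolynomial ι ℂ) : RatGen u fun a => MvPolynomial.eval (F a) p := by
  induction p using MvPolynomial.induction_on with
  | C c => simpa using const c
  | add p q hp hq => simpa using hp.add hq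
  | mul_X p i hp => simpa using hp.mul (hF i)

theorem of_isEmpty [IsEmpty A] : RatGen u f := ⟨0, 1, by simp, fun a => isEmptyElim a⟩

theorem trans {ι : Type*} {w : A → ι → ℂ} (hf : RatGen u f) (hu : ∀ i, RatGen w fun a => u a i) :
    RatGen w f := by
  obtain ⟨h, q, hq, e⟩ := hf
  exact ((eval hu h).mul ((eval hu q).inv hq)).congr fun a => by
    rw [← e, mul_inv_cancel_right₀ (hq a)]

theorem neg (hf : RatGen u f) : RatGen u fun a => - f a :=
  ((const (-1)).mul hf).congr fun a => by ring

/-- The algebra of functions that are rational in `u`. -/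
def algebra (u : A → κ → ℂ) : Subalgebra ℂ (A → ℂ) where
  carrier := {f | RatGen u f}
  mul_mem' := mul
  add_mem' := add
  algebraMap_mem' := const

theorem aeval_apply {ι : Type*} (φ : ι → algebra u) (p : MvPolynomial ι ℂ) (a : A) :
    (aeval φ p).1 a = MvPolynomial.eval (fun i => (φ i).1 a) p := by
  induction p using MvPolynomial.induction_on with
  | C c => simp
  | add p q hp hq => rw [map_add, map_add, ← hp, ← hq]; rfl
  | mul_X p i hp => rw [map_mul, map_mul, ← hp, aeval_X, eval_X]; rfl

end RatGen

/-- The ideal of polynomial relations satisfied by a family of points. -/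
abbrev relIdeal {A σ : Type*} (t : A → σ → ℂ) : Ideal (MvPolynomial σ ℂ) :=
  vanishingIdeal ℂ (Set.range t)

theorem mem_relIdeal {A σ : Type*} {t : A → σ → ℂ} {f : MvPolynomial σ ℂ} :
    f ∈ relIdeal t ↔ ∀ a, eval (t a) f = 0 := by
  simp [relIdeal, mem_vanishingIdeal_iff, aeval_eq_eval]

/-- Denominators vanish nowhere, so a product of functions is zero only if the product of the
numerators is a relation, and the relations form a prime ideal. The algebra thus plays the role of a
localized coordinate ring. -/
theorem isDomain_algebra {A σ : Type*} (t : A → σ → ℂ) [hP : (relIdeal t).IsPrime] :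
    IsDomain (RatGen.algebra t) := by
  have hne : Nonempty A := by
    by_contra hA
    rw [not_nonempty_iff] at hA
    exact hP.ne_top ((Ideal.eq_top_iff_one _).2 (mem_relIdeal.2 fun a => isEmptyElim a))
  have : Nontrivial (RatGen.algebra t) := by
    refine ⟨0, 1, fun h => ?_⟩
    have := congrFun (congrArg Subtype.val h) hne.some
    simp at this
  have : NoZeroDivisors (RatGen.algebra t) := by
    constructor
    rintro ⟨f, h, q, hq, e⟩ ⟨f', h', q', hq', e'⟩ h0
    have h1 : h * h' ∈ relIdeal t := by
      rw [mem_relIdeal]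
      intro a
      have := congrFun (congrArg Subtype.val h0) a
      simp only [Subalgebra.coe_mul, Pi.mul_apply, ZeroMemClass.coe_zero, Pi.zero_apply] at this
      rw [map_mul, ← e, ← e']
      linear_combination (eval (t a) q * eval (t a) q') * this
    rcases hP.mem_or_mem h1 with h2 | h2 <;> rw [mem_relIdeal] at h2
    · left
      refine Subtype.ext (funext fun a => ?_)
      exact (mul_eq_zero.1 ((e a).trans (h2 a))).resolve_right (hq a)
    · right
      refine Subtype.ext (funext fun a => ?_)
      exact (mul_eq_zero.1 ((e' a).trans (h2 a))).resolve_right (hq' a)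
  exact NoZeroDivisors.to_isDomain _

theorem isAlgebraic_of_mul_eq {D K : Type*} [CommRing D] [IsDomain D] [CommRing K] [IsDomain K]
    [Algebra D K] [FaithfulSMul D K] {f q h : K} (hq : IsAlgebraic D q) (hh : IsAlgebraic D h)
    (hq0 : q ≠ 0) (e : f * q = h) : IsAlgebraic D f := by
  have hinj := IsFractionRing.injective K (FractionRing K)
  rw [← isAlgebraic_algebraMap_iff (A := FractionRing K) hinj] at hq hh ⊢
  have : algebraMap K (FractionRing K) f
      = algebraMap K (FractionRing K) h * (algebraMap K (FractionRing K) q)⁻¹ := by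
    rw [← e, map_mul, mul_inv_cancel_right₀]
    simpa using hq0
  rw [this]
  exact hh.mul hq.inv

theorem tdim_le_card {R A ρ : Type*} [CommRing R] [CommRing A] [NoZeroDivisors A] [Algebra R A]
    [Fintype ρ] (v : ρ → A) [Algebra.IsAlgebraic (Algebra.adjoin R (Set.range v)) A] :
    tdim R A ≤ Fintype.card ρ := by
  have h1 := Algebra.IsAlgebraic.trdeg_le_cardinalMk R (Set.range v)
  have h2 : Cardinal.toENat (Cardinal.mk (Set.range v)) ≤ Fintype.card ρ := by
    rw [← Cardinal.toENat_nat (Fintype.card ρ), ← Cardinal.toENat_lift.{_, _} (c := Cardinal.mk (Set.range v)),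
      ← Cardinal.toENat_lift (c := ((Fintype.card ρ : ℕ) : Cardinal))]
    have h3 := OrderHomClass.mono Cardinal.toENat (Cardinal.mk_range_le_lift (f := v))
    rw [Cardinal.mk_fintype ρ] at h3
    exact h3
  exact (OrderHomClass.mono Cardinal.toENat h1).trans h2

/-- If the points `t` are rational in the points `F` and the further functions `s`, then the
dimension of the set of the `F a` is at least that of the set of the `t a`, less the number of
further functions. -/
theorem height_relIdeal_add_card_le {A σ τ ρ : Type*} [Fintype σ] [Fintype τ] [Fintype ρ]
    (t : A → σ → ℂ) [hP : (relIdeal t).IsPrime] (F : A → τ → ℂ) (s : A → ρ → ℂ)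
    (hF : ∀ j, RatGen t fun a => F a j) (hs : ∀ j, RatGen t fun a => s a j)
    (ht : ∀ i, RatGen (fun a => Sum.elim (F a) (s a)) fun a => t a i) :
    (relIdeal F).height + Fintype.card σ
      ≤ (relIdeal t).height + (Fintype.card τ + Fintype.card ρ) := by
  have hdom := isDomain_algebra t
  let Φ : τ → RatGen.algebra t := fun j => ⟨fun a => F a j, hF j⟩
  let Ψ : ρ → RatGen.algebra t := fun j => ⟨fun a => s a j, hs j⟩
  let T : σ → RatGen.algebra t := fun i => ⟨fun a => t a i, RatGen.coord i⟩
  have hker : ∀ p : MvPolynomial τ ℂ, aeval Φ p = 0 ↔ p ∈ relIdeal F := by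
    intro p
    rw [mem_relIdeal, Subtype.ext_iff, funext_iff]
    exact forall_congr' fun a => by rw [RatGen.aeval_apply]; rfl
  have hkerT : ∀ p : MvPolynomial σ ℂ, aeval T p = 0 ↔ p ∈ relIdeal t := by
    intro p
    rw [mem_relIdeal, Subtype.ext_iff, funext_iff]
    exact forall_congr' fun a => by rw [RatGen.aeval_apply]; rfl
  have hQ : (relIdeal F).IsPrime := by
    have : relIdeal F = RingHom.ker (aeval Φ : MvPolynomial τ ℂ →ₐ[ℂ] RatGen.algebra t) :=
      Ideal.ext fun p => (hker p).symm
    rw [this]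
    exact RingHom.ker_isPrime _
  -- `S` is the coordinate ring of the closure of the image, embedded into the function algebra. By
  -- `ht` that algebra is algebraic over `S[s]`, hence of transcendence degree at most `card ρ` over
  -- `S`; additivity and the dimension formula translate this into heights.
  let S := MvPolynomial τ ℂ ⧸ relIdeal F
  let g : S →ₐ[ℂ] RatGen.algebra t := Ideal.Quotient.liftₐ _ (aeval Φ) fun p hp => (hker p).2 hp
  have hg : Function.Injective g := by
    rw [injective_iff_map_eq_zero]
    intro x hx
    obtain ⟨p, rfl⟩ := Ideal.Quotient.mk_surjective x
    exact Ideal.Quotient.eq_zero_iff_mem.2 ((hker p).1 hx)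
  let _ : Algebra S (RatGen.algebra t) := g.toRingHom.toAlgebra
  have htower : IsScalarTower ℂ S (RatGen.algebra t) :=
    IsScalarTower.of_algebraMap_eq fun c => (g.commutes c).symm
  have hfaith : FaithfulSMul S (RatGen.algebra t) :=
    (faithfulSMul_iff_algebraMap_injective _ _).2 hg
  have hfaith' : FaithfulSMul ℂ S :=
    (faithfulSMul_iff_algebraMap_injective _ _).2 (algebraMap ℂ S).injective
  let D := Algebra.adjoin S (Set.range Ψ)
  have hD : ∀ p : MvPolynomial (τ ⊕ ρ) ℂ, aeval (Sum.elim Φ Ψ) p ∈ D := by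
    intro p
    induction p using MvPolynomial.induction_on with
    | C c =>
      rw [aeval_C, IsScalarTower.algebraMap_apply ℂ S (RatGen.algebra t)]
      exact D.algebraMap_mem _
    | add p q hp hq => rw [map_add]; exact D.add_mem hp hq
    | mul_X p i hp =>
      rw [map_mul, aeval_X]
      refine D.mul_mem hp ?_
      rcases i with j | j
      · have : Φ j = algebraMap S (RatGen.algebra t) (Ideal.Quotient.mk _ (X j)) :=
          (aeval_X Φ j).symm
        simp only [Sum.elim_inl]
        rw [this]
        exact D.algebraMap_mem _
      · exact Algebra.subset_adjoin ⟨j, rfl⟩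
  have hDalg : ∀ p : MvPolynomial (τ ⊕ ρ) ℂ, IsAlgebraic D (aeval (Sum.elim Φ Ψ) p) := fun p =>
    isAlgebraic_algebraMap (⟨_, hD p⟩ : D)
  have hev : ∀ (p : MvPolynomial (τ ⊕ ρ) ℂ) a, (aeval (Sum.elim Φ Ψ) p).1 a
      = eval (Sum.elim (F a) (s a)) p := by
    intro p a
    rw [RatGen.aeval_apply]
    congr 2
    funext i
    cases i <;> rfl
  obtain ⟨a₀⟩ : Nonempty A := by
    by_contra hA
    rw [not_nonempty_iff] at hA
    exact hP.ne_top ((Ideal.eq_top_iff_one _).2 (mem_relIdeal.2 fun a => isEmptyElim a))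
  have hTalg : ∀ i, IsAlgebraic D (T i) := by
    intro i
    obtain ⟨h, q, hq, e⟩ := ht i
    refine isAlgebraic_of_mul_eq (hDalg q) (hDalg h) (fun h0 => hq a₀ ?_)
      (Subtype.ext (funext fun a => ?_))
    · rw [← hev, h0]; rfl
    · rw [hev, ← e, ← hev]; rfl
  have hTalg' : ∀ p : MvPolynomial σ ℂ, IsAlgebraic D (aeval T p) := by
    intro p
    induction p using MvPolynomial.induction_on with
    | C c =>
      rw [aeval_C, IsScalarTower.algebraMap_apply ℂ D (RatGen.algebra t)]
      exact isAlgebraic_algebraMap _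
    | add p q hp hq => rw [map_add]; exact hp.add hq
    | mul_X p i hp => rw [map_mul, aeval_X]; exact hp.mul (hTalg i)
  have halg : Algebra.IsAlgebraic D (RatGen.algebra t) := by
    constructor
    rintro ⟨f, h, q, hq, e⟩
    refine isAlgebraic_of_mul_eq (hTalg' q) (hTalg' h) (fun h0 => hq a₀ ?_)
      (Subtype.ext (funext fun a => ?_))
    · have := RatGen.aeval_apply T q a₀
      rw [h0] at this
      exact this.symm
    · have h1 := RatGen.aeval_apply T q a
      have h2 := RatGen.aeval_apply T h a
      rw [h2]
      refine Eq.trans ?_ (e a)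
      exact congrArg (f a * ·) h1
  have hrho : tdim S (RatGen.algebra t) ≤ Fintype.card ρ := by
    exact tdim_le_card Ψ
  have hadd : tdim ℂ (RatGen.algebra t) = tdim ℂ S + tdim S (RatGen.algebra t) := by
    have h1 := congrArg Cardinal.toENat (lift_trdeg_add_eq ℂ S (RatGen.algebra t))
    simpa [tdim] using h1.symm
  have hσ : tdim ℂ (MvPolynomial σ ℂ ⧸ relIdeal t) ≤ tdim ℂ (RatGen.algebra t) := by
    refine tdim_le_of_injective (Ideal.Quotient.liftₐ _ (aeval T) fun p hp => (hkerT p).2 hp) ?_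
    rw [injective_iff_map_eq_zero]
    intro x hx
    obtain ⟨p, rfl⟩ := Ideal.Quotient.mk_surjective x
    exact Ideal.Quotient.eq_zero_iff_mem.2 ((hkerT p).1 hx)
  have e1 := height_add_tdim (relIdeal t)
  have e2 := height_add_tdim (relIdeal F)
  calc (relIdeal F).height + Fintype.card σ
      = (relIdeal F).height + ((relIdeal t).height + tdim ℂ (MvPolynomial σ ℂ ⧸ relIdeal t)) := by
        rw [e1]
    _ ≤ (relIdeal F).height + ((relIdeal t).height + (tdim ℂ S + Fintype.card ρ)) := by
        gcongr
        exact hσ.trans (hadd.le.trans (add_le_add_right hrho _))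
    _ = (relIdeal t).height + (((relIdeal F).height + tdim ℂ S) + Fintype.card ρ) := by ring
    _ = _ := by rw [e2]

/-- If some coordinates are rational in the others, the codimension is at least their number. -/
theorem card_le_height_relIdeal {A τ ι : Type*} [Fintype τ] [Fintype ι] (t : A → τ → ℂ)
    (k : ι → τ) (hk : Function.Injective k)
    (h : ∀ i, RatGen (fun a (j : {j // j ∉ Set.range k}) => t a j) fun a => t a (k i)) :
    (Fintype.card ι : ℕ∞) ≤ (relIdeal t).height := by
  classical
  -- The relation ideal need not be prime here, so each minimal prime over it is treated separately.
  rw [Ideal.height_eq_inf_minimalPrimes]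
  refine le_iInf₂ fun p hp => ?_
  have hpp : p.IsPrime := hp.1.1
  let κ := {j // j ∉ Set.range k}
  let v : κ → MvPolynomial τ ℂ ⧸ p := fun j => Ideal.Quotient.mk p (X j.1)
  let D := Algebra.adjoin ℂ (Set.range v)
  have hmem : ∀ q : MvPolynomial κ ℂ,
      Ideal.Quotient.mk p (rename Subtype.val q) ∈ D := by
    intro q
    have : Ideal.Quotient.mk p (rename Subtype.val q) = aeval v q := by
      have h1 : (Ideal.Quotient.mkₐ ℂ p).comp (rename Subtype.val) = aeval v := by
        ext j
        simp [v]
      rw [← h1]; rfl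
    rw [this, show D = (aeval v).range from Algebra.adjoin_range_eq_range_aeval ℂ v]
    exact ⟨q, rfl⟩
  have hX : ∀ j, IsAlgebraic D (Ideal.Quotient.mk p (X j)) := by
    intro j
    by_cases hj : j ∈ Set.range k
    · obtain ⟨i, rfl⟩ := hj
      obtain ⟨g, q, hq, e⟩ := h i
      refine isAlgebraic_of_mul_eq (isAlgebraic_algebraMap (⟨_, hmem q⟩ : D))
        (isAlgebraic_algebraMap (⟨_, hmem g⟩ : D)) ?_ ?_
      -- The denominator survives modulo a minimal prime: otherwise it would multiply some `y`
      -- outside the relation ideal into it, but it vanishes nowhere, so `y` would be a relation.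
      · intro h0
        obtain ⟨y, hy, hy'⟩ := Ideal.exists_mul_mem_of_mem_minimalPrimes hp
          (Ideal.Quotient.eq_zero_iff_mem.1 h0)
        apply hy
        rw [mem_relIdeal] at hy' ⊢
        intro a
        have := hy' a
        rw [map_mul, eval_rename] at this
        exact (mul_eq_zero.1 this).resolve_left (hq a)
      · change Ideal.Quotient.mk p _ * Ideal.Quotient.mk p _ = Ideal.Quotient.mk p _
        rw [← map_mul, Ideal.Quotient.eq]
        refine hp.1.2 (mem_relIdeal.2 fun a => ?_)
        rw [map_sub, map_mul, eval_rename, eval_rename, eval_X, sub_eq_zero]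
        exact e a
    · exact isAlgebraic_algebraMap (⟨_, Algebra.subset_adjoin ⟨⟨j, hj⟩, rfl⟩⟩ : D)
  have halg : Algebra.IsAlgebraic D (MvPolynomial τ ℂ ⧸ p) := by
    constructor
    intro x
    obtain ⟨f, rfl⟩ := Ideal.Quotient.mk_surjective x
    induction f using MvPolynomial.induction_on with
    | C c =>
      have : Ideal.Quotient.mk p (C c) = algebraMap D _ (algebraMap ℂ D c) := rfl
      rw [this]
      exact isAlgebraic_algebraMap _
    | add f g hf hg => rw [map_add]; exact hf.add hg
    | mul_X f i hf => rw [map_mul]; exact hf.mul (hX i)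
  have h1 : tdim ℂ (MvPolynomial τ ℂ ⧸ p) ≤ Fintype.card κ := by
    exact tdim_le_card v
  have h2 : Fintype.card ι + Fintype.card κ = Fintype.card τ := by
    rw [Fintype.card_subtype_compl, Set.card_range_of_injective hk]
    have := Fintype.card_le_of_injective k hk
    omega
  have h3 := height_add_tdim p
  rw [← h2] at h3
  have h4 : ((Fintype.card ι + Fintype.card κ : ℕ) : ℕ∞) ≤ p.height + Fintype.card κ := by
    rw [← h3]
    gcongr
  push_cast at h4
  exact (ENat.add_le_add_iff_right (ENat.natCast_ne_top _)).1 h4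

end DelayPainleve

end

noncomputable section
namespace DelayPainleve
open PowerSeries

/-! ### Families of power series with rational coefficients -/

/-- The coefficients of index less than `N` are rational in `u`. -/
def RatPS {A κ : Type*} (u : A → κ → ℂ) (N : ℕ) (P : A → PowerSeries ℂ) : Prop :=
  ∀ n < N, RatGen u fun a => coeff n (P a)

/-- Division by `ζ ^ k`, dropping the coefficients of index less than `k`. -/
def unshift (k : ℕ) (P : PowerSeries ℂ) : PowerSeries ℂ := PowerSeries.mk fun n => coeff (n + k) P

@[simp] theorem coeff_unshift (k n : ℕ) (P : PowerSeries ℂ) :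
    coeff n (unshift k P) = coeff (n + k) P := coeff_mk _ _

theorem X_pow_mul_unshift {k : ℕ} {P : PowerSeries ℂ} (h : ∀ i < k, coeff i P = 0) :
    X ^ k * unshift k P = P := by
  ext n
  rw [coeff_X_pow_mul']
  split_ifs with hn
  · rw [coeff_unshift, Nat.sub_add_cancel hn]
  · exact (h n (not_le.1 hn)).symm

theorem unshift_X_pow_mul (k : ℕ) (P : PowerSeries ℂ) : unshift k (X ^ k * P) = P := by
  ext n
  rw [coeff_unshift, coeff_X_pow_mul]

namespace RatPS
variable {A κ : Type*} {u : A → κ → ℂ} {N : ℕ} {P Q : A → PowerSeries ℂ}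

theorem mono {M : ℕ} (h : RatPS u N P) (hM : M ≤ N) : RatPS u M P :=
  fun n hn => h n (hn.trans_le hM)

theorem congr (h : RatPS u N P) (e : ∀ a, Q a = P a) : RatPS u N Q := by
  rwa [show Q = P from funext e]

theorem const (p : PowerSeries ℂ) : RatPS u N fun _ => p := fun _ _ => RatGen.const _

theorem add (hP : RatPS u N P) (hQ : RatPS u N Q) : RatPS u N fun a => P a + Q a :=
  fun n hn => ((hP n hn).add (hQ n hn)).congr fun a => by simp

theorem mul (hP : RatPS u N P) (hQ : RatPS u N Q) : RatPS u N fun a => P a * Q a := by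
  intro n hn
  refine (RatGen.sum (Finset.HasAntidiagonal.antidiagonal n)
    (F := fun p a => coeff p.1 (P a) * coeff p.2 (Q a)) fun p hp => ?_).congr fun a => ?_
  · have := Finset.HasAntidiagonal.mem_antidiagonal.1 hp
    exact (hP p.1 (by omega)).mul (hQ p.2 (by omega))
  · exact coeff_mul _ _ _

theorem neg (hP : RatPS u N P) : RatPS u N fun a => - P a :=
  fun n hn => (hP n hn).neg.congr fun a => by simp

theorem sub (hP : RatPS u N P) (hQ : RatPS u N Q) : RatPS u N fun a => P a - Q a :=
  (hP.add hQ.neg).congr fun _ => sub_eq_add_neg _ _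

theorem inv (hP : RatPS u N P) (h0 : ∀ a, constantCoeff (P a) ≠ 0) :
    RatPS u N fun a => (P a)⁻¹ := by
  intro n
  induction n using Nat.strong_induction_on with
  | _ n ih =>
    intro hn
    have hc : RatGen u fun a => (constantCoeff (P a))⁻¹ := by
      refine RatGen.inv ?_ h0
      simpa using hP 0 (by omega)
    by_cases h : n = 0
    · subst h
      refine hc.congr fun a => ?_
      rw [coeff_zero_eq_constantCoeff_apply, constantCoeff_inv]
    · refine ((hc.neg).mul (RatGen.sum (Finset.HasAntidiagonal.antidiagonal n)
        (F := fun p a => if p.2 < n then coeff p.1 (P a) * coeff p.2 (P a)⁻¹ else 0)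
        fun p hp => ?_)).congr fun a => ?_
      · have := Finset.HasAntidiagonal.mem_antidiagonal.1 hp
        by_cases hp2 : p.2 < n
        · simp only [hp2, if_true]
          exact (hP p.1 (by omega)).mul (ih p.2 hp2 (by omega))
        · simp only [hp2, if_false]
          exact RatGen.const 0
      · rw [coeff_inv, if_neg h]

theorem X_pow_mul (hP : RatPS u N P) (k : ℕ) : RatPS u (N + k) fun a => X ^ k * P a := by
  intro n hn
  by_cases h : k ≤ n
  · refine (hP (n - k) (by omega)).congr fun a => ?_
    rw [coeff_X_pow_mul', if_pos h]
  · refine (RatGen.const 0).congr fun a => ?_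
    rw [coeff_X_pow_mul', if_neg h]

theorem unshift (k : ℕ) (hP : RatPS u (N + k) P) : RatPS u N fun a => unshift k (P a) :=
  fun n hn => (hP (n + k) (by omega)).congr fun a => by simp

theorem derivative (hP : RatPS u (N + 1) P) : RatPS u N fun a => d⁄dX ℂ (P a) :=
  fun n hn => ((hP (n + 1) (by omega)).mul (RatGen.const ((n : ℂ) + 1))).congr fun a =>
    coeff_derivative _ _

theorem X_mul_derivative (hP : RatPS u N P) : RatPS u N fun a => X * d⁄dX ℂ (P a) := by
  rcases N with _ | N
  · intro n hn; omega
  · simpa using hP.derivative.X_pow_mul 1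

end RatPS

/-! ### Jets of power series -/

/-- The truncated power series with given coefficients. -/
def ser {r : ℕ} (v : Fin (r + 1) → ℂ) : PowerSeries ℂ :=
  PowerSeries.mk fun n => if h : n < r + 1 then v ⟨n, h⟩ else 0

theorem coeff_ser {r : ℕ} (v : Fin (r + 1) → ℂ) (n : ℕ) :
    coeff n (ser v) = if h : n < r + 1 then v ⟨n, h⟩ else 0 := coeff_mk _ _

theorem coeff_ser_fin {r : ℕ} (v : Fin (r + 1) → ℂ) (i : Fin (r + 1)) :
    coeff (i : ℕ) (ser v) = v i := by
  rw [coeff_ser, dif_pos i.2]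

theorem ratPS_ser {A κ : Type*} {u : A → κ → ℂ} {r : ℕ} {v : A → Fin (r + 1) → ℂ} (N : ℕ)
    (h : ∀ i : Fin (r + 1), (i : ℕ) < N → RatGen u fun a => v a i) : RatPS u N fun a => ser (v a) := by
  intro n hn
  by_cases h' : n < r + 1
  · exact (h ⟨n, h'⟩ hn).congr fun a => by rw [coeff_ser, dif_pos h']
  · exact (RatGen.const 0).congr fun a => by rw [coeff_ser, dif_neg h']

/-- The coefficients of a power series up to order `r`. -/
def trc (r : ℕ) (p : PowerSeries ℂ) : Fin (r + 1) → ℂ := fun i => coeff (i : ℕ) p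

/-- The component of a chart of the jet space. -/
def pt (r : ℕ) (e : Bool) (v : Fin (r + 1) → ℂ) : Quotient (jetSetoid r) :=
  Quotient.mk (jetSetoid r) (germOf r e v)

theorem localCoord_localCoord (e : Bool) (f : Germ) : localCoord e (localCoord e f) = f := by
  cases e <;> simp [localCoord]

/-- The power series underlying `germOf`. -/
def gser {r : ℕ} (v : Fin (r + 1) → ℂ) : PowerSeries ℂ := ser v + X ^ (r + 1)

theorem coe_gser {r : ℕ} (v : Fin (r + 1) → ℂ) : ((gser v : PowerSeries ℂ) : Germ)
    = (∑ i : Fin (r + 1), HahnSeries.single ((i : ℕ) : ℤ) (v i)) +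
      HahnSeries.single ((r : ℤ) + 1) 1 := by
  have h1 : ser v = ∑ i : Fin (r + 1), PowerSeries.monomial (i : ℕ) (v i) := by
    ext n
    rw [coeff_ser, map_sum]
    simp only [coeff_monomial]
    split_ifs with h
    · rw [Finset.sum_eq_single ⟨n, h⟩]
      · simp
      · intro b _ hb
        rw [if_neg]
        rintro rfl
        exact hb rfl
      · simp
    · rw [Finset.sum_eq_zero]
      intro b _
      rw [if_neg]
      have := b.2
      omega
  rw [gser, h1, map_add, map_sum, map_pow, HahnSeries.ofPowerSeries_X, HahnSeries.single_pow]
  congr 1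
  · refine Finset.sum_congr rfl fun i _ => ?_
    have : PowerSeries.monomial (i : ℕ) (v i) = C (v i) * X ^ (i : ℕ) := by
      rw [X_pow_eq, ← monomial_zero_eq_C_apply, monomial_mul_monomial, zero_add, mul_one]
    rw [this, map_mul, map_pow, HahnSeries.ofPowerSeries_X, HahnSeries.single_pow,
      HahnSeries.ofPowerSeries_C]
    simp
  · simp

theorem germOf_eq (r : ℕ) (e : Bool) (v : Fin (r + 1) → ℂ) :
    germOf r e v = localCoord e (gser v : PowerSeries ℂ) := by
  rw [coe_gser, germOf]

theorem gser_ne_zero {r : ℕ} (v : Fin (r + 1) → ℂ) : gser v ≠ 0 := by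
  intro h
  have := congrArg (coeff (r + 1)) h
  simp [gser, coeff_ser, coeff_X_pow] at this

theorem coeff_gser {r : ℕ} (v : Fin (r + 1) → ℂ) (i : Fin (r + 1)) : coeff (i : ℕ) (gser v) = v i := by
  rw [gser, map_add, coeff_ser_fin, coeff_X_pow, if_neg (by have := i.2; omega), add_zero]

theorem coe_ne_zero {p : PowerSeries ℂ} : (p : Germ) ≠ 0 ↔ p ≠ 0 :=
  map_ne_zero_iff _ HahnSeries.ofPowerSeries_injective

theorem visible_germOf (r : ℕ) (e : Bool) (v : Fin (r + 1) → ℂ) : Visible e (germOf r e v) := by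
  rw [germOf_eq]
  refine ⟨fun he => ?_, gser v, by rw [localCoord_localCoord]⟩
  subst he
  exact inv_ne_zero (coe_ne_zero.2 (gser_ne_zero v))

theorem coeff_coe_nat (p : PowerSeries ℂ) (i : ℕ) : (p : Germ).coeff i = coeff i p :=
  LaurentSeries.coeff_coe_powerSeries p i

theorem mk_eq_pt_iff {r : ℕ} {e : Bool} {f : Germ} {v : Fin (r + 1) → ℂ} :
    Quotient.mk (jetSetoid r) f = pt r e v ↔
      Visible e f ∧ ∀ i : Fin (r + 1), (localCoord e f).coeff (i : ℕ) = v i := by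
  have hg := visible_germOf r e v
  have hc : ∀ i : ℕ, ∀ h : i < r + 1, (localCoord e (germOf r e v)).coeff i = v ⟨i, h⟩ := by
    intro i h
    rw [germOf_eq, localCoord_localCoord, coeff_coe_nat]
    exact coeff_gser v ⟨i, h⟩
  rw [pt, Quotient.eq]
  constructor
  · rintro ⟨e', h1, h2, h3⟩
    obtain ⟨h4, h5⟩ := sameJet_change h1 h2 h3 hg
    exact ⟨h4, fun i => (h5 i (by have := i.2; omega)).trans (hc i i.2)⟩
  · rintro ⟨h1, h2⟩
    exact ⟨e, h1, hg, fun i hi => (h2 ⟨i, by omega⟩).trans (hc i (by omega)).symm⟩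

theorem mk_coe_eq_pt {r : ℕ} (p : PowerSeries ℂ) :
    Quotient.mk (jetSetoid r) (p : Germ) = pt r false (trc r p) := by
  rw [mk_eq_pt_iff]
  exact ⟨⟨by simp, p, by simp [localCoord]⟩, fun i => by simp [localCoord, trc]⟩

theorem mk_inv_eq_pt {r : ℕ} (p : PowerSeries ℂ) (hp : p ≠ 0) :
    Quotient.mk (jetSetoid r) (p : Germ)⁻¹ = pt r true (trc r p) := by
  rw [mk_eq_pt_iff]
  exact ⟨⟨fun _ => inv_ne_zero (coe_ne_zero.2 hp), p, by simp [localCoord]⟩,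
    fun i => by simp [localCoord, trc]⟩

theorem trc_ser {r : ℕ} (v : Fin (r + 1) → ℂ) : trc r (ser v) = v :=
  funext fun i => coeff_ser_fin v i

theorem pt_injective (r : ℕ) (e : Bool) : Function.Injective (pt r e) := by
  intro v w h
  rw [pt, mk_eq_pt_iff] at h
  funext i
  rw [← h.2 i, germOf_eq, localCoord_localCoord, coeff_coe_nat, coeff_gser]

/-- Transition between the two charts of `ℙ¹`. -/
def flip1 {r : ℕ} (v : Fin (r + 1) → ℂ) : Fin (r + 1) → ℂ := trc r (ser v)⁻¹

theorem coe_inv {p : PowerSeries ℂ} (hp : constantCoeff p ≠ 0) :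
    ((p⁻¹ : PowerSeries ℂ) : Germ) = (p : Germ)⁻¹ := by
  refine (inv_eq_of_mul_eq_one_right ?_).symm
  rw [← map_mul, PowerSeries.mul_inv_cancel p hp, map_one]

theorem constantCoeff_ser {r : ℕ} (v : Fin (r + 1) → ℂ) : constantCoeff (ser v) = v 0 := by
  rw [← coeff_zero_eq_constantCoeff_apply]
  exact coeff_ser_fin v 0

theorem ne_zero_of_constantCoeff {p : PowerSeries ℂ} (h : constantCoeff p ≠ 0) : p ≠ 0 := by
  rintro rfl
  simp at h

theorem pt_flip {r : ℕ} (e : Bool) {v : Fin (r + 1) → ℂ} (h : v 0 ≠ 0) :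
    pt r (!e) (flip1 v) = pt r e v := by
  have h0 : constantCoeff (ser v) ≠ 0 := by rwa [constantCoeff_ser]
  have h0' : constantCoeff (ser v)⁻¹ ≠ 0 := by
    rw [constantCoeff_inv]; exact inv_ne_zero h0
  cases e
  · rw [flip1, Bool.not_false, ← mk_inv_eq_pt _ (ne_zero_of_constantCoeff h0'), coe_inv h0, inv_inv,
      mk_coe_eq_pt, trc_ser]
  · rw [flip1, Bool.not_true, ← mk_coe_eq_pt, coe_inv h0, mk_inv_eq_pt _ (ne_zero_of_constantCoeff h0),
      trc_ser]

theorem constantCoeff_ne_zero_of_coe_inv {p q : PowerSeries ℂ} (hp : p ≠ 0)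
    (h : (p : Germ)⁻¹ = (q : Germ)) : constantCoeff p ≠ 0 := by
  have h1 : p * q = 1 := by
    apply HahnSeries.ofPowerSeries_injective (Γ := ℤ)
    rw [map_mul, ← h, map_one, mul_inv_cancel₀ (coe_ne_zero.2 hp)]
  intro h0
  have := congrArg constantCoeff h1
  simp [h0] at this

/-- A power series whose inverse is also regular has a nonzero value. Together with `pt_flip` this
identifies the overlap of the two charts of `ℙ¹`. -/
theorem ne_zero_of_pt_eq {r : ℕ} {e : Bool} {v w : Fin (r + 1) → ℂ} (h : pt r (!e) w = pt r e v) :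
    v 0 ≠ 0 := by
  have h1 : Visible (!e) (germOf r e v) := (mk_eq_pt_iff.1 h.symm).1
  have h2 : constantCoeff (gser v) = v 0 := by
    rw [← coeff_zero_eq_constantCoeff_apply]
    exact coeff_gser v 0
  rw [germOf_eq] at h1
  obtain ⟨_, q, hq⟩ := h1
  have h3 : ((gser v : PowerSeries ℂ) : Germ)⁻¹ = q := by
    cases e <;> simpa [localCoord] using hq
  rw [← h2]
  exact constantCoeff_ne_zero_of_coe_inv (gser_ne_zero v) h3

end DelayPainleve

end

noncomputable section
namespace DelayPainleve
open MvPolynomial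

/-! ### The Zariski topology of the jet space -/

theorem isOpen_zariskiCoord_iff {r : ℕ} {V : Set (Coord r)} :
    @IsOpen _ (zariskiCoord r) V ↔
      ∀ v ∈ V, ∃ f : MvPolynomial (Fin 2 × Fin (r + 1)) ℂ, eval v f ≠ 0 ∧
        ∀ w, eval w f ≠ 0 → w ∈ V := by
  have hmem : ∀ (f : MvPolynomial (Fin 2 × Fin (r + 1)) ℂ) (v : Coord r),
      (pointToPoint v : PrimeSpectrum _) ∈ PrimeSpectrum.basicOpen f ↔ eval v f ≠ 0 := by
    intro f v
    change f ∉ vanishingIdeal ℂ {v} ↔ _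
    rw [mem_vanishingIdeal_singleton_iff, aeval_eq_eval]
  rw [isOpen_induced_iff]
  constructor
  · rintro ⟨T, hT, rfl⟩ v hv
    obtain ⟨_, ⟨f, rfl⟩, h1, h2⟩ :=
      PrimeSpectrum.isTopologicalBasis_basic_opens.exists_subset_of_mem_open hv hT
    exact ⟨f, (hmem f v).1 h1, fun w hw => h2 ((hmem f w).2 hw)⟩
  · intro h
    choose! f hf1 hf2 using h
    refine ⟨⋃ v ∈ V, (PrimeSpectrum.basicOpen (f v) : Set _),
      isOpen_biUnion fun v _ => PrimeSpectrum.isOpen_basicOpen, ?_⟩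
    ext w
    simp only [Set.mem_preimage, Set.mem_iUnion, exists_prop]
    exact ⟨fun ⟨v, hv, hw⟩ => hf2 v hv w ((hmem _ _).1 hw),
      fun hw => ⟨w, hw, (hmem _ _).2 (hf1 w hw)⟩⟩

theorem isOpen_jet_iff {r : ℕ} {U : Set (Jet r)} :
    IsOpen U ↔ ∀ e v, chart r e v ∈ U →
      ∃ f : MvPolynomial (Fin 2 × Fin (r + 1)) ℂ, eval v f ≠ 0 ∧
        ∀ w, eval w f ≠ 0 → chart r e w ∈ U := by
  rw [show IsOpen U ↔ ∀ e, @IsOpen _ (zariskiCoord r) (chart r e ⁻¹' U) by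
    simp only [isOpen_iSup_iff, isOpen_coinduced]]
  simp only [isOpen_zariskiCoord_iff]
  rfl

/-- The components of a pair indexed by `Fin 2`. -/
def side (e : Bool × Bool) (k : Fin 2) : Bool := if k = 0 then e.1 else e.2

theorem chart_eq_chart_iff {r : ℕ} {e e' : Bool × Bool} {v w : Coord r} :
    chart r e' v = chart r e w ↔
      ∀ k, pt r (side e' k) (fun i => v (k, i)) = pt r (side e k) fun i => w (k, i) := by
  rw [Fin.forall_fin_two]
  exact Prod.mk.injEq _ _ _ _ ▸ Iff.rfl

/-- The points of the chart `e'` that lie in the chart `e`. -/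
def InOverlap {r : ℕ} (e e' : Bool × Bool) (v : Coord r) : Prop :=
  ∀ k, side e' k ≠ side e k → v (k, 0) ≠ 0

/-- The change of coordinates from the chart `e'` to the chart `e`. -/
def transition {r : ℕ} (e e' : Bool × Bool) (v : Coord r) : Coord r := fun p =>
  if side e' p.1 = side e p.1 then v p else flip1 (fun i => v (p.1, i)) p.2

theorem chart_transition {r : ℕ} {e e' : Bool × Bool} {v : Coord r} (h : InOverlap e e' v) :
    chart r e (transition e e' v) = chart r e' v := by
  rw [chart_eq_chart_iff]
  intro k
  simp only [transition]
  by_cases hk : side e' k = side e k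
  · simp [hk]
  · have hk' : side e k = !(side e' k) := by
      revert hk
      cases side e' k <;> cases side e k <;> simp
    simp only [hk, if_false]
    rw [hk']
    exact pt_flip (side e' k) (h k hk)

theorem chart_injective (r : ℕ) (e : Bool × Bool) : Function.Injective (chart r e) := by
  intro v w h
  rw [chart_eq_chart_iff] at h
  funext p
  exact congrFun (pt_injective r _ (h p.1)) p.2

theorem inOverlap_of_eq {r : ℕ} {e e' : Bool × Bool} {v w : Coord r}
    (h : chart r e' v = chart r e w) : InOverlap e e' v := by
  rw [chart_eq_chart_iff] at h
  intro k hk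
  have hk' : side e k = !(side e' k) := by
    revert hk
    cases side e' k <;> cases side e k <;> simp
  have := h k
  rw [hk'] at this
  exact ne_zero_of_pt_eq this.symm

theorem ratGen_transition {r : ℕ} (e e' : Bool × Bool) {A : Type*} (t : A → Coord r)
    (ht : ∀ a, InOverlap e e' (t a)) (p : Fin 2 × Fin (r + 1)) :
    RatGen t fun a => transition e e' (t a) p := by
  simp only [transition]
  by_cases hk : side e' p.1 = side e p.1
  · simp only [hk, if_true]
    exact RatGen.coord p
  · simp only [hk, if_false]
    have h1 : RatPS t (r + 1) fun a => ser fun i => t a (p.1, i) :=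
      ratPS_ser _ fun i _ => RatGen.coord (p.1, i)
    exact h1.inv (fun a => by rw [constantCoeff_ser]; exact ht a p.1 hk) p.2 p.2.2

/-- The equation of the complement of the overlap. -/
def overlapPoly (r : ℕ) (e e' : Bool × Bool) : MvPolynomial (Fin 2 × Fin (r + 1)) ℂ :=
  ∏ k : Fin 2, if side e' k = side e k then 1 else X (k, 0)

theorem eval_overlapPoly {r : ℕ} {e e' : Bool × Bool} {v : Coord r} :
    eval v (overlapPoly r e e') ≠ 0 ↔ InOverlap e e' v := by
  rw [overlapPoly, map_prod, Finset.prod_ne_zero_iff]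
  refine ⟨fun h k hk => ?_, fun h k _ => ?_⟩
  · have := h k (Finset.mem_univ _)
    rwa [if_neg hk, eval_X] at this
  · split_ifs with hk
    · simp
    · rw [eval_X]; exact h k hk

/-- In another chart the transition functions are rational with denominators that vanish nowhere on
the overlap. The preimage is therefore again the nonvanishing locus of one polynomial, the equation
of the complement of the overlap times a numerator of the transformed `f`. -/
theorem isOpen_chart_image {r : ℕ} (e : Bool × Bool) (f : MvPolynomial (Fin 2 × Fin (r + 1)) ℂ) :
    IsOpen (chart r e '' {v | eval v f ≠ 0}) := by
  rw [isOpen_jet_iff]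
  rintro e' v ⟨w, hw, hwv⟩
  have hv : InOverlap e e' v := inOverlap_of_eq hwv.symm
  obtain ⟨h, q, hq, hh⟩ := RatGen.eval
    (ratGen_transition e e' (fun a : {v : Coord r // InOverlap e e' v} => a.1) fun a => a.2) f
  have hw' : w = transition e e' v := chart_injective r e (hwv.trans (chart_transition hv).symm)
  refine ⟨overlapPoly r e e' * h, ?_, fun w' hw' => ?_⟩
  · rw [map_mul, mul_ne_zero_iff, eval_overlapPoly]
    refine ⟨hv, ?_⟩
    have := hh ⟨v, hv⟩
    rw [← this]
    refine mul_ne_zero ?_ (hq ⟨v, hv⟩)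
    change eval (transition e e' v) f ≠ 0
    rw [← hw']; exact hw
  · rw [map_mul, mul_ne_zero_iff, eval_overlapPoly] at hw'
    have := hh ⟨w', hw'.1⟩
    refine ⟨transition e e' w', fun h0 => hw'.2 ?_, chart_transition hw'.1⟩
    rw [← this]
    exact mul_eq_zero_of_left h0 _

/-- The ideal of the points of a set of jets that lie in a given chart. -/
abbrev chartIdeal {r : ℕ} (S : Set (Jet r)) (e : Bool × Bool) :
    Ideal (MvPolynomial (Fin 2 × Fin (r + 1)) ℂ) := vanishingIdeal ℂ (chart r e ⁻¹' S)

theorem mem_chartIdeal {r : ℕ} {S : Set (Jet r)} {e : Bool × Bool}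
    {f : MvPolynomial (Fin 2 × Fin (r + 1)) ℂ} :
    f ∈ chartIdeal S e ↔ ∀ v, chart r e v ∈ S → eval v f = 0 := by
  simp [chartIdeal, mem_vanishingIdeal_iff, aeval_eq_eval]

theorem exists_ne_zero_of_isOpen {r : ℕ} {S : Set (Jet r)} (hS : IsPreirreducible S)
    (e : Bool × Bool) {f : MvPolynomial (Fin 2 × Fin (r + 1)) ℂ} (hf : f ∉ chartIdeal S e)
    {U : Set (Jet r)} (hU : IsOpen U) (hSU : (S ∩ U).Nonempty) :
    ∃ v, chart r e v ∈ S ∧ chart r e v ∈ U ∧ eval v f ≠ 0 := by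
  rw [mem_chartIdeal] at hf
  push Not at hf
  obtain ⟨v, hv, hvf⟩ := hf
  obtain ⟨j, hj, hjU, w, hw, rfl⟩ := hS U _ hU (isOpen_chart_image e f) hSU
    ⟨chart r e v, hv, v, hvf, rfl⟩
  exact ⟨w, hj, hjU, hw⟩

/-- If neither factor vanishes identically on `S`, the two nonvanishing loci are open and meet `S`,
so by irreducibility they meet in a point of `S`. -/
theorem isPrime_chartIdeal {r : ℕ} {S : Set (Jet r)} (hS : IsPreirreducible S)
    {e : Bool × Bool} (hne : ∃ v, chart r e v ∈ S) : (chartIdeal S e).IsPrime := by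
  obtain ⟨v, hv⟩ := hne
  refine ⟨fun h => ?_, fun {f g} hfg => ?_⟩
  · have := mem_chartIdeal.1 ((Ideal.eq_top_iff_one _).1 h) v hv
    simp at this
  · by_contra hc
    push Not at hc
    obtain ⟨hf, hg⟩ := hc
    rw [mem_chartIdeal] at hg
    push Not at hg
    obtain ⟨w, hw, hwg⟩ := hg
    obtain ⟨v, h1, ⟨v', h2, h2'⟩, h3⟩ := exists_ne_zero_of_isOpen hS e hf (isOpen_chart_image e g)
      ⟨_, hw, w, hwg, rfl⟩
    rw [chart_injective r e h2'] at h2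
    have := mem_chartIdeal.1 hfg v h1
    rw [map_mul] at this
    exact (mul_ne_zero h3 h2) this

theorem isPreirreducible_chart_image {r : ℕ} (e : Bool × Bool) {T : Set (Coord r)}
    (hT : (vanishingIdeal ℂ T).IsPrime) : IsPreirreducible (chart r e '' T) := by
  rintro U V hU hV ⟨_, ⟨v, hv, rfl⟩, hvU⟩ ⟨_, ⟨w, hw, rfl⟩, hwV⟩
  obtain ⟨f, hf, hf'⟩ := isOpen_jet_iff.1 hU e v hvU
  obtain ⟨g, hg, hg'⟩ := isOpen_jet_iff.1 hV e w hwV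
  have hfg : f * g ∉ vanishingIdeal ℂ T := by
    intro h
    rcases hT.mem_or_mem h with h | h <;> rw [mem_vanishingIdeal_iff] at h
    · exact hf (by simpa [aeval_eq_eval] using h v hv)
    · exact hg (by simpa [aeval_eq_eval] using h w hw)
  rw [mem_vanishingIdeal_iff] at hfg
  push Not at hfg
  obtain ⟨z, hz, hzfg⟩ := hfg
  rw [map_mul, mul_ne_zero_iff, aeval_eq_eval] at hzfg
  exact ⟨_, ⟨z, hz, rfl⟩, hf' z hzfg.1, hg' z hzfg.2⟩

theorem isOpen_chart_compl {r : ℕ} (e : Bool × Bool)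
    (s : Set (MvPolynomial (Fin 2 × Fin (r + 1)) ℂ)) :
    IsOpen (chart r e '' {v | ¬ ∀ f ∈ s, eval v f = 0}) := by
  have : chart r e '' {v | ¬ ∀ f ∈ s, eval v f = 0} = ⋃ f ∈ s, chart r e '' {v | eval v f ≠ 0} := by
    ext j
    simp only [Set.mem_image, Set.mem_ofPred_eq, Set.mem_iUnion, not_forall]
    constructor
    · rintro ⟨v, ⟨f, hf, hv⟩, rfl⟩
      exact ⟨f, hf, v, hv, rfl⟩
    · rintro ⟨f, hf, v, hv, rfl⟩
      exact ⟨v, ⟨f, hf, hv⟩, rfl⟩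
  rw [this]
  exact isOpen_biUnion fun f _ => isOpen_chart_image e f

theorem isOpen_range_chart {r : ℕ} (e : Bool × Bool) : IsOpen (Set.range (chart r e)) := by
  simpa using isOpen_chart_image e (1 : MvPolynomial (Fin 2 × Fin (r + 1)) ℂ)

theorem isLocallyClosed_chart_image {r : ℕ} (e : Bool × Bool)
    (s : Set (MvPolynomial (Fin 2 × Fin (r + 1)) ℂ)) :
    IsLocallyClosed (chart r e '' {v | ∀ f ∈ s, eval v f = 0}) := by
  refine ⟨_, _, isOpen_range_chart e, (isOpen_chart_compl e s).isClosed_compl, ?_⟩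
  ext j
  constructor
  · rintro ⟨v, hv, rfl⟩
    refine ⟨⟨v, rfl⟩, ?_⟩
    rintro ⟨w, hw, hwv⟩
    rw [chart_injective r e hwv] at hw
    exact hw hv
  · rintro ⟨⟨v, rfl⟩, hv⟩
    by_contra hc
    exact hv ⟨v, fun h => hc ⟨v, h, rfl⟩, rfl⟩

theorem chart_mem_closure_iff {r : ℕ} (e : Bool × Bool)
    {s : Set (MvPolynomial (Fin 2 × Fin (r + 1)) ℂ)} {v : Coord r} :
    chart r e v ∈ closure (chart r e '' {v | ∀ f ∈ s, eval v f = 0}) ↔ ∀ f ∈ s, eval v f = 0 := by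
  constructor
  · intro h
    by_contra hc
    obtain ⟨_, ⟨w, hw, rfl⟩, w', hw', hww⟩ :=
      mem_closure_iff.1 h _ (isOpen_chart_compl e s) ⟨v, hc, rfl⟩
    rw [chart_injective r e hww] at hw'
    exact hw hw'
  · intro h
    exact subset_closure ⟨v, h, rfl⟩

/-- The part of an irreducible set in a chart that it meets is dense in it, so the equations need
only be tested there. -/
theorem subset_closure_chart_image_iff {r : ℕ} {S : Set (Jet r)} (hS : IsPreirreducible S)
    (e : Bool × Bool) (hne : ∃ v, chart r e v ∈ S)
    {s : Set (MvPolynomial (Fin 2 × Fin (r + 1)) ℂ)} :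
    S ⊆ closure (chart r e '' {v | ∀ f ∈ s, eval v f = 0}) ↔
      ∀ v, chart r e v ∈ S → ∀ f ∈ s, eval v f = 0 := by
  constructor
  · intro h v hv
    exact (chart_mem_closure_iff e).1 (h hv)
  · intro h j hj
    rw [mem_closure_iff]
    intro U hU hjU
    obtain ⟨v, hv⟩ := hne
    obtain ⟨_, h1, h2, w, rfl⟩ := hS U _ hU (isOpen_range_chart e) ⟨j, hj, hjU⟩ ⟨_, hv, v, rfl⟩
    exact ⟨_, h2, w, h w h1, rfl⟩

/-- On the overlap of two charts the coordinates are rational in each other, so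
`height_relIdeal_add_card_le` with no further functions compares the heights. Charts that miss `S`
contribute `⊤` to the infimum. -/
theorem codim_eq_of_irreducible {r : ℕ} {S : Set (Jet r)} (hS : IsPreirreducible S)
    {e : Bool × Bool} (hne : ∃ v, chart r e v ∈ S) : codim S = (chartIdeal S e).height := by
  refine le_antisymm (iInf_le _ e) (le_iInf fun e' => ?_)
  by_cases hne' : ∃ v, chart r e' v ∈ S
  swap
  · have : chart r e' ⁻¹' S = ∅ := by
      ext v
      simpa using fun h => hne' ⟨v, h⟩
    rw [this, vanishingIdeal_empty, Ideal.height_top]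
    exact le_top
  have hprime := isPrime_chartIdeal hS hne'
  let A := {v : Coord r // chart r e' v ∈ S ∧ InOverlap e e' v}
  have hov : overlapPoly r e e' ∉ chartIdeal S e' := by
    obtain ⟨v, hv⟩ := hne
    obtain ⟨v', hv'⟩ := hne'
    obtain ⟨_, h1, ⟨w, rfl⟩, w', hw'⟩ := hS _ _ (isOpen_range_chart e) (isOpen_range_chart e')
      ⟨_, hv, v, rfl⟩ ⟨_, hv', v', rfl⟩
    intro h
    refine eval_overlapPoly.2 (inOverlap_of_eq hw') (mem_chartIdeal.1 h w' ?_)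
    rwa [hw']
  -- The overlap is dense in the part of `S` in this chart, so restricting to it creates no new
  -- relations.
  have hrel : relIdeal (fun a : A => a.1) = chartIdeal S e' := by
    ext f
    rw [mem_relIdeal, mem_chartIdeal]
    refine ⟨fun h v hv => ?_, fun h a => h _ a.2.1⟩
    have : overlapPoly r e e' * f ∈ chartIdeal S e' := by
      rw [mem_chartIdeal]
      intro w hw
      rw [map_mul]
      by_cases ho : InOverlap e e' w
      · rw [h ⟨w, hw, ho⟩, mul_zero]
      · rw [← eval_overlapPoly, not_not] at ho
        rw [ho, zero_mul]
    exact mem_chartIdeal.1 ((hprime.mem_or_mem this).resolve_left hov) v hv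
  have hp' : (relIdeal (fun a : A => a.1)).IsPrime := hrel ▸ hprime
  have key := height_relIdeal_add_card_le (fun a : A => a.1) (fun a => transition e e' a.1)
    (fun _ (i : Fin 0) => i.elim0) (ratGen_transition e e' _ fun a => a.2.2)
    (fun i => i.elim0) (fun p => by
      have hback : ∀ a : A, InOverlap e' e (transition e e' a.1) := fun a =>
        inOverlap_of_eq (chart_transition a.2.2)
      refine ((ratGen_transition e' e (fun a : A => transition e e' a.1) hback p).congr
        fun a => ?_).trans fun i => RatGen.coord (Sum.inl i)
      exact (congrFun (chart_injective r e'
        ((chart_transition (hback a)).trans (chart_transition a.2.2))) p).symm)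
  rw [hrel] at key
  simp only [Fintype.card_fin, Nat.cast_zero, add_zero] at key
  have key' := (ENat.add_le_add_iff_right (ENat.natCast_ne_top _)).1 key
  refine le_trans (Ideal.height_mono ?_) key'
  intro f hf
  rw [mem_relIdeal]
  intro a
  refine mem_chartIdeal.1 hf _ ?_
  rw [chart_transition a.2.2]
  exact a.2.1

end DelayPainleve

end

noncomputable section
namespace DelayPainleve
open MvPolynomial

/-! ### Codimensions of linear subspaces and of images -/

theorem chartIdeal_eq_relIdeal {r : ℕ} (S : Set (Jet r)) (e : Bool × Bool) :
    chartIdeal S e = relIdeal (fun a : {v : Coord r // chart r e v ∈ S} => a.1) := by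
  ext f
  rw [mem_chartIdeal, mem_relIdeal]
  exact ⟨fun h a => h a.1 a.2, fun h v hv => h ⟨v, hv⟩⟩

/-- The parametrization of a linear subspace given by the coordinates not in the range of `k`. -/
def linParam {ι τ : Type*} [DecidableEq τ] (k : ι → τ) (c : ι → ℂ) (j₀ : {j // j ∉ Set.range k})
    (w : {j // j ∉ Set.range k} → ℂ) (j : τ) : ℂ :=
  open Classical in
  if h : j ∈ Set.range k then c h.choose * w j₀ else w ⟨j, h⟩

theorem linParam_apply {ι τ : Type*} [DecidableEq τ] {k : ι → τ} (hk : Function.Injective k)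
    (c : ι → ℂ) (j₀ : {j // j ∉ Set.range k}) (w : {j // j ∉ Set.range k} → ℂ) (i : ι) :
    linParam k c j₀ w (k i) = c i * w j₀ := by
  have h : k i ∈ Set.range k := ⟨i, rfl⟩
  rw [linParam, dif_pos h, hk h.choose_spec]

theorem linParam_val {ι τ : Type*} [DecidableEq τ] (k : ι → τ)
    (c : ι → ℂ) (j₀ : {j // j ∉ Set.range k}) (w : {j // j ∉ Set.range k} → ℂ)
    (j : {j // j ∉ Set.range k}) : linParam k c j₀ w j.1 = w j := by
  rw [linParam, dif_neg j.2]

theorem ratGen_linParam {ι τ : Type*} [DecidableEq τ] (k : ι → τ)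
    (c : ι → ℂ) (j₀ : {j // j ∉ Set.range k}) (j : τ) :
    RatGen (fun w : {j // j ∉ Set.range k} → ℂ => w) fun w => linParam k c j₀ w j := by
  by_cases h : j ∈ Set.range k
  · exact ((RatGen.const (c h.choose)).mul (RatGen.coord j₀)).congr fun w => by
      rw [linParam, dif_pos h]
  · exact (RatGen.coord ⟨j, h⟩).congr fun w => by rw [linParam, dif_neg h]

theorem relIdeal_id (κ : Type*) : relIdeal (fun w : κ → ℂ => w) = ⊥ := by
  rw [eq_bot_iff]
  intro f hf
  rw [mem_relIdeal] at hf
  exact MvPolynomial.funext fun w => by rw [hf w, map_zero]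

/-- The ideal is prime as the kernel of a substitution. The parameters are themselves coordinates,
which bounds the height above; the dependent coordinates bound it below. Conditions `v (k i) = c i *
v j₀` serve both kinds of sets: `c = 0` gives vanishing coefficients, and `j₀` the index of `x₀`
gives proportionality to a fixed series. -/
theorem linParam_spec {ι τ : Type*} [Fintype τ] [DecidableEq τ] [Fintype ι] {k : ι → τ}
    (hk : Function.Injective k) (c : ι → ℂ) (j₀ : {j // j ∉ Set.range k}) :
    (relIdeal (linParam k c j₀)).IsPrime ∧
      (relIdeal (linParam k c j₀)).height = Fintype.card ι := by
  classical
  constructor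
  · let Φ : τ → MvPolynomial {j // j ∉ Set.range k} ℂ := fun j =>
      if h : j ∈ Set.range k then C (c h.choose) * X j₀ else X ⟨j, h⟩
    have hΦ : ∀ j w, eval w (Φ j) = linParam k c j₀ w j := by
      intro j w
      simp only [Φ, linParam]
      split_ifs <;> simp
    have : relIdeal (linParam k c j₀) = RingHom.ker (aeval (R := ℂ) Φ) := by
      ext f
      rw [mem_relIdeal, RingHom.mem_ker]
      have he : ∀ w, eval (linParam k c j₀ w) f = eval w (aeval Φ f) := by
        intro w
        induction f using MvPolynomial.induction_on with
        | C a => simp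
        | add p q hp hq => simp [hp, hq]
        | mul_X p i hp => simp [hp, hΦ]
      simp only [he]
      exact ⟨fun h => MvPolynomial.funext fun w => by rw [h w, map_zero], fun h w => by
        rw [h, map_zero]⟩
    rw [this]
    exact RingHom.ker_isPrime _
  · refine le_antisymm ?_ ?_
    · have hp : (relIdeal (fun w : {j // j ∉ Set.range k} → ℂ => w)).IsPrime := by
        rw [relIdeal_id]
        exact Ideal.isPrime_bot
      have key := height_relIdeal_add_card_le (fun w : {j // j ∉ Set.range k} → ℂ => w)
        (linParam k c j₀) (fun _ (i : Fin 0) => i.elim0) (ratGen_linParam k c j₀)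
        (fun i => i.elim0) (fun j => (RatGen.coord (Sum.inl j.1)).congr fun w =>
          (linParam_val k c j₀ w j).symm)
      rw [relIdeal_id, Ideal.height_bot, zero_add, Fintype.card_fin, Nat.cast_zero, add_zero] at key
      have h2 : Fintype.card τ = Fintype.card ι + Fintype.card {j // j ∉ Set.range k} := by
        rw [Fintype.card_subtype_compl, Set.card_range_of_injective hk]
        have := Fintype.card_le_of_injective k hk
        omega
      rw [h2] at key
      push_cast at key
      exact (ENat.add_le_add_iff_right (ENat.natCast_ne_top _)).1 key
    · refine card_le_height_relIdeal _ k hk fun i => ?_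
      refine ((RatGen.const (c i)).mul (RatGen.coord j₀)).congr fun w => ?_
      rw [linParam_apply hk, linParam_val]

theorem range_linParam {ι τ : Type*} [DecidableEq τ] {k : ι → τ}
    (hk : Function.Injective k) (c : ι → ℂ) (j₀ : {j // j ∉ Set.range k}) :
    Set.range (linParam k c j₀) = {v | ∀ i, v (k i) = c i * v j₀} := by
  ext v
  constructor
  · rintro ⟨w, rfl⟩ i
    rw [linParam_apply hk, linParam_val]
  · intro h
    refine ⟨fun j => v j, funext fun j => ?_⟩
    by_cases hj : j ∈ Set.range k
    · obtain ⟨i, rfl⟩ := hj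
      rw [linParam_apply hk, h i]
    · exact linParam_val k c j₀ _ ⟨j, hj⟩

/-- Linear subspaces of the `(x, y)`-chart are subvarieties of the expected codimension. -/
theorem linear_isSubvariety {r : ℕ} {ι : Type*} [Fintype ι] {k : ι → Fin 2 × Fin (r + 1)}
    (hk : Function.Injective k) (c : ι → ℂ) (j₀ : {j // j ∉ Set.range k}) :
    IsSubvariety (chart r (false, false) '' {v | ∀ i, v (k i) = c i * v j₀}) ∧
      codim (chart r (false, false) '' {v | ∀ i, v (k i) = c i * v j₀}) = Fintype.card ι := by
  obtain ⟨h1, h2⟩ := linParam_spec hk c j₀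
  have hirr := isPreirreducible_chart_image (false, false) h1
  rw [range_linParam hk] at hirr
  have hne : (0 : Coord r) ∈ {v : Coord r | ∀ i, v (k i) = c i * v j₀} := by
    intro i; simp
  refine ⟨⟨⟨⟨_, 0, hne, rfl⟩, hirr⟩, ?_⟩, ?_⟩
  · convert isLocallyClosed_chart_image (false, false)
      (Set.range fun i => (X (k i) - C (c i) * X j₀.1 : MvPolynomial (Fin 2 × Fin (r + 1)) ℂ))
      using 3
    simp [sub_eq_zero]
  · rw [codim_eq_of_irreducible hirr ⟨0, 0, hne, rfl⟩, chartIdeal,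
      Set.preimage_image_eq _ (chart_injective r _), ← range_linParam hk]
    exact h2

/-- As a supremum over open sets, `imageCodim` needs only one good `U`; as an infimum over charts,
`codim` needs dependent coordinates in each chart separately. -/
theorem le_imageCodim {E : DelayEquation} {c : ℂ} {r : ℕ} {B U : Set (Jet (r + 1))}
    (hU : IsOpen U) (hne : (B ∩ U).Nonempty) {ι : Type*} [Fintype ι]
    (h : ∀ e, ∃ k : ι → Fin 2 × Fin (r + 1), Function.Injective k ∧
      ∀ i, RatGen (fun (a : {v : Coord r // chart r e v ∈ image E c r (B ∩ U)})
        (j : {j // j ∉ Set.range k}) => a.1 j) fun a => a.1 (k i)) :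
    (Fintype.card ι : ℕ∞) ≤ imageCodim E c r B := by
  refine le_trans (le_iInf fun e => ?_) (le_iSup₂_of_le U hU (le_iSup_of_le hne le_rfl))
  obtain ⟨k, hk, hk'⟩ := h e
  exact (card_le_height_relIdeal _ k hk hk').trans_eq
    (congrArg Ideal.height (chartIdeal_eq_relIdeal _ e).symm)

/-- Restriction of the families in `imageCodim` to a small open set. -/
theorem imageCodim_le {E : DelayEquation} {c : ℂ} {r : ℕ} {S : Set (Jet (r + 1))} {N : ℕ∞}
    (hS : IsPreirreducible S)
    {g : MvPolynomial (Fin 2 × Fin (r + 1 + 1)) ℂ} (hg : g ∉ chartIdeal S (false, false))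
    (h : ∀ f : MvPolynomial (Fin 2 × Fin (r + 1 + 1)) ℂ,
      (∃ v, chart (r + 1) (false, false) v ∈ S ∧ eval v g ≠ 0 ∧ eval v f ≠ 0) →
      codim (image E c r (chart (r + 1) (false, false) ''
        {v | chart (r + 1) (false, false) v ∈ S ∧ eval v g ≠ 0 ∧ eval v f ≠ 0})) ≤ N) :
    imageCodim E c r S ≤ N := by
  refine iSup_le fun U => iSup_le fun hU => iSup_le fun hne => ?_
  obtain ⟨v, hvS, hvU, hvg⟩ := exists_ne_zero_of_isOpen hS _ hg hU hne
  -- A smaller set has an image of larger codimension, so `U` may be shrunk to a basic open set that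
  -- still meets `S`.
  obtain ⟨f, hf, hf'⟩ := isOpen_jet_iff.1 hU _ v hvU
  refine le_trans ?_ (h f ⟨v, hvS, hvg, hf⟩)
  refine iInf_mono fun e => Ideal.height_mono (vanishingIdeal_anti_mono ?_)
  refine Set.preimage_mono ?_
  rintro j ⟨x, y, x', hx, ⟨w, ⟨hw1, _, hw3⟩, hw⟩, hE, rfl⟩
  exact ⟨x, y, x', hx, by rw [← hw]; exact ⟨hw1, hf' w hw3⟩, hE, rfl⟩

theorem image_mono {E : DelayEquation} {c : ℂ} {r : ℕ} {S T : Set (Jet (r + 1))} (h : S ⊆ T) :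
    image E c r S ⊆ image E c r T := by
  rintro j ⟨x, y, x', hx, hj, hE, rfl⟩
  exact ⟨x, y, x', hx, h hj, hE, rfl⟩

/-- If on a dense open part of `S` the jets can be recovered from jets in the image and `k + 2`
further coordinates, the codimension increases by at most `k`. -/
theorem imageCodim_le_codim_add {E : DelayEquation} {c : ℂ} {r : ℕ} {S : Set (Jet (r + 1))}
    (hS : IsPreirreducible S)
    {g : MvPolynomial (Fin 2 × Fin (r + 1 + 1)) ℂ} (hg : g ∉ chartIdeal S (false, false))
    (k : ℕ) {ρ : Type*} [Fintype ρ] (hρ : Fintype.card ρ = k + 2)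
    (p : ρ → Fin 2 × Fin (r + 1 + 1)) (e : Bool × Bool) (F : Coord (r + 1) → Coord r)
    (hI : ∀ a, chart (r + 1) (false, false) a ∈ S → eval a g ≠ 0 →
      chart r e (F a) ∈ image E c r {chart (r + 1) (false, false) a})
    (hF : ∀ j, RatGen (fun a : {a // chart (r + 1) (false, false) a ∈ S ∧ eval a g ≠ 0} => a.1)
      fun a => F a.1 j)
    (ht : ∀ i, RatGen (fun a : {a // chart (r + 1) (false, false) a ∈ S ∧ eval a g ≠ 0} =>
      Sum.elim (F a.1) fun l => a.1 (p l)) fun a => a.1 i) :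
    imageCodim E c r S ≤ codim S + k := by
  have hne : ∃ v, chart (r + 1) (false, false) v ∈ S := by
    by_contra hc
    exact hg (mem_chartIdeal.2 fun v hv => (hc ⟨v, hv⟩).elim)
  have hprime := isPrime_chartIdeal hS hne
  refine imageCodim_le hS hg fun f hf => ?_
  rw [codim_eq_of_irreducible hS hne]
  let A := {v // chart (r + 1) (false, false) v ∈ S ∧ eval v g ≠ 0 ∧ eval v f ≠ 0}
  let ι : A → {a // chart (r + 1) (false, false) a ∈ S ∧ eval a g ≠ 0} := fun a =>
    ⟨a.1, a.2.1, a.2.2.1⟩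
  have hfS : f ∉ chartIdeal S (false, false) := by
    obtain ⟨v, h1, _, h3⟩ := hf
    exact fun h => h3 (mem_chartIdeal.1 h v h1)
  have hrel : relIdeal (fun a : A => a.1) = chartIdeal S (false, false) := by
    ext q
    rw [mem_relIdeal]
    refine ⟨fun h => ?_, fun h a => mem_chartIdeal.1 h a.1 a.2.1⟩
    have : g * (f * q) ∈ chartIdeal S (false, false) := by
      rw [mem_chartIdeal]
      intro w hw
      rw [map_mul, map_mul]
      by_cases h1 : eval w g = 0
      · rw [h1, zero_mul]
      by_cases h2 : eval w f = 0
      · rw [h2, zero_mul, mul_zero]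
      rw [h ⟨w, hw, h1, h2⟩, mul_zero, mul_zero]
    exact (hprime.mem_or_mem ((hprime.mem_or_mem this).resolve_left hg)).resolve_left hfS
  have hp' : (relIdeal (fun a : A => a.1)).IsPrime := hrel ▸ hprime
  have key := height_relIdeal_add_card_le (fun a : A => a.1) (fun a => F a.1)
    (fun a l => a.1 (p l)) (fun j => (hF j).comp ι) (fun l => RatGen.coord (p l))
    (fun i => (ht i).comp ι)
  rw [hrel, hρ] at key
  -- These two coordinates, lost in passing from `J^(r+1)` to `J^r`, account for the `2` in `hρ`.
  have hc : Fintype.card (Fin 2 × Fin (r + 1 + 1)) = Fintype.card (Fin 2 × Fin (r + 1)) + 2 := by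
    simp only [Fintype.card_prod, Fintype.card_fin]
    ring
  have key' : (relIdeal fun a : A => F a.1).height + (Fintype.card (Fin 2 × Fin (r + 1)) + 2 : ℕ)
      ≤ ((chartIdeal S (false, false)).height + k) + (Fintype.card (Fin 2 × Fin (r + 1)) + 2 : ℕ) := by
    rw [hc] at key
    refine key.trans_eq ?_
    push_cast
    ring
  refine le_trans ?_ ((ENat.add_le_add_iff_right (ENat.natCast_ne_top _)).1 key')
  refine (iInf_le _ e).trans (Ideal.height_mono ?_)
  intro q hq
  rw [mem_relIdeal]
  intro a
  refine mem_chartIdeal.1 hq _ (image_mono ?_ (hI a.1 a.2.1 a.2.2.1))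
  rintro _ rfl
  exact ⟨a.1, a.2, rfl⟩

end DelayPainleve

end

noncomputable section
namespace DelayPainleve
open PowerSeries

/-! ### Jets of regular sections -/

theorem jet_eq_chart_iff {r : ℕ} {x y : Germ} {e : Bool × Bool} {v : Coord r} :
    jet r x y = chart r e v ↔
      (Visible e.1 x ∧ ∀ i : Fin (r + 1), (localCoord e.1 x).coeff (i : ℕ) = v (0, i)) ∧
      (Visible e.2 y ∧ ∀ i : Fin (r + 1), (localCoord e.2 y).coeff (i : ℕ) = v (1, i)) := by
  rw [← mk_eq_pt_iff, ← mk_eq_pt_iff]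
  exact Prod.mk.injEq _ _ _ _ ▸ Iff.rfl

/-- The coordinates with given components. -/
def pack {r : ℕ} (v w : Fin (r + 1) → ℂ) : Coord r := fun j => if j.1 = 0 then v j.2 else w j.2

@[simp] theorem pack_zero {r : ℕ} (v w : Fin (r + 1) → ℂ) (i : Fin (r + 1)) :
    pack v w (0, i) = v i := by simp [pack]

@[simp] theorem pack_one {r : ℕ} (v w : Fin (r + 1) → ℂ) (i : Fin (r + 1)) :
    pack v w (1, i) = w i := by simp [pack]

theorem visible_false_coe (p : PowerSeries ℂ) : Visible false (p : Germ) :=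
  ⟨by simp, p, rfl⟩

theorem jet_coe_coe (r : ℕ) (p q : PowerSeries ℂ) :
    jet r (p : Germ) (q : Germ) = chart r (false, false) (pack (trc r p) (trc r q)) :=
  jet_eq_chart_iff.2 ⟨⟨visible_false_coe p, fun i => by simp [localCoord, trc]⟩,
    visible_false_coe q, fun i => by simp [localCoord, trc]⟩

theorem jet_inv_coe (r : ℕ) {p : PowerSeries ℂ} (hp : p ≠ 0) (q : PowerSeries ℂ) :
    jet r (p : Germ)⁻¹ (q : Germ) = chart r (true, false) (pack (trc r p) (trc r q)) :=
  jet_eq_chart_iff.2 ⟨⟨⟨fun _ => inv_ne_zero (coe_ne_zero.2 hp), p, by simp [localCoord]⟩,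
    fun i => by simp [localCoord, trc]⟩,
    visible_false_coe q, fun i => by simp [localCoord, trc]⟩

/-- The first, respectively second, component of a point of a chart, as a power series. -/
def comp {r : ℕ} (k : Fin 2) (v : Coord r) : PowerSeries ℂ := ser fun i => v (k, i)

theorem coeff_comp {r : ℕ} (k : Fin 2) (v : Coord r) (i : Fin (r + 1)) :
    coeff (i : ℕ) (comp k v) = v (k, i) := coeff_ser_fin _ i

theorem coeff_comp_of_lt {r : ℕ} (k : Fin 2) (v : Coord r) {n : ℕ} (hn : n < r + 1) :
    coeff n (comp k v) = v (k, ⟨n, hn⟩) := coeff_ser_fin _ ⟨n, hn⟩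

theorem coeff_comp_of_le {r : ℕ} (k : Fin 2) (v : Coord r) {n : ℕ} (hn : r + 1 ≤ n) :
    coeff n (comp k v) = 0 := by
  rw [comp, coeff_ser, dif_neg (by omega)]

theorem chart_eq_jet {r : ℕ} (v : Coord r) :
    chart r (false, false) v = jet r (comp 0 v : PowerSeries ℂ) (comp 1 v : PowerSeries ℂ) := by
  rw [jet_coe_coe]
  congr 1
  funext ⟨k, i⟩
  fin_cases k <;> simp [trc, coeff_comp]

theorem ratPS_comp {A κ : Type*} {u : A → κ → ℂ} {r : ℕ} {v : A → Coord r} {k : Fin 2} (N : ℕ)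
    (h : ∀ i : Fin (r + 1), (i : ℕ) < N → RatGen u fun a => v a (k, i)) :
    RatPS u N fun a => comp k (v a) := ratPS_ser N h

theorem exists_of_jet_eq_chart {r : ℕ} {x y : Germ} {v : Coord r}
    (h : jet r x y = chart r (false, false) v) : ∃ p q : PowerSeries ℂ,
      x = (p : Germ) ∧ y = (q : Germ) ∧ (∀ i : Fin (r + 1), coeff (i : ℕ) p = v (0, i)) ∧
        ∀ i : Fin (r + 1), coeff (i : ℕ) q = v (1, i) := by
  obtain ⟨⟨⟨_, p, hp⟩, h1⟩, ⟨_, q, hq⟩, h2⟩ := jet_eq_chart_iff.1 h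
  simp only [localCoord, Bool.false_eq_true, if_false] at hp hq h1 h2
  subst hp hq
  exact ⟨p, q, rfl, rfl, fun i => by rw [← h1 i, coeff_coe_nat], fun i => by
    rw [← h2 i, coeff_coe_nat]⟩

theorem eq_false_of_visible_coe {e : Bool} {p : PowerSeries ℂ} (h : Visible e (p : Germ))
    (h0 : constantCoeff p = 0) : e = false := by
  cases e
  · rfl
  · obtain ⟨hp, q, hq⟩ := h
    exact (constantCoeff_ne_zero_of_coe_inv (coe_ne_zero.1 (hp rfl))
      (by simpa [localCoord] using hq) h0).elim

theorem eq_true_of_visible_inv {e : Bool} {p : PowerSeries ℂ} (hp : p ≠ 0)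
    (h : Visible e (p : Germ)⁻¹) (h0 : constantCoeff p = 0) : e = true := by
  cases e
  · obtain ⟨_, q, hq⟩ := h
    exact (constantCoeff_ne_zero_of_coe_inv hp (by simpa [localCoord] using hq) h0).elim
  · rfl

theorem zeroSet_eq (r m : ℕ) : zeroSet r m = chart (r + 1) (false, false) ''
    {v | ∀ i : Fin (r + 1 + 1), (i : ℕ) < m → v (0, i) = 0} := by
  ext j
  constructor
  · rintro ⟨_, _, ⟨p, rfl⟩, ⟨q, rfl⟩, h, rfl⟩
    refine ⟨_, fun i hi => ?_, (jet_coe_coe _ p q).symm⟩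
    have := h i hi
    rw [coeff_coe_nat] at this
    simpa [trc] using this
  · rintro ⟨v, hv, rfl⟩
    refine ⟨_, _, ⟨_, rfl⟩, ⟨_, rfl⟩, fun i hi => ?_, chart_eq_jet v⟩
    rw [coeff_coe_nat]
    by_cases h : i < r + 1 + 1
    · rw [coeff_comp_of_lt 0 v h]
      exact hv ⟨i, h⟩ hi
    · exact coeff_comp_of_le 0 v (not_lt.1 h)

theorem coeff_inv_congr {d n : ℕ} {p q : PowerSeries ℂ} (hp : constantCoeff p ≠ 0)
    (hq : constantCoeff q ≠ 0) (h : ∀ i < d, coeff i p = coeff i q) (hn : n < d) :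
    coeff n p⁻¹ = coeff n q⁻¹ := by
  have h1 : (X : PowerSeries ℂ) ^ d ∣ q - p := by
    rw [X_pow_dvd_iff]
    intro i hi
    rw [map_sub, h i hi, sub_self]
  have h2 : p⁻¹ - q⁻¹ = (q - p) * (p⁻¹ * q⁻¹) := by
    linear_combination (-p⁻¹) * (PowerSeries.mul_inv_cancel q hq)
      + q⁻¹ * (PowerSeries.mul_inv_cancel p hp)
  have h3 := X_pow_dvd_iff.1 (h2 ▸ h1.mul_right (p⁻¹ * q⁻¹)) n hn
  rw [map_sub] at h3
  exact sub_eq_zero.1 h3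

theorem der_coe (p : PowerSeries ℂ) : der (p : Germ) = ((d⁄dX ℂ p : PowerSeries ℂ) : Germ) := by
  ext n
  rw [der, LaurentSeries.derivative_apply, LaurentSeries.hasseDeriv_coeff, Ring.choose_one_right]
  rcases lt_or_ge n 0 with hn | hn
  · rw [PowerSeries.coeff_coe (f := d⁄dX ℂ p), if_pos hn]
    rcases eq_or_ne n (-1) with rfl | hn'
    · simp
    · rw [PowerSeries.coeff_coe, if_pos (by push_cast; omega), smul_zero]
  · obtain ⟨m, rfl⟩ := Int.eq_ofNat_of_zero_le hn
    rw [coeff_coe_nat, coeff_derivative, ← Nat.cast_add, coeff_coe_nat]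
    simp [mul_comm]

theorem zAt_eq (c : ℂ) : zAt c = ((C c + X : PowerSeries ℂ) : Germ) := by
  simp [zAt]

theorem smul_coe (c : ℂ) (p : PowerSeries ℂ) : c • (p : Germ) = ((C c * p : PowerSeries ℂ) : Germ) := by
  rw [← smul_eq_C_mul]
  simp

/-- The order of vanishing splits off. -/
theorem exists_eq_X_pow_mul {p : PowerSeries ℂ} (hp : p ≠ 0) :
    ∃ (n : ℕ) (ξ : PowerSeries ℂ), constantCoeff ξ ≠ 0 ∧ p = X ^ n * ξ := by
  classical
  have h : ∃ n, coeff n p ≠ 0 := by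
    by_contra hc
    push Not at hc
    exact hp (PowerSeries.ext fun n => by simpa using hc n)
  refine ⟨Nat.find h, unshift (Nat.find h) p, ?_, (X_pow_mul_unshift fun i hi => ?_).symm⟩
  · rw [← coeff_zero_eq_constantCoeff_apply, coeff_unshift, zero_add]
    exact Nat.find_spec h
  · exact not_not.1 (Nat.find_min h hi)

end DelayPainleve

end

noncomputable section
namespace DelayPainleve
open PowerSeries

/-! ### Equations `x̄ = y + R(x)` -/

/-- The equation has the form `x̄ = y + R(x)` where `R (ζ ^ m ξ) = ζ ^ (-d m) H m ξ` for `ξ`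
invertible, with `H m ξ` invertible when `m` is positive. -/
structure PoleForm (E : DelayEquation) (d : ℕ → ℕ) (H : ℕ → PowerSeries ℂ → PowerSeries ℂ) :
    Prop where
  eqn : ∀ c m (ξ q : PowerSeries ℂ) (v : Germ), constantCoeff ξ ≠ 0 →
    (E c (q : Germ) ((X ^ m * ξ : PowerSeries ℂ) : Germ) v ↔
      v * ((X ^ d m : PowerSeries ℂ) : Germ) = ((X ^ d m * q + H m ξ : PowerSeries ℂ) : Germ))
  d_zero : d 0 = 0
  d_pos : ∀ m, 1 ≤ m → 1 ≤ d m
  ne_zero : ∀ m ξ, 1 ≤ m → constantCoeff ξ ≠ 0 → constantCoeff (H m ξ) ≠ 0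
  ratPS : ∀ (A κ : Type) (u : A → κ → ℂ) (N m : ℕ) (ξ : A → PowerSeries ℂ),
    (∀ a, constantCoeff (ξ a) ≠ 0) → RatPS u (N + 1) ξ → RatPS u N fun a => H m (ξ a)
  ratPS_low : ∀ (A κ : Type) (u : A → κ → ℂ) (n N m : ℕ) (ξ : A → PowerSeries ℂ), 1 ≤ m →
    n ≤ d m → n + d m ≤ N + m →
    (∀ a, constantCoeff (ξ a) ≠ 0) → RatPS u N ξ → RatPS u n fun a => H m (ξ a)
  exists_ne : ∃ ξ, constantCoeff ξ ≠ 0 ∧ constantCoeff (H 0 ξ) ≠ 0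

/-- The reciprocal of the iterate at a zero of order `m`, with `δ = d m` and `h = H m ξ`. -/
def poleInv (δ : ℕ) (h q : PowerSeries ℂ) : PowerSeries ℂ := X ^ δ * (X ^ δ * q + h)⁻¹

theorem constantCoeff_pole {δ : ℕ} (hδ : 1 ≤ δ) (h q : PowerSeries ℂ) :
    constantCoeff (X ^ δ * q + h) = constantCoeff h := by
  simp [show δ ≠ 0 by omega]

theorem poleInv_ne_zero {δ : ℕ} (hδ : 1 ≤ δ) {h : PowerSeries ℂ} (q : PowerSeries ℂ)
    (h0 : constantCoeff h ≠ 0) : poleInv δ h q ≠ 0 := by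
  refine mul_ne_zero (pow_ne_zero _ X_ne_zero) (ne_zero_of_constantCoeff ?_)
  rw [constantCoeff_inv, constantCoeff_pole hδ]
  exact inv_ne_zero h0

theorem constantCoeff_poleInv {δ : ℕ} (hδ : 1 ≤ δ) (h q : PowerSeries ℂ) :
    constantCoeff (poleInv δ h q) = 0 := by
  simp [poleInv, show δ ≠ 0 by omega]

theorem mul_eq_iff_eq_poleInv {δ : ℕ} (hδ : 1 ≤ δ) {h : PowerSeries ℂ} (q : PowerSeries ℂ)
    (h0 : constantCoeff h ≠ 0) (v : Germ) :
    v * ((X ^ δ : PowerSeries ℂ) : Germ) = ((X ^ δ * q + h : PowerSeries ℂ) : Germ) ↔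
      v = ((poleInv δ h q : PowerSeries ℂ) : Germ)⁻¹ := by
  have h1 : constantCoeff (X ^ δ * q + h) ≠ 0 := by rwa [constantCoeff_pole hδ]
  have h2 : ((X ^ δ : PowerSeries ℂ) : Germ) ≠ 0 := coe_ne_zero.2 (pow_ne_zero _ X_ne_zero)
  rw [poleInv, map_mul, coe_inv h1, mul_inv, inv_inv, ← eq_div_iff h2, div_eq_mul_inv, mul_comm]

namespace PoleForm
variable {E : DelayEquation} {d : ℕ → ℕ} {H : ℕ → PowerSeries ℂ → PowerSeries ℂ}

theorem eqn_pos (hE : PoleForm E d H) (c : ℂ) {m : ℕ} (hm : 1 ≤ m) {ξ : PowerSeries ℂ}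
    (hξ : constantCoeff ξ ≠ 0) (q : PowerSeries ℂ) (v : Germ) :
    E c (q : Germ) ((X ^ m * ξ : PowerSeries ℂ) : Germ) v ↔
      v = ((poleInv (d m) (H m ξ) q : PowerSeries ℂ) : Germ)⁻¹ := by
  rw [hE.eqn c m ξ q v hξ, mul_eq_iff_eq_poleInv (hE.d_pos m hm) q (hE.ne_zero m ξ hm hξ)]

theorem eqn_zero (hE : PoleForm E d H) (c : ℂ) {ξ : PowerSeries ℂ}
    (hξ : constantCoeff ξ ≠ 0) (q : PowerSeries ℂ) (v : Germ) :
    E c (q : Germ) (ξ : Germ) v ↔ v = ((q + H 0 ξ : PowerSeries ℂ) : Germ) := by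
  have := hE.eqn c 0 ξ q v hξ
  simpa [hE.d_zero] using this

/-- No blow-down where `x` does not vanish. -/
theorem imageCodim_le_codim (hE : PoleForm E d H) (c : ℂ) {r : ℕ} {S : Set (Jet (r + 1))}
    (hS : IsPreirreducible S) (hg : MvPolynomial.X (0, 0) ∉ chartIdeal S (false, false)) :
    imageCodim E c r S ≤ codim S := by
  have hξ : ∀ a : {a : Coord (r + 1) // chart (r + 1) (false, false) a ∈ S ∧
      MvPolynomial.eval a (MvPolynomial.X (0, 0)) ≠ 0}, constantCoeff (comp 0 a.1) ≠ 0 := by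
    intro a
    rw [comp, constantCoeff_ser]
    simpa using a.2.2
  -- The two further functions are the top coefficients of `x` and `y`. The others are recovered
  -- from `x = ȳ` and `y = x̄ - H 0 x`; knowing `H 0 x` up to order `r` uses the top coefficient of
  -- `x`.
  have key := imageCodim_le_codim_add (E := E) (c := c) hS hg 0 (ρ := Bool) rfl
    (fun b => if b then (0, Fin.last _) else (1, Fin.last _)) (false, false)
    (fun a => pack (trc r (comp 1 a + H 0 (comp 0 a))) (trc r (comp 0 a))) ?_ ?_ ?_
  · simpa using key
  · intro a ha hag
    have h0 := hξ ⟨a, ha, hag⟩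
    refine ⟨_, _, _, coe_ne_zero.2 (ne_zero_of_constantCoeff h0), (chart_eq_jet a).symm,
      (hE.eqn_zero c h0 _ _).2 rfl, (jet_coe_coe r _ _).symm⟩
  · have h0 : ∀ k N, RatPS (fun a : {a : Coord (r + 1) // chart (r + 1) (false, false) a ∈ S ∧
        MvPolynomial.eval a (MvPolynomial.X (0, 0)) ≠ 0} => a.1) N fun a => comp k a.1 :=
      fun k N => ratPS_comp N fun i _ => RatGen.coord (k, i)
    rintro ⟨k, i⟩
    fin_cases k
    · exact (((h0 1 (r + 1)).add (hE.ratPS _ _ _ (r + 1) 0 _ hξ (h0 0 _))) i i.2).congr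
        fun a => pack_zero _ _ i
    · exact (h0 0 (r + 1) i i.2).congr fun a => pack_one _ _ i
  · set u := fun a : {a : Coord (r + 1) // chart (r + 1) (false, false) a ∈ S ∧
        MvPolynomial.eval a (MvPolynomial.X (0, 0)) ≠ 0} =>
      Sum.elim (pack (trc r (comp 1 a.1 + H 0 (comp 0 a.1))) (trc r (comp 0 a.1)))
        fun b : Bool => a.1 (if b then (0, Fin.last _) else (1, Fin.last _)) with hu
    have hx : ∀ i, RatGen u fun a => a.1 (0, i) := by
      intro i
      rcases Fin.eq_castSucc_or_eq_last i with ⟨i, rfl⟩ | rfl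
      · refine (RatGen.coord (Sum.inl (1, i))).congr fun a => ?_
        simp only [hu, Sum.elim_inl, pack_one, trc]
        exact (coeff_comp 0 a.1 i.castSucc).symm
      · exact (RatGen.coord (Sum.inr true)).congr fun a => rfl
    have hxN : ∀ N, RatPS u N fun a => comp 0 a.1 := fun N => ratPS_comp N fun i _ => hx i
    have hHN : ∀ N, RatPS u N fun a => H 0 (comp 0 a.1) := fun N =>
      hE.ratPS _ _ _ N 0 _ hξ (hxN _)
    rintro ⟨k, i⟩
    fin_cases k
    · exact hx i
    · rcases Fin.eq_castSucc_or_eq_last i with ⟨i, rfl⟩ | rfl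
      · refine ((RatGen.coord (Sum.inl (0, i))).add ((hHN (r + 1)) i i.2).neg).congr fun a => ?_
        simp only [hu, Sum.elim_inl, pack_zero, trc, map_add]
        rw [add_neg_cancel_right]
        exact (coeff_comp 1 a.1 i.castSucc).symm
      · exact (RatGen.coord (Sum.inr false)).congr fun a => rfl

/-- The codimension increases by at most `min (r + 1) (2 d)` at a zero of order `m`. -/
theorem imageCodim_le_of_zero (hE : PoleForm E d H) (c : ℂ) {r m : ℕ} (hm : 1 ≤ m)
    (hmr : m < r + 1 + 1) {S : Set (Jet (r + 1))} (hS : IsPreirreducible S)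
    (hz : ∀ v, chart (r + 1) (false, false) v ∈ S → ∀ i : Fin (r + 1 + 1), (i : ℕ) < m →
      v (0, i) = 0)
    (hg : MvPolynomial.X (0, ⟨m, hmr⟩) ∉ chartIdeal S (false, false)) :
    imageCodim E c r S ≤ codim S + (min (r + 1) (2 * d m) : ℕ) := by
  have hd := hE.d_pos m hm
  have hξ : ∀ a : {a : Coord (r + 1) // chart (r + 1) (false, false) a ∈ S ∧
      MvPolynomial.eval a (MvPolynomial.X (0, ⟨m, hmr⟩)) ≠ 0},
      constantCoeff (unshift m (comp 0 a.1)) ≠ 0 := by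
    intro a
    rw [← coeff_zero_eq_constantCoeff_apply, coeff_unshift, zero_add, coeff_comp_of_lt 0 a.1 hmr]
    simpa using a.2.2
  have hsplit : ∀ a, chart (r + 1) (false, false) a ∈ S →
      X ^ m * unshift m (comp 0 a) = comp 0 a := by
    intro a ha
    refine X_pow_mul_unshift fun i hi => ?_
    rw [coeff_comp_of_lt 0 a (hi.trans hmr)]
    exact hz a ha _ hi
  -- The further functions are the top coefficient of `x` and those of `y` of index at least `r + 1
  -- - 2 * d m`: there are `2 * d m + 1` of the latter, or all `r + 2` if that is fewer.
  refine imageCodim_le_codim_add (E := E) (c := c) hS hg _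
    (ρ := Option (Fin (min (r + 2) (2 * d m + 1)))) (by simp; omega)
    (fun o => o.elim (0, Fin.last _) fun l => (1, ⟨r + 1 - l, by omega⟩)) (true, false)
    (fun a => pack (trc r (poleInv (d m) (H m (unshift m (comp 0 a))) (comp 1 a)))
      (trc r (comp 0 a))) ?_ ?_ ?_
  · intro a ha hag
    have h0 := hξ ⟨a, ha, hag⟩
    have hne : comp 0 a ≠ 0 := by
      rw [← hsplit a ha]
      exact mul_ne_zero (pow_ne_zero _ X_ne_zero) (ne_zero_of_constantCoeff h0)
    refine ⟨_, _, _, coe_ne_zero.2 hne, (chart_eq_jet a).symm, ?_,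
      (jet_inv_coe r (poleInv_ne_zero hd _ (hE.ne_zero m _ hm h0)) _).symm⟩
    have := (hE.eqn_pos c hm h0 (comp 1 a) _).2 rfl
    rwa [hsplit a ha] at this
  · have h0 : ∀ k N, RatPS (fun a : {a : Coord (r + 1) // chart (r + 1) (false, false) a ∈ S ∧
        MvPolynomial.eval a (MvPolynomial.X (0, ⟨m, hmr⟩)) ≠ 0} => a.1) N fun a => comp k a.1 :=
      fun k N => ratPS_comp N fun i _ => RatGen.coord (k, i)
    have hH := fun N => hE.ratPS _ _ _ N m _ hξ ((h0 0 (N + 1 + m)).unshift m)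
    rintro ⟨k, i⟩
    fin_cases k
    · refine (((((((h0 1 (r + 1)).X_pow_mul (d m)).mono (Nat.le_add_right _ _)).add
        (hH (r + 1))).inv fun a => ?_).X_pow_mul (d m)) i (by omega)).congr fun a => pack_zero _ _ i
      rw [constantCoeff_pole hd]
      exact hE.ne_zero m _ hm (hξ a)
    · exact (h0 0 (r + 1) i i.2).congr fun a => pack_one _ _ i
  · set u := fun a : {a : Coord (r + 1) // chart (r + 1) (false, false) a ∈ S ∧
        MvPolynomial.eval a (MvPolynomial.X (0, ⟨m, hmr⟩)) ≠ 0} =>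
      Sum.elim (pack (trc r (poleInv (d m) (H m (unshift m (comp 0 a.1))) (comp 1 a.1)))
        (trc r (comp 0 a.1)))
        fun o : Option (Fin (min (r + 2) (2 * d m + 1))) =>
          a.1 (o.elim (0, Fin.last _) fun l => (1, ⟨r + 1 - l, by omega⟩)) with hu
    have hx : ∀ i, RatGen u fun a => a.1 (0, i) := by
      intro i
      rcases Fin.eq_castSucc_or_eq_last i with ⟨i, rfl⟩ | rfl
      · refine (RatGen.coord (Sum.inl (1, i))).congr fun a => ?_
        simp only [hu, Sum.elim_inl, pack_one, trc]
        exact (coeff_comp 0 a.1 i.castSucc).symm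
      · exact (RatGen.coord (Sum.inr none)).congr fun a => rfl
    have hH : ∀ N, RatPS u N fun a => H m (unshift m (comp 0 a.1)) := fun N =>
      hE.ratPS _ _ _ N m _ hξ (RatPS.unshift m (ratPS_comp _ fun i _ => hx i))
    have hP : RatPS u (r + 1)
        fun a => poleInv (d m) (H m (unshift m (comp 0 a.1))) (comp 1 a.1) := by
      intro n hn
      exact (RatGen.coord (Sum.inl (0, ⟨n, hn⟩))).congr fun a => by simp [hu, trc]
    have hinv : ∀ a : {a : Coord (r + 1) // chart (r + 1) (false, false) a ∈ S ∧
        MvPolynomial.eval a (MvPolynomial.X (0, ⟨m, hmr⟩)) ≠ 0},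
        constantCoeff (X ^ d m * comp 1 a.1 + H m (unshift m (comp 0 a.1))) ≠ 0 := by
      intro a
      rw [constantCoeff_pole hd]
      exact hE.ne_zero m _ hm (hξ a)
    -- The precision drops by `d m` twice: in dividing `1/x̄` by `ζ ^ d m` before inverting, and in
    -- dividing `ζ ^ d m * y` by the same power afterwards.
    have hq : RatPS u (r + 1 - 2 * d m) fun a => comp 1 a.1 := by
      by_cases hr : 2 * d m ≤ r + 1
      · have h1 : RatPS u (r + 1 - d m) fun a =>
            (X ^ d m * comp 1 a.1 + H m (unshift m (comp 0 a.1)))⁻¹ :=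
          ((hP.mono (by omega)).unshift (d m)).congr fun a => (unshift_X_pow_mul _ _).symm
        have h2 := ((h1.inv fun a => by
          rw [constantCoeff_inv]; exact inv_ne_zero (hinv a)).sub (hH _)).mono
            (show r + 1 - 2 * d m + d m ≤ _ by omega)
        refine (h2.unshift (d m)).congr fun a => ?_
        have h3 : ((X ^ d m * comp 1 a.1 + H m (unshift m (comp 0 a.1)))⁻¹)⁻¹
            = X ^ d m * comp 1 a.1 + H m (unshift m (comp 0 a.1)) := by
          rw [PowerSeries.inv_eq_iff_mul_eq_one]
          · exact PowerSeries.mul_inv_cancel _ (hinv a)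
          · rw [constantCoeff_inv]; exact inv_ne_zero (hinv a)
        rw [h3, add_sub_cancel_right, unshift_X_pow_mul]
      · intro n hn
        omega
    rintro ⟨k, i⟩
    fin_cases k
    · exact hx i
    · by_cases hi : (i : ℕ) < r + 1 - 2 * d m
      · exact (hq i hi).congr fun a => (coeff_comp 1 a.1 i).symm
      · refine (RatGen.coord (Sum.inr (some ⟨r + 1 - i, by omega⟩))).congr fun a => ?_
        simp only [hu, Sum.elim_inr, Option.elim]
        exact congrArg (fun l => a.1 (1, l)) (Fin.ext (by simp only; omega))

end PoleForm
end DelayPainleve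

end

noncomputable section
namespace DelayPainleve
open PowerSeries

/-! ### The loci where `x` vanishes to order `m`, for equations `x̄ = y + R(x)` -/

theorem subset_closure_zeroSet_iff {r m : ℕ} {S : Set (Jet (r + 1))} (hS : IsPreirreducible S)
    (hne : ∃ v, chart (r + 1) (false, false) v ∈ S) :
    S ⊆ closure (zeroSet r m) ↔ ∀ v, chart (r + 1) (false, false) v ∈ S →
      ∀ i : Fin (r + 1 + 1), (i : ℕ) < m → v (0, i) = 0 := by
  have := subset_closure_chart_image_iff hS (false, false) hne
    (s := {f | ∃ i : Fin (r + 1 + 1), (i : ℕ) < m ∧ f = MvPolynomial.X (0, i)})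
  have he : ∀ v : Coord (r + 1), (∀ f ∈ {f | ∃ i : Fin (r + 1 + 1), (i : ℕ) < m ∧
      f = (MvPolynomial.X (0, i) : MvPolynomial (Fin 2 × Fin (r + 1 + 1)) ℂ)},
      MvPolynomial.eval v f = 0) ↔ ∀ i : Fin (r + 1 + 1), (i : ℕ) < m → v (0, i) = 0 := by
    refine fun v => ⟨fun h i hi => by simpa using h _ ⟨i, hi, rfl⟩, ?_⟩
    rintro h _ ⟨i, hi, rfl⟩
    simpa using h i hi
  rw [zeroSet_eq]
  simpa only [he] using this

theorem zeroSet_isSubvariety {r m : ℕ} (hm : m ≤ r + 2) :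
    IsSubvariety (zeroSet r m) ∧ codim (zeroSet r m) = m := by
  have hk : Function.Injective fun i : Fin m => ((0, Fin.castLE hm i) : Fin 2 × Fin (r + 1 + 1)) := by
    intro i j h
    simpa using h
  have := linear_isSubvariety hk 0 ⟨(1, 0), by simp⟩
  have e : {v : Coord (r + 1) | ∀ i : Fin m, v (0, Fin.castLE hm i) = (0 : Fin m → ℂ) i * v (1, 0)}
      = {v | ∀ i : Fin (r + 1 + 1), (i : ℕ) < m → v (0, i) = 0} := by
    ext v
    simp only [Pi.zero_apply, zero_mul, Set.mem_ofPred_eq]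
    exact ⟨fun h i hi => h ⟨i, hi⟩, fun h i => h _ i.2⟩
  rw [zeroSet_eq, ← e]
  simpa using this

theorem exists_chart_of_accessible {r : ℕ} {S : Set (Jet (r + 1))} {p q : PowerSeries ℂ}
    (h : jet (r + 1) (p : Germ) (q : Germ) ∈ S) : ∃ v, chart (r + 1) (false, false) v ∈ S :=
  ⟨_, jet_coe_coe (r + 1) p q ▸ h⟩

namespace PoleForm
variable {E : DelayEquation} {d : ℕ → ℕ} {H : ℕ → PowerSeries ℂ → PowerSeries ℂ}

/-- Where `x = ζ^m ξ` with `ξ` invertible, `ȳ = x` begins with `m` zeros and `1/x̄ = ζ^d / (ζ^d y +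
h)` with `d` zeros. The next `d` coefficients are those of `1/h`, and `h = H m ξ` is a function of
`ȳ`; the series `y` enters only from `ζ^(2d)` on. -/
theorem le_imageCodim_zeroSet (hE : PoleForm E d H) (c : ℂ) {r m : ℕ} (hm : 1 ≤ m)
    (hmr : m ≤ r + 1) :
    ((m + min (r + 1) (2 * d m) : ℕ) : ℕ∞) ≤ imageCodim E c r (zeroSet r m) := by
  have hd := hE.d_pos m hm
  have hmr' : m < r + 1 + 1 := by omega
  set U := chart (r + 1) (false, false) '' {v | MvPolynomial.eval v (MvPolynomial.X (0, ⟨m, hmr'⟩)) ≠ 0}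
    with hU
  have hdata : ∀ e (a : {v : Coord r // chart r e v ∈ image E c r (zeroSet r m ∩ U)}),
      ∃ ξ q : PowerSeries ℂ, constantCoeff ξ ≠ 0 ∧ e = (true, false) ∧
        (∀ i : Fin (r + 1), a.1 (0, i) = coeff (i : ℕ) (poleInv (d m) (H m ξ) q)) ∧
        ∀ i : Fin (r + 1), a.1 (1, i) = coeff (i : ℕ) (X ^ m * ξ) := by
    rintro ⟨e1, e2⟩ ⟨v, x, y, x', hx, ⟨hB, w, hw, hwj⟩, hE', hj⟩
    rw [zeroSet_eq] at hB
    obtain ⟨w', hw', hwj'⟩ := hB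
    obtain rfl := chart_injective _ _ (hwj.trans hwj'.symm)
    obtain ⟨p, q, rfl, rfl, hp, hq⟩ := exists_of_jet_eq_chart hwj.symm
    have hsplit : X ^ m * unshift m p = p := X_pow_mul_unshift fun i hi => by
      rw [hp ⟨i, by omega⟩]
      exact hw' _ hi
    have hξ : constantCoeff (unshift m p) ≠ 0 := by
      rw [← coeff_zero_eq_constantCoeff_apply, coeff_unshift, zero_add, hp ⟨m, hmr'⟩]
      simpa using hw
    rw [← hsplit, hE.eqn_pos c hm hξ] at hE'
    subst hE'
    obtain ⟨⟨h1, h2⟩, h3, h4⟩ := jet_eq_chart_iff.1 hj.symm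
    -- Here `x̄` has a pole and `ȳ` a zero, so the image meets only one chart; in the others there
    -- is nothing to prove.
    have e1t : e1 = true := eq_true_of_visible_inv
      (poleInv_ne_zero hd q (hE.ne_zero m _ hm hξ)) h1 (constantCoeff_poleInv hd _ _)
    have e2f : e2 = false := eq_false_of_visible_coe h3 (by
      rw [← hsplit]; simp [show m ≠ 0 by omega])
    subst e1t e2f
    refine ⟨unshift m p, q, hξ, rfl, fun i => ?_, fun i => ?_⟩
    · simpa [localCoord] using (h2 i).symm
    · rw [hsplit]
      simpa [localCoord] using (h4 i).symm
  have hne : (zeroSet r m ∩ U).Nonempty := by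
    refine ⟨chart (r + 1) (false, false) (Pi.single (0, ⟨m, hmr'⟩) 1), ?_, _, ?_, rfl⟩
    · rw [zeroSet_eq]
      refine ⟨_, fun i hi => ?_, rfl⟩
      rw [Pi.single_eq_of_ne]
      intro h
      simp only [Prod.mk.injEq, true_and] at h
      rw [h] at hi
      exact lt_irrefl _ hi
    · simp
  have key := le_imageCodim (E := E) (c := c)
    (ι := Fin m ⊕ Fin (min (r + 1) (2 * d m))) (isOpen_chart_image _ _) hne fun e => ?_
  · simpa using key
  refine ⟨Sum.elim (fun i => (1, ⟨i, by omega⟩)) fun i => (0, ⟨i, by omega⟩), ?_, ?_⟩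
  · rintro (i | i) (j | j) h <;> simp_all [Fin.ext_iff]
  by_cases he : e = (true, false)
  swap
  · have : IsEmpty {v : Coord r // chart r e v ∈ image E c r (zeroSet r m ∩ U)} :=
      ⟨fun a => by obtain ⟨_, _, _, h, _⟩ := hdata e a; exact he h⟩
    exact fun i => RatGen.of_isEmpty
  choose ξ q hξ _ h0 h1 using hdata e
  set k : Fin m ⊕ Fin (min (r + 1) (2 * d m)) → Fin 2 × Fin (r + 1) :=
    Sum.elim (fun i => (1, ⟨i, by omega⟩)) fun i => (0, ⟨i, by omega⟩) with hk
  rintro (i | i)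
  · refine (RatGen.const 0).congr fun a => ?_
    simp only [hk, Sum.elim_inl]
    rw [h1, coeff_X_pow_mul', if_neg (by simp)]
  · simp only [hk, Sum.elim_inr]
    by_cases hi : d m ≤ i
    · have hξN : RatPS (fun (a : {v : Coord r // chart r e v ∈ image E c r (zeroSet r m ∩ U)})
          (j : {j // j ∉ Set.range k}) => a.1 j) (r + 1 - m) ξ := by
        intro n hn
        have hnk : (1, ⟨n + m, by omega⟩) ∉ Set.range k := by
          rintro ⟨j | j, hj⟩
          · simp [hk, Fin.ext_iff] at hj
            omega
          · simp [hk] at hj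
        refine (RatGen.coord ⟨_, hnk⟩).congr fun a => ?_
        rw [h1, coeff_X_pow_mul', if_pos (Nat.le_add_left _ _), Nat.add_sub_cancel]
      -- The `r`-jet of `ȳ = ζ^m ξ` shows `ξ` only below index `r + 1 - m`. The low coefficients of
      -- `H m ξ` need no more, whereas `ratPS` would lose one order to the derivative.
      have hH := hE.ratPS_low _ _ _ (min (d m) (r + 1 - d m)) (r + 1 - m) m ξ hm (by omega)
        (by omega) hξ hξN
      refine ((hH.inv fun a => hE.ne_zero m _ hm (hξ a)) (i - d m) (by omega)).congr fun a => ?_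
      rw [h0, poleInv]
      simp only
      rw [coeff_X_pow_mul', if_pos hi]
      refine coeff_inv_congr (d := d m) ?_ (hE.ne_zero m _ hm (hξ a)) (fun l hl => ?_) (by omega)
      · rw [constantCoeff_pole hd]
        exact hE.ne_zero m _ hm (hξ a)
      · rw [map_add, coeff_X_pow_mul', if_neg (by omega), zero_add]
    · refine (RatGen.const 0).congr fun a => ?_
      rw [h0, poleInv]
      simp only
      rw [coeff_X_pow_mul', if_neg hi]

theorem isBlowDown_zeroSet (hE : PoleForm E d H) (c : ℂ) {r m : ℕ} (hm : 1 ≤ m)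
    (hmr : m ≤ r + 1) : IsBlowDown E c r (zeroSet r m) := by
  obtain ⟨h1, h2⟩ := zeroSet_isSubvariety (r := r) (m := m) (by omega)
  refine ⟨h1, ?_⟩
  rw [h2]
  refine lt_of_lt_of_le ?_ (hE.le_imageCodim_zeroSet c hm hmr)
  have := hE.d_pos m hm
  norm_cast
  omega

/-- By `imageCodim_le_codim`, `x₀` must vanish on every blow-down type singularity in the `(x,
y)`-chart. -/
theorem not_onBlowDown (hE : PoleForm E d H) (c : ℂ) {p : PowerSeries ℂ} (q : PowerSeries ℂ)
    (hp : constantCoeff p ≠ 0) : ¬ OnBlowDown E c (p : Germ) (q : Germ) := by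
  rintro ⟨r, B, ⟨hB, hlt⟩, hj⟩
  rw [jet_coe_coe] at hj
  refine not_le_of_gt hlt (hE.imageCodim_le_codim c hB.1.2 fun h => hp ?_)
  have := mem_chartIdeal.1 h _ hj
  simpa [trc] using this

/-- A pole can only come from a section with `x = 0` at the base point. Such a section lies on
`zeroSet 1 1`, a blow-down type singularity, so it may not be iterated. -/
theorem regular_of_accessible (hE : PoleForm E d H) {c : ℂ} {x y : Germ}
    (h : AccessibleSection E c x y) : ∃ p q : PowerSeries ℂ, x = (p : Germ) ∧ y = (q : Germ) := by
  induction h with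
  | init c x y hx hy =>
    obtain ⟨⟨p, rfl⟩, _⟩ := hx
    obtain ⟨⟨q, rfl⟩, _⟩ := hy
    exact ⟨p, q, rfl, rfl⟩
  | step c x y x' h hB hx hE' ih =>
    obtain ⟨p, q, rfl, rfl⟩ := ih
    by_cases hp : constantCoeff p = 0
    · refine (hB ⟨1, _, hE.isBlowDown_zeroSet c (r := 1) (m := 1) le_rfl (by norm_num),
        _, _, ⟨p, rfl⟩, ⟨q, rfl⟩, fun i hi => ?_, rfl⟩).elim
      obtain rfl : i = 0 := by omega
      rw [coeff_coe_nat]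
      simpa using hp
    · rw [hE.eqn_zero c hp] at hE'
      exact ⟨_, p, hE', rfl⟩

/-- One step suffices: starting from `x = ξ` and `y = ζ^m - H 0 ξ` at the preceding base point, the
iterate is exactly `ζ^m`. The choice of `ξ` in `exists_ne` makes this `y` nonzero at the base point.
-/
theorem isAccessible_zeroSet (hE : PoleForm E d H) (c : ℂ) {r m : ℕ} (hm : 1 ≤ m) :
    IsAccessible E c (zeroSet r m) := by
  obtain ⟨ξ, hξ, hξ'⟩ := hE.exists_ne
  refine ⟨((X ^ m : PowerSeries ℂ) : Germ), (ξ : Germ), ?_, _, _, ⟨X ^ m, rfl⟩, ⟨ξ, rfl⟩,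
    fun i hi => ?_, rfl⟩
  · have := AccessibleSection.step (E := E) (c - 1) (ξ : Germ) ((X ^ m - H 0 ξ : PowerSeries ℂ) : Germ)
      ((X ^ m : PowerSeries ℂ) : Germ) (.init _ _ _ ⟨⟨_, rfl⟩, ?_⟩ ⟨⟨_, rfl⟩, ?_⟩)
      (hE.not_onBlowDown _ _ hξ) (coe_ne_zero.2 (ne_zero_of_constantCoeff hξ))
      ((hE.eqn_zero _ hξ _ _).2 (by rw [sub_add_cancel]))
    · rwa [sub_add_cancel] at this
    · have := coeff_coe_nat ξ 0
      rw [Nat.cast_zero] at this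
      rw [this]
      simpa using hξ
    · have := coeff_coe_nat (X ^ m - H 0 ξ) 0
      rw [Nat.cast_zero] at this
      rw [this]
      simpa [show m ≠ 0 by omega] using hξ'
  · rw [coeff_coe_nat, coeff_X_pow, if_neg (by omega)]

/-- The classification of the accessible blow-down type singularities, except for the subvarieties
on which `x` vanishes to the highest order. -/
theorem onlyAccessibleBlowDowns (hE : PoleForm E d H) (c : ℂ)
    (hlast : ∀ r, ∃ k : ℕ, ((r + 2 + k : ℕ) : ℕ∞) ≤ imageCodim E c r (zeroSet r (r + 2)) ∧
      ∀ S : Set (Jet (r + 1)), IsPreirreducible S →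
        (∃ v, chart (r + 1) (false, false) v ∈ S) →
        (∀ v, chart (r + 1) (false, false) v ∈ S → ∀ i, v (0, i) = 0) →
        imageCodim E c r S ≤ codim S + k) :
    OnlyAccessibleBlowDowns E c (fun r => r + 2) zeroSet := by
  classical
  refine ⟨fun r m _ hm hmr => ⟨hE.isBlowDown_zeroSet c hm hmr, hE.isAccessible_zeroSet c hm,
    (zeroSet_isSubvariety (by omega)).2⟩, ?_⟩
  rintro r S ⟨hS, hlt⟩ ⟨x, y, hxy, hj⟩
  obtain ⟨p, q, rfl, rfl⟩ := hE.regular_of_accessible hxy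
  have hne := exists_chart_of_accessible hj
  have hirr := hS.1.2
  let Q : ℕ → Prop := fun m => ∀ v, chart (r + 1) (false, false) v ∈ S →
      ∀ i : Fin (r + 1 + 1), (i : ℕ) < m → v (0, i) = 0
  have hQ1 : Q 1 := by
    by_contra hc
    refine not_le_of_gt hlt (hE.imageCodim_le_codim c hirr fun h => hc fun v hv i hi => ?_)
    obtain rfl : i = 0 := Fin.ext (by simpa using hi)
    simpa using mem_chartIdeal.1 h v hv
  set m := Nat.findGreatest Q (r + 2) with hm
  have hm1 : 1 ≤ m := Nat.le_findGreatest (by omega) hQ1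
  have hmr : m ≤ r + 2 := Nat.findGreatest_le _
  have hQm : Q m := Nat.findGreatest_spec (P := Q) (m := 1) (by omega) hQ1
  refine ⟨m, hm1, ⟨⟨hmr, (subset_closure_zeroSet_iff hirr hne).2 hQm⟩, fun k hk => ?_⟩, ?_⟩
  · exact Nat.le_findGreatest hk.1 ((subset_closure_zeroSet_iff hirr hne).1 hk.2)
  -- The two increases are compared through an explicit `k`: at least `k` for the zero locus, at
  -- most `k` for `S`.
  have fin : ∀ k : ℕ, ((m + k : ℕ) : ℕ∞) ≤ imageCodim E c r (zeroSet r m) →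
      imageCodim E c r S ≤ codim S + k →
      imageCodim E c r S + m ≤ codim S + imageCodim E c r (zeroSet r m) := by
    intro k h1 h2
    calc imageCodim E c r S + m ≤ (codim S + k) + m := by gcongr
      _ = codim S + ((m + k : ℕ) : ℕ∞) := by push_cast; ring
      _ ≤ _ := by gcongr
  rcases hmr.lt_or_eq with hlt' | heq
  · refine fin _ (hE.le_imageCodim_zeroSet c hm1 (by omega))
      (hE.imageCodim_le_of_zero c hm1 hlt' hirr hQm fun h => ?_)
    have : Q (m + 1) := by
      intro v hv i hi
      rcases Nat.lt_succ_iff_lt_or_eq.1 hi with hi | hi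
      · exact hQm v hv i hi
      · obtain rfl : i = ⟨m, hlt'⟩ := Fin.ext hi
        simpa using mem_chartIdeal.1 h v hv
    have := Nat.le_findGreatest (P := Q) (n := r + 2) (by omega) this
    omega
  · obtain ⟨k, h1, h2⟩ := hlast r
    rw [← heq] at h1
    exact fin k h1 (h2 S hirr hne fun v hv i => hQm v hv i (by omega))

end PoleForm
end DelayPainleve

end

noncomputable section
namespace DelayPainleve
open PowerSeries

/-! ### The first and the second equation -/

/-- By `e`, `R / P = h / δ` among Laurent series, so both sides say `v = q + h / δ`. -/
theorem mul_sub_eq_iff {P R δ h : PowerSeries ℂ} (hP : P ≠ 0) (hδ : δ ≠ 0) (e : P * h = δ * R)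
    (q : PowerSeries ℂ) (v : Germ) :
    (P : Germ) * (v - (q : Germ)) = (R : Germ) ↔
      v * (δ : Germ) = ((δ * q + h : PowerSeries ℂ) : Germ) := by
  have hP' := coe_ne_zero.2 hP
  have hδ' := coe_ne_zero.2 hδ
  have e' : (P : Germ) * (h : Germ) = (δ : Germ) * (R : Germ) := by
    rw [← map_mul, e, map_mul]
  rw [map_add, map_mul]
  constructor
  · intro H
    refine mul_left_cancel₀ hP' ?_
    linear_combination (δ : Germ) * H - e'
  · intro H
    refine mul_left_cancel₀ hδ' ?_
    linear_combination (P : Germ) * H + e'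

theorem derivative_X_pow_succ_mul (m : ℕ) (ξ : PowerSeries ℂ) :
    d⁄dX ℂ (X ^ (m + 1) * ξ) = X ^ m * (((m : PowerSeries ℂ) + 1) * ξ + X * d⁄dX ℂ ξ) := by
  rw [Derivation.leibniz, Derivation.leibniz_pow, PowerSeries.derivative_X]
  simp only [smul_eq_mul, nsmul_eq_mul, Nat.add_sub_cancel, Nat.cast_add, Nat.cast_one]
  ring

/-- The order of the pole of `u'/u`. -/
def poleOrderOne : ℕ → ℕ
  | 0 => 0
  | _ + 1 => 1

/-- The numerator of `a - b u'/u`. -/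
def residualOne (a b : ℂ) : ℕ → PowerSeries ℂ → PowerSeries ℂ
  | 0, ξ => C a - C b * (d⁄dX ℂ ξ * ξ⁻¹)
  | m + 1, ξ => C (-b * (m + 1)) + X * (C a - C b * (d⁄dX ℂ ξ * ξ⁻¹))

/-- The order of the pole of `(p u + q u')/u ^ 2`. -/
def poleOrderTwo : ℕ → ℕ
  | 0 => 0
  | m + 1 => m + 2

/-- The numerator of `(p u + q u')/u ^ 2`. -/
def residualTwo (p q : ℂ) : ℕ → PowerSeries ℂ → PowerSeries ℂ
  | 0, ξ => (C p * ξ + C q * d⁄dX ℂ ξ) * (ξ ^ 2)⁻¹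
  | m + 1, ξ => (C q * (C ((m : ℂ) + 1) * ξ + X * d⁄dX ℂ ξ) + C p * (X * ξ)) * (ξ ^ 2)⁻¹

/-- For `u = ζ^(m+1) ξ` one has `u'/u = (m + 1)/ζ + ξ'/ξ`: a simple pole whose residue does not
depend on `ξ`. Hence the only low coefficient required by `ratPS_low`, that of index `0`, is a
constant. -/
theorem poleForm_eqOne (a : ℂ) {b : ℂ} (hb : b ≠ 0) :
    PoleForm (eqOne a b) poleOrderOne (residualOne a b) where
  eqn c m ξ q v hξ := by
    have h1 : X ^ m * ξ ≠ 0 := mul_ne_zero (pow_ne_zero _ X_ne_zero) (ne_zero_of_constantCoeff hξ)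
    rw [← mul_sub_eq_iff (P := X ^ m * ξ) (R := C a * (X ^ m * ξ) - C b * d⁄dX ℂ (X ^ m * ξ)) h1
      (pow_ne_zero _ X_ne_zero), eqOne, smul_coe, der_coe, smul_coe, map_sub]
    have hi := PowerSeries.mul_inv_cancel ξ hξ
    rcases m with _ | m
    · simp only [residualOne, poleOrderOne, pow_zero, one_mul]
      linear_combination (-C b * d⁄dX ℂ ξ) * hi
    · rw [derivative_X_pow_succ_mul]
      simp only [residualOne, poleOrderOne, pow_one, map_mul, map_neg, map_add, map_natCast, map_one]
      linear_combination (-C b * d⁄dX ℂ ξ * X ^ (m + 2)) * hi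
  d_zero := rfl
  d_pos m hm := by
    obtain ⟨m, rfl⟩ := Nat.exists_eq_add_of_le' hm
    exact le_rfl
  ne_zero m ξ hm hξ := by
    obtain ⟨m, rfl⟩ := Nat.exists_eq_add_of_le' hm
    simp only [residualOne, map_add, map_mul, constantCoeff_X, zero_mul, add_zero, constantCoeff_C]
    exact mul_ne_zero (neg_ne_zero.2 hb) (Nat.cast_add_one_ne_zero m)
  ratPS A κ u N m ξ h0 hξ := by
    have h : RatPS u N fun a' => C a - C b * (d⁄dX ℂ (ξ a') * (ξ a')⁻¹) :=
      (RatPS.const _).sub ((RatPS.const _).mul (hξ.derivative.mul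
        ((hξ.inv h0).mono (Nat.le_succ _))))
    rcases m with _ | m
    · exact h
    · exact (RatPS.const _).add ((RatPS.const _).mul h)
  ratPS_low A κ u n N m ξ hm hn _ h0 hξ := by
    obtain ⟨m, rfl⟩ := Nat.exists_eq_add_of_le' hm
    intro i hi
    obtain rfl : i = 0 := by
      simp only [poleOrderOne] at hn
      omega
    exact (RatGen.const (-b * (m + 1))).congr fun a' => by simp [residualOne]
  exists_ne := by
    -- The slope is chosen so that `a - b ξ'/ξ` has value `1`.
    refine ⟨1 + C ((a - 1) / b) * X, by simp, ?_⟩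
    have : constantCoeff (d⁄dX ℂ (1 + C ((a - 1) / b) * X)) = (a - 1) / b := by
      rw [← coeff_zero_eq_constantCoeff_apply, coeff_derivative]
      simp [coeff_one]
    simp only [residualOne]
    rw [map_sub, map_mul, map_mul, this]
    simp [mul_div_cancel₀ _ hb]

/-- For `u = ζ^(m+1) ξ`, `(p u + q u')/u²` is `ζ^(-(m+2))` times `(q ((m + 1) ξ + ζ ξ') + p ζ
ξ)/ξ²`. The derivative occurs only as `ζ ξ'`, which costs no order of precision; this gives
`ratPS_low`. -/
theorem poleForm_eqTwo (p : ℂ) {q : ℂ} (hq : q ≠ 0) :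
    PoleForm (eqTwo p q) poleOrderTwo (residualTwo p q) where
  eqn c m ξ y v hξ := by
    have h1 : X ^ m * ξ ≠ 0 := mul_ne_zero (pow_ne_zero _ X_ne_zero) (ne_zero_of_constantCoeff hξ)
    rw [← mul_sub_eq_iff (P := (X ^ m * ξ) ^ 2)
      (R := C p * (X ^ m * ξ) + C q * d⁄dX ℂ (X ^ m * ξ)) (pow_ne_zero _ h1)
      (pow_ne_zero _ X_ne_zero), eqTwo, smul_coe, der_coe, smul_coe, map_add, map_pow]
    have hi := PowerSeries.mul_inv_cancel (ξ ^ 2) (by rw [map_pow]; exact pow_ne_zero _ hξ)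
    rcases m with _ | m
    · simp only [residualTwo, poleOrderTwo, pow_zero, one_mul]
      linear_combination (C p * ξ + C q * d⁄dX ℂ ξ) * hi
    · rw [derivative_X_pow_succ_mul]
      simp only [residualTwo, poleOrderTwo, map_add, map_natCast, map_one]
      linear_combination (X ^ (2 * m + 2) * (C q * (((m : PowerSeries ℂ) + 1) * ξ + X * d⁄dX ℂ ξ) +
        C p * (X * ξ))) * hi
  d_zero := rfl
  d_pos m hm := by
    obtain ⟨m, rfl⟩ := Nat.exists_eq_add_of_le' hm
    exact Nat.le_add_left _ _
  ne_zero m ξ hm hξ := by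
    obtain ⟨m, rfl⟩ := Nat.exists_eq_add_of_le' hm
    simp only [residualTwo, map_add, map_mul, constantCoeff_X, zero_mul, mul_zero, add_zero,
      constantCoeff_C, constantCoeff_inv, map_pow]
    exact mul_ne_zero (mul_ne_zero hq (mul_ne_zero (Nat.cast_add_one_ne_zero m) hξ))
      (inv_ne_zero (pow_ne_zero _ hξ))
  ratPS A κ u N m ξ h0 hξ := by
    have h1 : ∀ a', constantCoeff (ξ a' ^ 2) ≠ 0 := fun a' => by
      rw [map_pow]; exact pow_ne_zero _ (h0 a')
    have h2 := hξ.mono (Nat.le_succ N)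
    have h3 : RatPS u N fun a' => (ξ a' ^ 2)⁻¹ :=
      ((h2.mul h2).congr fun a' => sq (ξ a')).inv h1
    rcases m with _ | m
    · exact (((RatPS.const _).mul h2).add ((RatPS.const _).mul hξ.derivative)).mul h3
    · exact (((RatPS.const _).mul (((RatPS.const _).mul h2).add h2.X_mul_derivative)).add
        ((RatPS.const _).mul ((RatPS.const _).mul h2))).mul h3
  ratPS_low A κ u n N m ξ hm hn hN h0 hξ := by
    obtain ⟨m, rfl⟩ := Nat.exists_eq_add_of_le' hm
    have h1 : ∀ a', constantCoeff (ξ a' ^ 2) ≠ 0 := fun a' => by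
      rw [map_pow]; exact pow_ne_zero _ (h0 a')
    have h2 := hξ.mono (show n ≤ N by simp only [poleOrderTwo] at hN; omega)
    have h3 : RatPS u n fun a' => (ξ a' ^ 2)⁻¹ :=
      ((h2.mul h2).congr fun a' => sq (ξ a')).inv h1
    exact (((RatPS.const _).mul (((RatPS.const _).mul h2).add h2.X_mul_derivative)).add
        ((RatPS.const _).mul ((RatPS.const _).mul h2))).mul h3
  exists_ne := by
    refine ⟨1 + C ((1 - p) / q) * X, by simp, ?_⟩
    have : constantCoeff (d⁄dX ℂ (1 + C ((1 - p) / q) * X)) = (1 - p) / q := by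
      rw [← coeff_zero_eq_constantCoeff_apply, coeff_derivative]
      simp [coeff_one]
    simp only [residualTwo]
    rw [map_mul, map_add, map_mul, map_mul, this]
    simp [mul_div_cancel₀ _ hq]

/-! ### The locus where `x` vanishes to the highest order -/

theorem coeff_poleInv_of_lt {δ n : ℕ} (h : n < δ) (f q : PowerSeries ℂ) :
    coeff n (poleInv δ f q) = 0 := by
  rw [poleInv, coeff_X_pow_mul', if_neg (by omega)]

/-- The image of the locus where `x` vanishes to the highest order. -/
theorem PoleForm.le_imageCodim_zeroSet_last {E : DelayEquation} {d : ℕ → ℕ}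
    {H : ℕ → PowerSeries ℂ → PowerSeries ℂ} (hE : PoleForm E d H) (c : ℂ) {r δ : ℕ}
    (hδ : δ ≤ r + 1) (hd : ∀ n, r + 2 ≤ n → δ ≤ d n) :
    ((r + 1 + δ : ℕ) : ℕ∞) ≤ imageCodim E c r (zeroSet r (r + 2)) := by
  have hdata : ∀ e v, chart r e v ∈ image E c r (zeroSet r (r + 2) ∩ Set.univ) →
      (∀ i : Fin (r + 1), v (1, i) = 0) ∧ ∀ i : Fin (r + 1), (i : ℕ) < δ → v (0, i) = 0 := by
    rintro ⟨e1, e2⟩ v ⟨x, y, x', hx, ⟨hB, -⟩, hE', hj⟩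
    rw [zeroSet_eq] at hB
    obtain ⟨w, hw, hwj⟩ := hB
    obtain ⟨p, q, rfl, rfl, hp, hq⟩ := exists_of_jet_eq_chart hwj.symm
    obtain ⟨n, ξ, hξ, rfl⟩ := exists_eq_X_pow_mul (coe_ne_zero.1 hx)
    -- The section has `x ≠ 0` with vanishing `(r + 1)`-jet, so its order `n` can be any number from
    -- `r + 2` on; hence the bound on `d n` is required for all of them.
    have hn : r + 2 ≤ n := by
      by_contra hc
      have h1 := hp ⟨n, by omega⟩
      rw [hw _ (by simp only; omega), coeff_X_pow_mul', if_pos le_rfl, Nat.sub_self] at h1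
      exact hξ (by simpa using h1)
    have hdn := hE.d_pos n (by omega)
    rw [hE.eqn_pos c (by omega) hξ] at hE'
    subst hE'
    obtain ⟨⟨h1, h2⟩, h3, h4⟩ := jet_eq_chart_iff.1 hj.symm
    obtain rfl : e1 = true := eq_true_of_visible_inv
      (poleInv_ne_zero hdn q (hE.ne_zero n _ (by omega) hξ)) h1 (constantCoeff_poleInv hdn _ _)
    obtain rfl : e2 = false := eq_false_of_visible_coe h3 (by simp [show n ≠ 0 by omega])
    refine ⟨fun i => ?_, fun i hi => ?_⟩
    · rw [← h4 i]
      simp only [localCoord, Bool.false_eq_true, if_false]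
      rw [coeff_coe_nat, coeff_X_pow_mul', if_neg (by omega)]
    · rw [← h2 i]
      simp only [localCoord, if_true, inv_inv]
      rw [coeff_coe_nat, coeff_poleInv_of_lt (hi.trans_le (hd n hn))]
  have hne : (zeroSet r (r + 2) ∩ Set.univ).Nonempty :=
    ⟨_, ⟨(0 : PowerSeries ℂ), (0 : PowerSeries ℂ), ⟨0, rfl⟩, ⟨0, rfl⟩, by simp, rfl⟩, trivial⟩
  have key := le_imageCodim (E := E) (c := c) (ι := Fin (r + 1) ⊕ Fin δ) isOpen_univ hne fun e => ?_
  · simpa using key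
  refine ⟨Sum.elim (fun i => (1, i)) fun i => (0, Fin.castLE hδ i), ?_, ?_⟩
  · rintro (i | i) (j | j) h <;> simp_all
  · rintro (i | i)
    · exact (RatGen.const 0).congr fun a => (hdata e a.1 a.2).1 i
    · exact (RatGen.const 0).congr fun a => (hdata e a.1 a.2).2 _ i.2

theorem le_codim_of_forall_eq_zero {r : ℕ} {S : Set (Jet (r + 1))} (hS : IsPreirreducible S)
    (hne : ∃ v, chart (r + 1) (false, false) v ∈ S)
    (h0 : ∀ v, chart (r + 1) (false, false) v ∈ S → ∀ i, v (0, i) = 0) :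
    ((r + 2 : ℕ) : ℕ∞) ≤ codim S := by
  rw [codim_eq_of_irreducible hS hne, chartIdeal_eq_relIdeal]
  have := card_le_height_relIdeal
    (fun a : {v : Coord (r + 1) // chart (r + 1) (false, false) v ∈ S} => a.1)
    (fun i : Fin (r + 1 + 1) => ((0, i) : Fin 2 × Fin (r + 1 + 1))) (fun i j h => by simpa using h)
    fun i => (RatGen.const 0).congr fun a => h0 a.1 a.2 i
  rwa [Fintype.card_fin] at this

/-- A set containing a parametrized family. -/
theorem codim_le_of_param {r : ℕ} {T : Set (Jet r)} {A σ : Type*} [Fintype σ] (t : A → σ → ℂ)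
    (ht : relIdeal t = ⊥) (e : Bool × Bool) (F : A → Coord r) (hT : ∀ a, chart r e (F a) ∈ T)
    (hF : ∀ j, RatGen t fun a => F a j) (htF : ∀ i, RatGen F fun a => t a i) {N : ℕ}
    (hN : 2 * (r + 1) ≤ N + Fintype.card σ) : codim T ≤ N := by
  have hp : (relIdeal t).IsPrime := by
    rw [ht]
    exact Ideal.isPrime_bot
  have key := height_relIdeal_add_card_le t F (fun _ (i : Fin 0) => i.elim0) hF
    (fun i => i.elim0) fun i => (htF i).trans fun j => RatGen.coord (Sum.inl j)
  rw [ht, Ideal.height_bot] at key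
  have h1 : codim T ≤ (relIdeal F).height := (iInf_le _ e).trans <| Ideal.height_mono fun q hq =>
    mem_relIdeal.2 fun a => mem_chartIdeal.1 hq _ (hT a)
  refine h1.trans ((ENat.add_le_add_iff_right (ENat.natCast_ne_top (Fintype.card σ))).1
    (key.trans ?_))
  norm_cast
  simpa using hN

/-- On the last locus the pole order exceeds `r`, so `ȳ` and `1/x̄` both have zero `r`-jet and the
image is one point, of codimension `2 (r + 1) = (r + 2) + r`. A set `S` inside that locus has
codimension at least `r + 2`, and its image is nonempty because `x = ζ^(r+2)` is allowed; so the
increase is at most `r`. -/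
theorem onlyAccessibleBlowDowns_eqTwo (p : ℂ) {q : ℂ} (hq : q ≠ 0) (c : ℂ) :
    OnlyAccessibleBlowDowns (eqTwo p q) c (fun r => r + 2) zeroSet := by
  have hE := poleForm_eqTwo p hq
  refine hE.onlyAccessibleBlowDowns c fun r => ⟨r, ?_, fun S hS hne h0 => ?_⟩
  · have := hE.le_imageCodim_zeroSet_last c (r := r) (δ := r + 1) le_rfl fun n hn => by
      obtain ⟨m, rfl⟩ := Nat.exists_eq_add_of_le' (show 1 ≤ n by omega)
      simp only [poleOrderTwo]
      omega
    rwa [show r + 2 + r = r + 1 + (r + 1) by omega]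
  · have h1 : imageCodim (eqTwo p q) c r S ≤ ((2 * (r + 1) : ℕ) : ℕ∞) := by
      refine imageCodim_le hS (g := 1) (fun h => ?_) fun f ⟨v, hv, _, hf⟩ => ?_
      · obtain ⟨v, hv⟩ := hne
        simpa using mem_chartIdeal.1 h v hv
      have hδ := hE.d_pos (r + 2) (by omega)
      have hv0 : jet (r + 1) ((X ^ (r + 2) * 1 : PowerSeries ℂ) : Germ) (comp 1 v : PowerSeries ℂ)
          = chart (r + 1) (false, false) v := by
        rw [jet_coe_coe]
        congr 1
        funext ⟨k, i⟩
        fin_cases k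
        · simp only [Fin.zero_eta, pack_zero, trc, h0 v hv, mul_one]
          rw [coeff_X_pow, if_neg (by omega)]
        · simp [trc, coeff_comp]
      refine codim_le_of_param (fun w : Fin 0 → ℂ => w) (relIdeal_id _) (true, false)
        (fun _ => pack (trc r (poleInv (poleOrderTwo (r + 2)) (residualTwo p q (r + 2) 1) (comp 1 v)))
          (trc r (X ^ (r + 2) * 1))) (fun _ => ?_) (fun j => RatGen.const _) (fun i => i.elim0)
        (by simp)
      refine ⟨_, _, _, ?_, hv0 ▸ ⟨v, ⟨hv, by simp, hf⟩, rfl⟩,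
        (hE.eqn_pos c (by omega) (by simp) _ _).2 rfl,
        (jet_inv_coe r (poleInv_ne_zero hδ _ (hE.ne_zero _ _ (by omega) (by simp))) _).symm⟩
      rw [coe_ne_zero, mul_one]
      exact pow_ne_zero _ X_ne_zero
    refine h1.trans ?_
    have := add_le_add_left (le_codim_of_forall_eq_zero hS hne h0) (r : ℕ∞)
    refine le_trans ?_ this
    norm_cast
    omega

/-! ### Linear differential equations of first order -/

/-- The coefficients of the solution of `ξ' = η ξ`. -/
def expCoeff (η : PowerSeries ℂ) : ℕ → ℂ
  | 0 => 1
  | n + 1 => (∑ i : Fin (n + 1), coeff (n - i) η * expCoeff η i) / (n + 1)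
decreasing_by exact i.2

/-- The solution of `ξ' = η ξ` with value `1`. -/
def expSol (η : PowerSeries ℂ) : PowerSeries ℂ := PowerSeries.mk (expCoeff η)

theorem constantCoeff_expSol (η : PowerSeries ℂ) : constantCoeff (expSol η) = 1 := by
  rw [← coeff_zero_eq_constantCoeff_apply, expSol, coeff_mk, expCoeff]

theorem derivative_expSol (η : PowerSeries ℂ) : d⁄dX ℂ (expSol η) = η * expSol η := by
  ext n
  rw [coeff_derivative, expSol, coeff_mk, expCoeff, div_mul_cancel₀ _ (Nat.cast_add_one_ne_zero n),
    mul_comm η, coeff_mul, Finset.Nat.sum_antidiagonal_eq_sum_range_succ_mk, Finset.sum_range]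
  exact Finset.sum_congr rfl fun i _ => by rw [coeff_mk, mul_comm]

/-- On the last locus the codimension does not increase. The jet of `x` is zero, but the section is
free: writing `1/x̄ = ζ W`, the value `W₀` depends only on the order of `x`, and the higher
coefficients can be prescribed by solving `ξ' = η ξ` for the invertible factor of `x`. The image
thus has a dense family of `r` parameters in a space of dimension `2 (r + 1)`, so its codimension is
at most `r + 2`. -/
theorem onlyAccessibleBlowDowns_eqOne (a : ℂ) {b : ℂ} (hb : b ≠ 0) (c : ℂ) :
    OnlyAccessibleBlowDowns (eqOne a b) c (fun r => r + 2) zeroSet := by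
  have hE := poleForm_eqOne a hb
  refine hE.onlyAccessibleBlowDowns c fun r => ⟨0, ?_, fun S hS hne h0 => ?_⟩
  · exact hE.le_imageCodim_zeroSet_last c (r := r) (δ := 1) (by omega) fun n hn => by
      obtain ⟨m, rfl⟩ := Nat.exists_eq_add_of_le' (show 1 ≤ n by omega)
      exact le_rfl
  · have h1 : imageCodim (eqOne a b) c r S ≤ ((r + 2 : ℕ) : ℕ∞) := by
      refine imageCodim_le hS (g := 1) (fun h => ?_) fun f ⟨v, hv, _, hf⟩ => ?_
      · obtain ⟨v, hv⟩ := hne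
        simpa using mem_chartIdeal.1 h v hv
      -- The value of `W` when `x` has order `n + r + 2`. These are infinitely many numbers, so
      -- restricting the first parameter to them still gives a Zariski dense family.
      let ν : ℕ → ℂ := fun n => (-b * ((n + (r + 1) : ℕ) + 1 : ℂ))⁻¹
      have hν : ∀ n, ν n ≠ 0 := fun n =>
        inv_ne_zero (mul_ne_zero (neg_ne_zero.2 hb) (Nat.cast_add_one_ne_zero _))
      have hinj : Function.Injective ν := by
        intro m n h
        have := mul_left_cancel₀ (neg_ne_zero.2 hb) (inv_injective h)
        have := add_right_cancel this
        have := Nat.cast_injective this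
        omega
      let s : Fin r → Set ℂ := fun i => if (i : ℕ) = 0 then Set.range ν else Set.univ
      let A := {w : Fin r → ℂ // ∀ i, w i ∈ s i}
      have hA : relIdeal (fun w : A => w.1) = ⊥ := by
        rw [eq_bot_iff]
        intro g hg
        rw [mem_relIdeal] at hg
        refine MvPolynomial.funext_set s (fun i => ?_) fun w hw => ?_
        · simp only [s]
          split_ifs
          · exact Set.infinite_range_of_injective hinj
          · exact Set.infinite_univ
        · rw [map_zero]
          exact hg ⟨w, fun i => hw i (Set.mem_univ i)⟩
      refine codim_le_of_param (fun w : A => w.1) hA (true, false)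
        (fun w => pack (Fin.cons 0 w.1) fun _ => 0) (fun w => ?_) ?_ ?_
        (by simp only [Fintype.card_fin]; omega)
      · obtain ⟨n, hn⟩ : ∃ n, ∀ i : Fin r, (i : ℕ) = 0 → w.1 i = ν n := by
          by_cases hr : 0 < r
          · have := w.2 ⟨0, hr⟩
            simp only [s, if_true] at this
            obtain ⟨n, hn⟩ := this
            exact ⟨n, fun i hi => by rw [hn]; exact congrArg w.1 (Fin.ext hi)⟩
          · exact ⟨0, fun i => by have := i.2; omega⟩
        set W : PowerSeries ℂ := PowerSeries.mk fun i => if i = 0 then ν n else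
          if h : i < r then w.1 ⟨i, h⟩ else 0 with hW
        have hW0 : constantCoeff W = ν n := by
          rw [← coeff_zero_eq_constantCoeff_apply, hW, coeff_mk, if_pos rfl]
        have hWi : ∀ i : Fin r, coeff (i : ℕ) W = w.1 i := by
          intro i
          rw [hW, coeff_mk]
          by_cases h : (i : ℕ) = 0
          · rw [if_pos h, hn i h]
          · rw [if_neg h, dif_pos i.2]
        have hW0' : constantCoeff W ≠ 0 := hW0 ▸ hν n
        have hsplit : C (-b * ((n + (r + 1) : ℕ) + 1)) + X * unshift 1 W⁻¹ = W⁻¹ := by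
          ext i
          rcases i with _ | i
          · simp [hW0, ν]
          · rw [map_add, coeff_succ_X_mul, coeff_unshift, coeff_C, if_neg (Nat.succ_ne_zero _),
              zero_add]
        -- The logarithmic derivative is obtained by solving `y + a - b ξ'/ξ = (W⁻¹ - W₀⁻¹)/ζ` for
        -- `ξ'/ξ`.
        set ξ := expSol (C b⁻¹ * (comp 1 v + C a - unshift 1 W⁻¹)) with hξ
        have hξ0 : constantCoeff ξ ≠ 0 := by
          rw [hξ, constantCoeff_expSol]
          exact one_ne_zero
        have hres : X ^ poleOrderOne (n + (r + 1) + 1) * comp 1 v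
            + residualOne a b (n + (r + 1) + 1) ξ = W⁻¹ := by
          rw [← hsplit]
          simp only [poleOrderOne, residualOne, pow_one]
          rw [hξ, derivative_expSol, ← hξ, mul_assoc, PowerSeries.mul_inv_cancel ξ hξ0, mul_one,
            ← mul_assoc, ← map_mul, mul_inv_cancel₀ hb, map_one, one_mul]
          ring
        have hpole : poleInv (poleOrderOne (n + (r + 1) + 1))
            (residualOne a b (n + (r + 1) + 1) ξ) (comp 1 v) = X * W := by
          rw [poleInv, hres]
          have : (W⁻¹)⁻¹ = W := by
            rw [PowerSeries.inv_eq_iff_mul_eq_one]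
            · exact PowerSeries.mul_inv_cancel _ hW0'
            · rw [constantCoeff_inv]; exact inv_ne_zero hW0'
          rw [this, poleOrderOne, pow_one]
        have hv0 : jet (r + 1) ((X ^ (n + (r + 1) + 1) * ξ : PowerSeries ℂ) : Germ)
            (comp 1 v : PowerSeries ℂ) = chart (r + 1) (false, false) v := by
          rw [jet_coe_coe]
          congr 1
          funext ⟨k, i⟩
          fin_cases k
          · simp only [Fin.zero_eta, pack_zero, trc, h0 v hv]
            rw [coeff_X_pow_mul', if_neg (by omega)]
          · simp [trc, coeff_comp]
        have hXW : X * W ≠ 0 := mul_ne_zero X_ne_zero (ne_zero_of_constantCoeff hW0')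
        refine ⟨((X ^ (n + (r + 1) + 1) * ξ : PowerSeries ℂ) : Germ), (comp 1 v : PowerSeries ℂ),
          ((X * W : PowerSeries ℂ) : Germ)⁻¹, ?_, hv0 ▸ ⟨v, ⟨hv, by simp, hf⟩, rfl⟩,
          (hE.eqn_pos c (Nat.le_add_left _ _) hξ0 _ _).2 (by rw [hpole]), ?_⟩
        · exact coe_ne_zero.2 (mul_ne_zero (pow_ne_zero _ X_ne_zero) (ne_zero_of_constantCoeff hξ0))
        · rw [jet_inv_coe r hXW]
          congr 1
          funext ⟨k, i⟩
          fin_cases k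
          · simp only [Fin.zero_eta, pack_zero, trc]
            refine Fin.cases ?_ (fun i => ?_) i
            · simp
            · rw [Fin.cons_succ, Fin.val_succ, coeff_succ_X_mul, hWi]
          · simp only [Fin.mk_one, pack_one, trc]
            rw [coeff_X_pow_mul', if_neg (by omega)]
      · rintro ⟨k, i⟩
        fin_cases k
        · refine Fin.cases ?_ (fun i => ?_) i
          · exact (RatGen.const 0).congr fun w => by simp
          · exact (RatGen.coord i).congr fun w => by simp
        · exact (RatGen.const 0).congr fun w => by simp
      · exact fun i => (RatGen.coord (0, i.succ)).congr fun w => by simp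
    rw [Nat.cast_zero, add_zero]
    exact h1.trans (le_codim_of_forall_eq_zero hS hne h0)

end DelayPainleve

end

noncomputable section
namespace DelayPainleve
open PowerSeries

/-! ### The third equation -/

theorem coeff_zero_iterate_derivative (i : ℕ) (f : PowerSeries ℂ) :
    coeff 0 ((fun g => d⁄dX ℂ g)^[i] f) = (i.factorial : ℂ) * coeff i f := by
  induction i generalizing f with
  | zero => simp
  | succ i ih =>
    rw [Function.iterate_succ_apply, ih, coeff_derivative, Nat.factorial_succ]
    push_cast
    ring

theorem iterate_der_coe (i : ℕ) (f : PowerSeries ℂ) :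
    der^[i] (f : Germ) = (((fun g => d⁄dX ℂ g)^[i] f : PowerSeries ℂ) : Germ) := by
  induction i generalizing f with
  | zero => rfl
  | succ i ih =>
    rw [Function.iterate_succ_apply, Function.iterate_succ_apply]
    exact (congrArg der^[i] (der_coe f)).trans (ih _)

/-- The operator `λ z x + α x'`. -/
def linOp (l α c : ℂ) (p : PowerSeries ℂ) : PowerSeries ℂ :=
  C l * ((C c + X) * p) + C α * d⁄dX ℂ p

/-- The solution of `λ z x + α x' = 0` with value `1`. -/
def linSol (l α c : ℂ) : PowerSeries ℂ := expSol (-(C (l / α) * (C c + X)))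

theorem coe_linOp (l α c : ℂ) (p : PowerSeries ℂ) :
    l • (zAt c * (p : Germ)) + α • der (p : Germ) = ((linOp l α c p : PowerSeries ℂ) : Germ) := by
  rw [zAt_eq, ← map_mul, smul_coe, der_coe, smul_coe, ← map_add, linOp]

theorem constantCoeff_linSol (l α c : ℂ) : constantCoeff (linSol l α c) = 1 :=
  constantCoeff_expSol _

theorem linOp_linSol_mul (l : ℂ) {α : ℂ} (hα : α ≠ 0) (c : ℂ) (g : PowerSeries ℂ) :
    linOp l α c (linSol l α c * g) = C α * linSol l α c * d⁄dX ℂ g := by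
  have h : C α * d⁄dX ℂ (linSol l α c) = -(C l * (C c + X) * linSol l α c) := by
    rw [linSol, derivative_expSol, ← linSol]
    have : C α * C (l / α) = C l := by rw [← map_mul, mul_div_cancel₀ _ hα]
    rw [← this]
    ring
  rw [linOp, Derivation.leibniz]
  simp only [smul_eq_mul]
  linear_combination g * h

theorem X_pow_dvd_mul_iff {n : ℕ} {p q : PowerSeries ℂ} (hp : constantCoeff p ≠ 0) :
    X ^ n ∣ p * q ↔ X ^ n ∣ q := by
  refine ⟨fun h => ?_, fun h => h.mul_left p⟩
  have := h.mul_left p⁻¹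
  rwa [← mul_assoc, PowerSeries.inv_mul_cancel p hp, one_mul] at this

/-- Variation of constants: for `p = E g` with `E = linSol l α c`, the operator gives `α E g'`. This
is divisible by `ζ^m` exactly when `g` is constant modulo `ζ^(m+1)`, that is, when `p ≡ p(0) E`. The
differential conditions become linear equations for the coordinates. -/
theorem coeff_linOp_eq_zero_iff (l : ℂ) {α : ℂ} (hα : α ≠ 0) (c : ℂ) (m : ℕ) (p : PowerSeries ℂ) :
    (∀ i < m, coeff i (linOp l α c p) = 0) ↔
      ∀ i < m, coeff (i + 1) p = coeff (i + 1) (linSol l α c) * constantCoeff p := by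
  have hE : constantCoeff (linSol l α c) ≠ 0 := by
    rw [constantCoeff_linSol]
    exact one_ne_zero
  set E := linSol l α c
  set g := E⁻¹ * p
  have hp : p = E * g := by rw [← mul_assoc, PowerSeries.mul_inv_cancel E hE, one_mul]
  have hg : constantCoeff g = constantCoeff p := by
    rw [map_mul, constantCoeff_inv, constantCoeff_linSol, inv_one, one_mul]
  have h1 : linOp l α c p = (C α * E) * d⁄dX ℂ g := by
    rw [hp]
    exact linOp_linSol_mul l hα c g
  have h2 : constantCoeff (C α * E) ≠ 0 := by
    rw [map_mul, constantCoeff_C]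
    exact mul_ne_zero hα hE
  have h3 : p - C (constantCoeff p) * E = E * (g - C (constantCoeff p)) := by
    rw [mul_sub, ← hp, mul_comm E]
  have h4 : (∀ i < m, coeff (i + 1) p = coeff (i + 1) E * constantCoeff p) ↔
      X ^ (m + 1) ∣ p - C (constantCoeff p) * E := by
    rw [X_pow_dvd_iff]
    constructor
    · intro h i hi
      rcases i with _ | i
      · simp [E, constantCoeff_linSol]
      · rw [map_sub, coeff_C_mul, h i (by omega), mul_comm, sub_self]
    · intro h i hi
      have := h (i + 1) (by omega)
      rw [map_sub, coeff_C_mul, sub_eq_zero] at this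
      rw [this, mul_comm]
  rw [← X_pow_dvd_iff, h1, X_pow_dvd_mul_iff h2, h4, h3, X_pow_dvd_mul_iff hE, X_pow_dvd_iff,
    X_pow_dvd_iff]
  constructor
  · intro h i hi
    rcases i with _ | i
    · simp [hg]
    · have := h i (by omega)
      rw [coeff_derivative, mul_eq_zero, or_iff_left (Nat.cast_add_one_ne_zero i)] at this
      rw [map_sub, this, coeff_C, if_neg (Nat.succ_ne_zero i), sub_self]
  · intro h i hi
    have := h (i + 1) (by omega)
    rw [map_sub, coeff_C, if_neg (Nat.succ_ne_zero i), sub_zero] at this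
    rw [coeff_derivative, this, zero_mul]

theorem RatPS.linOp {A κ : Type*} {u : A → κ → ℂ} {N : ℕ} {P : A → PowerSeries ℂ} (l α c : ℂ)
    (hP : RatPS u (N + 1) P) : RatPS u N fun a => linOp l α c (P a) :=
  ((RatPS.const _).mul ((RatPS.const _).mul (hP.mono (Nat.le_succ N)))).add
    ((RatPS.const _).mul hP.derivative)

theorem eqThree_iff (l α c : ℂ) {p : PowerSeries ℂ} (hp : constantCoeff p ≠ 0) (q : PowerSeries ℂ)
    (v : Germ) : eqThree l α c (q : Germ) (p : Germ) v ↔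
      v = ((q * linOp l α c p * p⁻¹ : PowerSeries ℂ) : Germ) := by
  rw [eqThree, coe_linOp, map_mul, map_mul, coe_inv hp, ← div_eq_mul_inv,
    eq_div_iff (coe_ne_zero.2 (ne_zero_of_constantCoeff hp))]

/-- The conditions defining `logDerivSet`, as linear equations for the coordinates. -/
def LogFlat (l α c : ℂ) {r : ℕ} (m : ℕ) (v : Coord (r + 1)) : Prop :=
  ∀ i : Fin (r + 1), (i : ℕ) < m →
    v (0, i.succ) = coeff ((i : ℕ) + 1) (linSol l α c) * v (0, 0)

theorem logFlat_iff (l : ℂ) {α : ℂ} (hα : α ≠ 0) (c : ℂ) {r m : ℕ} (hm : m ≤ r + 1)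
    {p : PowerSeries ℂ} {v : Coord (r + 1)}
    (hp : ∀ i : Fin (r + 1 + 1), coeff (i : ℕ) p = v (0, i)) :
    LogFlat l α c m v ↔ ∀ i < m, coeff i (linOp l α c p) = 0 := by
  have h0 : constantCoeff p = v (0, 0) := by
    rw [← coeff_zero_eq_constantCoeff_apply]
    exact hp 0
  rw [coeff_linOp_eq_zero_iff l hα, h0]
  constructor
  · intro h i hi
    have := h ⟨i, by omega⟩ hi
    rw [← hp] at this
    exact this
  · intro h i hi
    rw [← hp]
    exact h i hi

theorem logDerivSet_eq (l : ℂ) {α : ℂ} (hα : α ≠ 0) (c : ℂ) {r m : ℕ} (hm : m ≤ r + 1) :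
    logDerivSet l α c r m = chart (r + 1) (false, false) '' {v | LogFlat l α c m v} := by
  have key : ∀ p : PowerSeries ℂ, (∀ i : ℕ, i < m →
      (der^[i] (l • (zAt c * (p : Germ)) + α • der (p : Germ))).coeff 0 = 0) ↔
      ∀ i < m, coeff i (linOp l α c p) = 0 := by
    intro p
    refine forall₂_congr fun i _ => ?_
    have := coeff_coe_nat ((fun g => d⁄dX ℂ g)^[i] (linOp l α c p)) 0
    rw [Nat.cast_zero] at this
    rw [coe_linOp, iterate_der_coe, this, coeff_zero_iterate_derivative, mul_eq_zero,
      or_iff_right (Nat.cast_ne_zero.2 (Nat.factorial_ne_zero i))]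
  ext j
  constructor
  · rintro ⟨_, _, ⟨p, rfl⟩, ⟨q, rfl⟩, h, rfl⟩
    refine ⟨_, ?_, (jet_coe_coe _ p q).symm⟩
    exact (logFlat_iff l hα c hm fun i => by simp [trc]).2 ((key p).1 h)
  · rintro ⟨v, hv, rfl⟩
    refine ⟨_, _, ⟨_, rfl⟩, ⟨_, rfl⟩, (key _).2 ?_, chart_eq_jet v⟩
    exact (logFlat_iff l hα c hm (coeff_comp 0 v)).1 hv

theorem logDerivSet_isSubvariety (l : ℂ) {α : ℂ} (hα : α ≠ 0) (c : ℂ) {r m : ℕ} (hm : m ≤ r + 1) :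
    IsSubvariety (logDerivSet l α c r m) ∧ codim (logDerivSet l α c r m) = m := by
  have hk : Function.Injective
      fun i : Fin m => ((0, (Fin.castLE hm i).succ) : Fin 2 × Fin (r + 1 + 1)) := by
    intro i j h
    simpa using h
  have := linear_isSubvariety hk (fun i => coeff ((i : ℕ) + 1) (linSol l α c))
    ⟨(0, 0), by rintro ⟨i, hi⟩; simp at hi⟩
  have e : {v : Coord (r + 1) | ∀ i : Fin m, v (0, (Fin.castLE hm i).succ)
      = coeff ((i : ℕ) + 1) (linSol l α c) * v (0, 0)} = {v | LogFlat l α c m v} := by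
    ext v
    exact ⟨fun h i hi => h ⟨i, hi⟩, fun h i => h _ i.2⟩
  rw [logDerivSet_eq l hα c hm, ← e]
  simpa using this

/-- The equations of `logDerivSet`. -/
def flatPoly (l α c : ℂ) (r : ℕ) (i : Fin (r + 1)) : MvPolynomial (Fin 2 × Fin (r + 1 + 1)) ℂ :=
  MvPolynomial.X (0, i.succ) -
    MvPolynomial.C (coeff ((i : ℕ) + 1) (linSol l α c)) * MvPolynomial.X (0, 0)

theorem eval_flatPoly (l α c : ℂ) {r : ℕ} (i : Fin (r + 1)) (v : Coord (r + 1)) :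
    MvPolynomial.eval v (flatPoly l α c r i) = 0 ↔
      v (0, i.succ) = coeff ((i : ℕ) + 1) (linSol l α c) * v (0, 0) := by
  simp [flatPoly, sub_eq_zero]

theorem subset_closure_logDerivSet_iff (l : ℂ) {α : ℂ} (hα : α ≠ 0) (c : ℂ) {r m : ℕ}
    (hm : m ≤ r + 1) {S : Set (Jet (r + 1))} (hS : IsPreirreducible S)
    (hne : ∃ v, chart (r + 1) (false, false) v ∈ S) :
    S ⊆ closure (logDerivSet l α c r m) ↔
      ∀ v, chart (r + 1) (false, false) v ∈ S → LogFlat l α c m v := by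
  have := subset_closure_chart_image_iff hS (false, false) hne
    (s := {f | ∃ i : Fin (r + 1), (i : ℕ) < m ∧ f = flatPoly l α c r i})
  have he : ∀ v : Coord (r + 1), (∀ f ∈ {f | ∃ i : Fin (r + 1), (i : ℕ) < m ∧
      f = flatPoly l α c r i}, MvPolynomial.eval v f = 0) ↔ LogFlat l α c m v := by
    refine fun v => ⟨fun h i hi => (eval_flatPoly l α c i v).1 (h _ ⟨i, hi, rfl⟩), ?_⟩
    rintro h _ ⟨i, hi, rfl⟩
    exact (eval_flatPoly l α c i v).2 (h i hi)
  rw [logDerivSet_eq l hα c hm]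
  simpa only [he] using this

/-- With `x₀ ≠ 0`, the factor `L(x)` gives `x̄` `m` leading zeros, and `ȳ = x` is proportional to
`E` up to order `m`; in the inverse chart `1/x` is proportional to `E⁻¹`. Since only the `r`-jet of
`ȳ` is seen, this gives `min m r` relations besides the `m` zeros. -/
theorem le_imageCodim_logDerivSet (l : ℂ) {α : ℂ} (hα : α ≠ 0) (c : ℂ) {r m : ℕ} (hm : 1 ≤ m)
    (hmr : m ≤ r + 1) :
    ((m + min m r : ℕ) : ℕ∞) ≤ imageCodim (eqThree l α) c r (logDerivSet l α c r m) := by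
  set U := chart (r + 1) (false, false) '' {v | MvPolynomial.eval v (MvPolynomial.X (0, 0)) ≠ 0}
    with hU
  set E := linSol l α c with hEdef
  have hE0 : constantCoeff E ≠ 0 := by
    rw [hEdef, constantCoeff_linSol]
    exact one_ne_zero
  have hdata : ∀ e v, chart r e v ∈ image (eqThree l α) c r (logDerivSet l α c r m ∩ U) →
      (∀ i : Fin (r + 1), (i : ℕ) < m → v (0, i) = 0) ∧
      ∀ i : Fin (r + 1), (i : ℕ) ≤ m →
        v (1, i) = (if e.2 then coeff (i : ℕ) E⁻¹ else coeff (i : ℕ) E) * v (1, 0) := by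
    rintro ⟨e1, e2⟩ v ⟨x, y, x', hx, ⟨hB, w, hw, hwj⟩, hE', hj⟩
    rw [logDerivSet_eq l hα c hmr] at hB
    obtain ⟨w', hw', hwj'⟩ := hB
    obtain rfl := chart_injective _ _ (hwj.trans hwj'.symm)
    obtain ⟨p, q, rfl, rfl, hp, hq⟩ := exists_of_jet_eq_chart hwj.symm
    have hp0 : constantCoeff p ≠ 0 := by
      rw [← coeff_zero_eq_constantCoeff_apply]
      have := hp 0
      simp only [Fin.coe_ofNat_eq_mod, Nat.zero_mod] at this
      rw [this]
      simpa using hw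
    rw [eqThree_iff l α c hp0] at hE'
    subst hE'
    have hlop := (logFlat_iff l hα c hmr hp).1 hw'
    have hflat := (coeff_linOp_eq_zero_iff l hα c m p).1 hlop
    have hx' : ∀ i < m, coeff i (q * linOp l α c p * p⁻¹) = 0 :=
      X_pow_dvd_iff.1 (((X_pow_dvd_iff.2 hlop).mul_left q).mul_right p⁻¹)
    obtain ⟨⟨h1, h2⟩, h3, h4⟩ := jet_eq_chart_iff.1 hj.symm
    obtain rfl : e1 = false := eq_false_of_visible_coe h1 (by
      rw [← coeff_zero_eq_constantCoeff_apply]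
      exact hx' 0 hm)
    have hpE : ∀ i < m + 1, coeff i p = coeff i (C (constantCoeff p) * E) := by
      intro i hi
      rw [coeff_C_mul]
      rcases i with _ | i
      · simp [hEdef, constantCoeff_linSol]
      · rw [hflat i (by omega), mul_comm]
    refine ⟨fun i hi => ?_, fun i hi => ?_⟩
    · rw [← h2 i]
      simp only [localCoord, Bool.false_eq_true, if_false]
      rw [coeff_coe_nat]
      exact hx' i hi
    · have h40 := h4 0
      rw [← h4 i, ← h40]
      cases e2
      · simp only [localCoord, Bool.false_eq_true, if_false]
        rw [coeff_coe_nat, coeff_coe_nat, hpE i (by omega), coeff_C_mul, mul_comm]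
        simp
      · simp only [localCoord, if_true]
        rw [← coe_inv hp0, coeff_coe_nat, coeff_coe_nat]
        have hcE : constantCoeff (C (constantCoeff p) * E) ≠ 0 := by
          rw [map_mul, constantCoeff_C]
          exact mul_ne_zero hp0 hE0
        have hinv : (C (constantCoeff p) * E)⁻¹ = C (constantCoeff p)⁻¹ * E⁻¹ := by
          rw [PowerSeries.mul_inv_rev, PowerSeries.C_inv, mul_comm]
        rw [coeff_inv_congr hp0 hcE hpE (show (i : ℕ) < m + 1 by omega), hinv, coeff_C_mul, mul_comm]
        simp [constantCoeff_inv]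
  have hne : (logDerivSet l α c r m ∩ U).Nonempty := by
    rw [logDerivSet_eq l hα c hmr]
    refine ⟨_, ⟨pack (trc (r + 1) E) 0, fun i _ => ?_, rfl⟩, _, ?_, rfl⟩
    · simp [trc, hEdef, constantCoeff_linSol]
    · simpa [trc] using hE0
  have key := le_imageCodim (E := eqThree l α) (c := c)
    (ι := Fin m ⊕ Fin (min m r)) (isOpen_chart_image _ _) hne fun e => ?_
  · simpa using key
  set k : Fin m ⊕ Fin (min m r) → Fin 2 × Fin (r + 1) :=
    Sum.elim (fun i => (0, ⟨i, by omega⟩)) fun i => (1, ⟨i + 1, by omega⟩) with hk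
  have h10 : (1, 0) ∉ Set.range k := by
    rintro ⟨i | i, hi⟩ <;> simp [hk, Fin.ext_iff] at hi
  refine ⟨k, ?_, ?_⟩
  · rintro (i | i) (j | j) h <;> simp_all [Fin.ext_iff]
  · rintro (i | i)
    · exact (RatGen.const 0).congr fun a => (hdata e a.1 a.2).1 _ i.2
    · exact ((RatGen.const (if e.2 then coeff ((i : ℕ) + 1) E⁻¹ else coeff ((i : ℕ) + 1) E)).mul
        (RatGen.coord ⟨(1, 0), h10⟩)).congr fun a =>
          (hdata e a.1 a.2).2 ⟨i + 1, by omega⟩ (by simp only; omega)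

/-- The increase `min m r` is positive because `r ≥ 1`. -/
theorem isBlowDown_logDerivSet (l : ℂ) {α : ℂ} (hα : α ≠ 0) (c : ℂ) {r m : ℕ} (hr : 1 ≤ r)
    (hm : 1 ≤ m) (hmr : m ≤ r + 1) : IsBlowDown (eqThree l α) c r (logDerivSet l α c r m) := by
  obtain ⟨h1, h2⟩ := logDerivSet_isSubvariety l hα c hmr
  refine ⟨h1, ?_⟩
  rw [h2]
  refine lt_of_lt_of_le ?_ (le_imageCodim_logDerivSet l hα c hm hmr)
  norm_cast
  omega

/-- The value of `x̄ = y L(x)/x` can vanish only if that of `L(x)` does, and then the section lies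
on the blow-down type singularity with `r = m = 1` and may not be iterated. -/
theorem exists_of_accessible_eqThree (l : ℂ) {α : ℂ} (hα : α ≠ 0) {c : ℂ} {x y : Germ}
    (h : AccessibleSection (eqThree l α) c x y) : ∃ p q : PowerSeries ℂ,
      x = (p : Germ) ∧ y = (q : Germ) ∧ constantCoeff p ≠ 0 ∧ constantCoeff q ≠ 0 := by
  have h0 : ∀ p : PowerSeries ℂ, (p : Germ).coeff 0 = constantCoeff p := by
    intro p
    have := coeff_coe_nat p 0
    rwa [Nat.cast_zero, coeff_zero_eq_constantCoeff_apply] at this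
  induction h with
  | init c x y hx hy =>
    obtain ⟨⟨p, rfl⟩, hp⟩ := hx
    obtain ⟨⟨q, rfl⟩, hq⟩ := hy
    exact ⟨p, q, rfl, rfl, h0 p ▸ hp, h0 q ▸ hq⟩
  | step c x y x' h hB hx hE ih =>
    obtain ⟨p, q, rfl, rfl, hp, hq⟩ := ih
    rw [eqThree_iff l α c hp] at hE
    refine ⟨_, p, hE, rfl, ?_, hp⟩
    by_cases hL : constantCoeff (linOp l α c p) = 0
    · refine (hB ⟨1, _, isBlowDown_logDerivSet l hα c le_rfl le_rfl (by norm_num),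
        _, _, ⟨p, rfl⟩, ⟨q, rfl⟩, fun i hi => ?_, rfl⟩).elim
      obtain rfl : i = 0 := by omega
      rw [coe_linOp, Function.iterate_zero, id, h0, hL]
    · rw [map_mul, map_mul, constantCoeff_inv]
      exact mul_ne_zero (mul_ne_zero hq hL) (inv_ne_zero hp)

/-- The increase of codimension inside `logDerivSet l α c r m`, away from the next of these sets. -/
theorem imageCodim_le_of_logFlat (l : ℂ) {α : ℂ} (hα : α ≠ 0) (c : ℂ) {r m : ℕ} (hmr : m < r + 1)
    {S : Set (Jet (r + 1))} (hS : IsPreirreducible S)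
    (hz : ∀ v, chart (r + 1) (false, false) v ∈ S → LogFlat l α c m v)
    (hg0 : MvPolynomial.X (0, 0) ∉ chartIdeal S (false, false))
    (hg1 : flatPoly l α c r ⟨m, hmr⟩ ∉ chartIdeal S (false, false)) :
    imageCodim (eqThree l α) c r S ≤ codim S + m := by
  have hne : ∃ v, chart (r + 1) (false, false) v ∈ S := by
    by_contra hc
    exact hg0 (mem_chartIdeal.2 fun v hv => (hc ⟨v, hv⟩).elim)
  have hg : MvPolynomial.X (0, 0) * flatPoly l α c r ⟨m, hmr⟩ ∉ chartIdeal S (false, false) :=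
    fun h => ((isPrime_chartIdeal hS hne).mem_or_mem h).elim hg0 hg1
  let A := {a : Coord (r + 1) // chart (r + 1) (false, false) a ∈ S ∧
      MvPolynomial.eval a (MvPolynomial.X (0, 0) * flatPoly l α c r ⟨m, hmr⟩) ≠ 0}
  have hp : ∀ a : A, constantCoeff (comp 0 a.1) ≠ 0 := by
    intro a
    rw [comp, constantCoeff_ser]
    have := left_ne_zero_of_mul (map_mul (MvPolynomial.eval a.1) _ _ ▸ a.2.2)
    simpa using this
  have hlow : ∀ a : A, ∀ i < m, coeff i (linOp l α c (comp 0 a.1)) = 0 := fun a =>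
    (logFlat_iff l hα c hmr.le (coeff_comp 0 a.1)).1 (hz a.1 a.2.1)
  have hΛ : ∀ a : A, constantCoeff (unshift m (linOp l α c (comp 0 a.1))) ≠ 0 := by
    intro a h
    have h1 := right_ne_zero_of_mul (map_mul (MvPolynomial.eval a.1) _ _ ▸ a.2.2)
    rw [← coeff_zero_eq_constantCoeff_apply, coeff_unshift, zero_add] at h
    refine h1 ((eval_flatPoly l α c _ a.1).2 ?_)
    have h2 : LogFlat l α c (m + 1) a.1 := by
      refine (logFlat_iff l hα c hmr (coeff_comp 0 a.1)).2 fun i hi => ?_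
      rcases Nat.lt_succ_iff_lt_or_eq.1 hi with hi | rfl
      · exact hlow a i hi
      · exact h
    exact h2 ⟨m, hmr⟩ (Nat.lt_succ_self m)
  have hsplit : ∀ a : A, X ^ m * unshift m (linOp l α c (comp 0 a.1)) = linOp l α c (comp 0 a.1) :=
    fun a => X_pow_mul_unshift (hlow a)
  -- The further functions are the top coefficient of `x` and the top `m + 1` coefficients of `y`.
  refine imageCodim_le_codim_add (E := eqThree l α) (c := c) hS hg m
    (ρ := Option (Fin (m + 1))) (by simp)
    (fun o => o.elim (0, Fin.last _) fun i => (1, ⟨r + 1 - i, by omega⟩)) (false, false)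
    (fun a => pack (trc r (comp 1 a * linOp l α c (comp 0 a) * (comp 0 a)⁻¹))
      (trc r (comp 0 a))) ?_ ?_ ?_
  · intro a ha hag
    have h0 := hp ⟨a, ha, hag⟩
    exact ⟨_, _, _, coe_ne_zero.2 (ne_zero_of_constantCoeff h0), (chart_eq_jet a).symm,
      (eqThree_iff l α c h0 _ _).2 rfl, (jet_coe_coe r _ _).symm⟩
  · have h0 : ∀ k N, RatPS (fun a : A => a.1) N fun a => comp k a.1 :=
      fun k N => ratPS_comp N fun i _ => RatGen.coord (k, i)
    rintro ⟨k, i⟩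
    fin_cases k
    · exact ((((h0 1 (r + 1)).mul (RatPS.linOp l α c (h0 0 (r + 2)))).mul
        ((h0 0 (r + 1)).inv hp)) i i.2).congr fun a => pack_zero _ _ i
    · exact (h0 0 (r + 1) i i.2).congr fun a => pack_one _ _ i
  · set u := fun a : A =>
      Sum.elim (pack (trc r (comp 1 a.1 * linOp l α c (comp 0 a.1) * (comp 0 a.1)⁻¹))
        (trc r (comp 0 a.1)))
        fun o : Option (Fin (m + 1)) =>
          a.1 (o.elim (0, Fin.last _) fun i => (1, ⟨r + 1 - i, by omega⟩)) with hu
    have hx : ∀ i, RatGen u fun a => a.1 (0, i) := by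
      intro i
      rcases Fin.eq_castSucc_or_eq_last i with ⟨i, rfl⟩ | rfl
      · refine (RatGen.coord (Sum.inl (1, i))).congr fun a => ?_
        simp only [hu, Sum.elim_inl, pack_one, trc]
        exact (coeff_comp 0 a.1 i.castSucc).symm
      · exact (RatGen.coord (Sum.inr none)).congr fun a => rfl
    have hxN : ∀ N, RatPS u N fun a => comp 0 a.1 := fun N => ratPS_comp N fun i _ => hx i
    have hP : RatPS u (r + 1)
        fun a => comp 1 a.1 * linOp l α c (comp 0 a.1) * (comp 0 a.1)⁻¹ := by
      intro n hn
      exact (RatGen.coord (Sum.inl (0, ⟨n, hn⟩))).congr fun a => by simp [hu, trc]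
    -- From `x̄ x = y L(x)` with `L(x) = ζ^m` times an invertible series: dividing by `ζ^m` costs
    -- `m` coefficients of `y`.
    have hq : RatPS u (r + 1 - m) fun a => comp 1 a.1 := by
      have h1 : RatPS u (r + 1 - m) fun a =>
          unshift m (comp 1 a.1 * linOp l α c (comp 0 a.1) * (comp 0 a.1)⁻¹ * comp 0 a.1) :=
        ((hP.mul (hxN _)).mono (show r + 1 - m + m ≤ r + 1 by omega)).unshift m
      have h2 : RatPS u (r + 1 - m) fun a => (unshift m (linOp l α c (comp 0 a.1)))⁻¹ :=
        ((RatPS.linOp l α c (hxN _)).unshift m).inv hΛ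
      refine (h1.mul h2).congr fun a => ?_
      have h3 : comp 1 a.1 * linOp l α c (comp 0 a.1) * (comp 0 a.1)⁻¹ * comp 0 a.1
          = X ^ m * (comp 1 a.1 * unshift m (linOp l α c (comp 0 a.1))) := by
        rw [mul_assoc _ _ (comp 0 a.1), PowerSeries.inv_mul_cancel _ (hp a), mul_one]
        nth_rewrite 1 [← hsplit a]
        ring
      rw [h3, unshift_X_pow_mul, mul_assoc, PowerSeries.mul_inv_cancel _ (hΛ a), mul_one]
    rintro ⟨k, i⟩
    fin_cases k
    · exact hx i
    · by_cases hi : (i : ℕ) < r + 1 - m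
      · exact (hq i hi).congr fun a => (coeff_comp 1 a.1 i).symm
      · refine (RatGen.coord (Sum.inr (some ⟨r + 1 - i, by omega⟩))).congr fun a => ?_
        simp only [hu, Sum.elim_inr, Option.elim]
        exact congrArg (fun i => a.1 (1, i)) (Fin.ext (by simp only; omega))

/-- The increase of codimension inside the smallest of the sets `logDerivSet l α c r m`. -/
theorem imageCodim_le_of_logFlat_last (l : ℂ) {α : ℂ} (hα : α ≠ 0) (c : ℂ) {r : ℕ}
    {S : Set (Jet (r + 1))} (hS : IsPreirreducible S)
    (hz : ∀ v, chart (r + 1) (false, false) v ∈ S → LogFlat l α c (r + 1) v)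
    (hg : MvPolynomial.X (0, 0) ∉ chartIdeal S (false, false)) :
    imageCodim (eqThree l α) c r S ≤ codim S + r := by
  have hp : ∀ a : {a : Coord (r + 1) // chart (r + 1) (false, false) a ∈ S ∧
      MvPolynomial.eval a (MvPolynomial.X (0, 0)) ≠ 0}, constantCoeff (comp 0 a.1) ≠ 0 := by
    intro a
    rw [comp, constantCoeff_ser]
    simpa using a.2.2
  -- The `r`-jet of `x̄` is zero and carries no information on `y`, so all `r + 2` coefficients of
  -- `y` are further functions. The top coefficient of `x` is not needed: it is a multiple of `x₀`.
  -- This is why the increase is `r` rather than `r + 1`.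
  refine imageCodim_le_codim_add (E := eqThree l α) (c := c) hS hg r
    (ρ := Fin (r + 1 + 1)) (by simp) (fun i => (1, i)) (false, false)
    (fun a => pack (fun _ => 0) (trc r (comp 0 a))) ?_ ?_ ?_
  · intro a ha hag
    have h0 := hp ⟨a, ha, hag⟩
    refine ⟨_, _, _, coe_ne_zero.2 (ne_zero_of_constantCoeff h0), (chart_eq_jet a).symm,
      (eqThree_iff l α c h0 _ _).2 rfl, ?_⟩
    rw [jet_coe_coe]
    congr 2
    funext i
    have hlop := (logFlat_iff l hα c le_rfl (coeff_comp 0 a)).1 (hz a ha)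
    exact (X_pow_dvd_iff.1 (((X_pow_dvd_iff.2 hlop).mul_left _).mul_right _) i i.2).symm
  · rintro ⟨k, i⟩
    fin_cases k
    · exact (RatGen.const 0).congr fun a => pack_zero _ _ i
    · exact (RatGen.coord (0, i.castSucc)).congr fun a =>
        (pack_one _ _ i).trans (coeff_comp 0 a.1 i.castSucc)
  · have h0 : ∀ i : Fin (r + 1), RatGen (fun a : {a : Coord (r + 1) //
        chart (r + 1) (false, false) a ∈ S ∧ MvPolynomial.eval a (MvPolynomial.X (0, 0)) ≠ 0} =>
        Sum.elim (pack (fun _ => (0 : ℂ)) (trc r (comp 0 a.1))) fun i => a.1 (1, i))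
        fun a => a.1 (0, i.castSucc) := fun i =>
      (RatGen.coord (Sum.inl (1, i))).congr fun a => by
        rw [Sum.elim_inl, pack_one]
        exact (coeff_comp 0 a.1 i.castSucc).symm
    rintro ⟨k, i⟩
    fin_cases k
    · rcases Fin.eq_castSucc_or_eq_last i with ⟨i, rfl⟩ | rfl
      · exact h0 i
      · exact ((RatGen.const _).mul (h0 0)).congr fun a => hz a.1 a.2.1 (Fin.last r) (by simp)
    · exact (RatGen.coord (Sum.inr i)).congr fun a => rfl

theorem onlyAccessibleBlowDowns_eqThree (l : ℂ) {α : ℂ} (hα : α ≠ 0) (c : ℂ) :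
    OnlyAccessibleBlowDowns (eqThree l α) c (fun r => r + 1) (logDerivSet l α c) := by
  classical
  refine ⟨fun r m hr hm hmr => ⟨isBlowDown_logDerivSet l hα c hr hm hmr, ?_,
    (logDerivSet_isSubvariety l hα c hmr).2⟩, ?_⟩
  · rw [logDerivSet_eq l hα c hmr]
    -- No iteration is needed: the solution of `L(x) = 0` is itself a regular nonzero initial value
    -- lying in all these sets.
    refine ⟨(linSol l α c : PowerSeries ℂ), (linSol l α c : PowerSeries ℂ), .init _ _ _ ?_ ?_,
      _, fun i _ => ?_, (jet_coe_coe _ _ _).symm⟩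
    iterate 2
      refine ⟨⟨_, rfl⟩, ?_⟩
      have := coeff_coe_nat (linSol l α c) 0
      rw [Nat.cast_zero] at this
      rw [this]
      simp [constantCoeff_linSol]
    simp [trc, constantCoeff_linSol]
  rintro r S ⟨hS, hlt⟩ ⟨x, y, hxy, hj⟩
  obtain ⟨p, q, rfl, rfl, hp, -⟩ := exists_of_accessible_eqThree l hα hxy
  have hne := exists_chart_of_accessible hj
  have hirr := hS.1.2
  have hg0 : MvPolynomial.X (0, 0) ∉ chartIdeal S (false, false) := by
    intro h
    rw [jet_coe_coe] at hj
    have := mem_chartIdeal.1 h _ hj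
    exact hp (by simpa [trc] using this)
  let Q : ℕ → Prop := fun m => ∀ v, chart (r + 1) (false, false) v ∈ S → LogFlat l α c m v
  have hstep : ∀ m, ∀ hm : m < r + 1, Q m →
      flatPoly l α c r ⟨m, hm⟩ ∈ chartIdeal S (false, false) → Q (m + 1) := by
    intro m hm hQ h v hv i hi
    rcases Nat.lt_succ_iff_lt_or_eq.1 hi with hi | hi
    · exact hQ v hv i hi
    · obtain rfl : i = ⟨m, hm⟩ := Fin.ext hi
      exact (eval_flatPoly l α c _ v).1 (mem_chartIdeal.1 h v hv)
  have hQ0 : Q 0 := fun v _ i hi => (Nat.not_lt_zero _ hi).elim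
  have hQ1 : Q 1 := by
    by_contra hc
    refine not_le_of_gt hlt ?_
    simpa using imageCodim_le_of_logFlat l hα c (Nat.succ_pos r) hirr hQ0 hg0 fun h =>
      hc (hstep 0 _ hQ0 h)
  set m := Nat.findGreatest Q (r + 1) with hm
  have hm1 : 1 ≤ m := Nat.le_findGreatest (by omega) hQ1
  have hmr : m ≤ r + 1 := Nat.findGreatest_le _
  have hQm : Q m := Nat.findGreatest_spec (P := Q) (m := 1) (by omega) hQ1
  refine ⟨m, hm1, ⟨⟨hmr, (subset_closure_logDerivSet_iff l hα c hmr hirr hne).2 hQm⟩,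
    fun k hk => ?_⟩, ?_⟩
  · exact Nat.le_findGreatest hk.1
      ((subset_closure_logDerivSet_iff l hα c hk.1 hirr hne).1 hk.2)
  have h1 := le_imageCodim_logDerivSet l hα c hm1 hmr
  -- For `m ≤ r` the maximality of `m` makes the next flatness equation nonzero on `S`; for `m = r +
  -- 1` there is no next equation and the bound is `r`.
  have h2 : imageCodim (eqThree l α) c r S ≤ codim S + (min m r : ℕ) := by
    rcases hmr.lt_or_eq with hlt' | heq
    · rw [min_eq_left (by omega)]
      refine imageCodim_le_of_logFlat l hα c hlt' hirr hQm hg0 fun h => ?_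
      have := Nat.le_findGreatest (P := Q) (n := r + 1) (by omega) (hstep m hlt' hQm h)
      omega
    · have hQr : Q (r + 1) := heq ▸ hQm
      rw [min_eq_right (by omega)]
      exact imageCodim_le_of_logFlat_last l hα c hirr hQr hg0
  calc imageCodim (eqThree l α) c r S + m ≤ (codim S + (min m r : ℕ)) + m := by gcongr
    _ = codim S + ((m + min m r : ℕ) : ℕ∞) := by push_cast; ring
    _ ≤ _ := by gcongr

end DelayPainleve

end

theorem lemma3p1 :
    (∀ a b c : ℂ, b ≠ 0 →
      DelayPainleve.OnlyAccessibleBlowDowns (DelayPainleve.eqOne a b) c (fun r => r + 2)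
        DelayPainleve.zeroSet) ∧
    (∀ p q c : ℂ, q ≠ 0 →
      DelayPainleve.OnlyAccessibleBlowDowns (DelayPainleve.eqTwo p q) c (fun r => r + 2)
        DelayPainleve.zeroSet) ∧
    (∀ l α c : ℂ, α ≠ 0 →
      DelayPainleve.OnlyAccessibleBlowDowns (DelayPainleve.eqThree l α) c (fun r => r + 1)
        (DelayPainleve.logDerivSet l α c)) :=
  ⟨fun a _ c hb => DelayPainleve.onlyAccessibleBlowDowns_eqOne a hb c,
    fun p _ c hq => DelayPainleve.onlyAccessibleBlowDowns_eqTwo p hq c,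
    fun l _ c hα => DelayPainleve.onlyAccessibleBlowDowns_eqThree l hα c⟩
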